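/- Fix a finite alphabet $\Sigma$ and an integer $k\ge 2$. All machines are nondeterministic Turing machines with a two-way read-only input tape, finitely many work tapes on which only $O(\log n)$ cells are visited on inputs of length $n$, a one-way write-only output tape, and computation branches of polynomially bounded length. $\#\mathsf L$ is the class of functions $\varphi:\Sigma^*\to\mathbb N$ such that $\varphi(x)$ is the number of accepting branches of some such machine on input $x$. A language $L\subseteq\Sigma^*$ is in $\mathsf{coMod}_k\mathsf L$ (respectively, in $\mathsf{Mod}_k\mathsf L$) if there is $\varphi\in\#\mathsf L$ such that $x\in L$ if and only if $\varphi(x)\equiv 0 \pmod k$ (respectively, $\varphi(x)\not\equiv 0\pmod k$). A partial function $f:\Sigma^*\rightharpoonup\Sigma^*$ is in $\mathsf{FUL}[k]$ if there is such a machine for which, for all $x,y\in\Sigma^*$, the number of accepting branches on input $x$ with $y$ on the output tape is $\equiv 1\pmod k$ if $x\in\operatorname{dom}(f)$ and $y=f(x)$, and is $\equiv 0\pmod k$ otherwise. An oracle machine with function oracle $f:\Sigma^*\rightharpoonup\Sigma^*$ has in addition one oracle tape, not counted in the space bound. The machine writes a query $q$ on it symbol by symbol, submits it, and then has two-way read-only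 access to $f(q)$ on that tape until the next query is begun, when the answer is erased; a branch which submits $q\notin\operatorname{dom}(f)$ ends without accepting. From the step which writes the first symbol of a query until the query is submitted, the machine acts deterministically (the Ruzzo–Simon–Tompa convention). The classes $\mathsf{Mod}_k\mathsf L^{\mathsf{FUL}[k]}$, $\mathsf{coMod}_k\mathsf L^{\mathsf{FUL}[k]}$ and $\mathsf{FUL}[k]^{\mathsf{FUL}[k]}$ are defined like $\mathsf{Mod}_k\mathsf L$, $\mathsf{coMod}_k\mathsf L$ and $\mathsf{FUL}[k]$, but by oracle machines with one oracle $f\in\mathsf{FUL}[k]$, with the resource bounds required for that oracle. Then $$\mathsf{Mod}_k\mathsf L^{\mathsf{FUL}[k]}=\mathsf{Mod}_k\mathsf L,\qquad \mathsf{coMod}_k\mathsf L^{\mathsf{FUL}[k]}=\mathsf{coMod}_k\mathsf L,\qquad \mathsf{FUL}[k]^{\mathsf{FUL}[k]}=\mathsf{FUL}[k].$$ Moreover, for every $f\in\mathsf{FUL}[k]$ and every such oracle machine $M$ with oracle $f$ there is such a machine $N$ without oracle which, on every input $x$, has modulo $k$ as many accepting branches as $M$ has with oracle $f$, and also, for every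 $y\in\Sigma^*$, modulo $k$ as many accepting branches with output $y$. -/

import Mathlib

namespace ModLog

/-- Moves of a tape head. -/
inductive Move
  | left
  | stay
  | right

/-- New position of a head on a tape with cells `0, 1, 2, …` (a left move on cell `0` has no
effect). -/
def Move.apply : Move → ℕ → ℕ
  | .left, p => p - 1
  | .stay, p => p
  | .right, p => p + 1

/-- Symbols seen on a read-only tape: a letter, or one of the two end markers. -/
inductive Marked (A : Type)
  | lend
  | sym (a : A)
  | rend

/-- The symbol in cell `p` of a read-only tape holding `w`: cell `0` holds the left end marker,
cells `1, …, |w|` hold the letters of `w`, and cell `|w| + 1` holds the right end marker. -/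
def readCell {A : Type} (w : List A) : ℕ → Marked A
  | 0 => .lend
  | p + 1 => match w[p]? with
    | some a => .sym a
    | none => .rend

/-- Movement of a head on a read-only tape holding `w`; it never leaves the cells
`0, …, |w| + 1`. -/
def moveOn {A : Type} (w : List A) (d : Move) (p : ℕ) : ℕ :=
  min (d.apply p) (w.length + 1)

/-- Partial functions `A* ⇀ A*`: `f x = none` means that `x` is not in the domain of `f`. -/
abbrev PartialFun (A : Type) := List A → Option (List A)

/-- What a single step may do with the oracle tape. -/
inductive OracleAct (A : Type)
  /-- leave the oracle tape alone -/
  | idle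
  /-- append a letter to the query (starting a new query if an answer is on the tape) -/
  | write (a : A)
  /-- submit the query -/
  | query
  /-- move the read head on the answer -/
  | move (d : Move)

/-- Contents of the oracle tape.  There is a single tape, which holds either a (write-only) query
under construction, or the (two-way, read-only) answer to the last query together with the position
of the read head.  The answer disappears when the next query is begun. -/
inductive OracleTape (A : Type)
  | writing (q : List A)
  | answer (v : List A) (pos : ℕ)

/-- The query word that is currently on the oracle tape. -/
def OracleTape.queryWord {A : Type} : OracleTape A → List A
  | .writing q => q
  | .answer _ _ => []

/-- The symbol scanned on the oracle tape; nothing is scanned while a query is being written. -/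
def OracleTape.scan {A : Type} : OracleTape A → Option (Marked A)
  | .writing _ => none
  | .answer v p => some (readCell v p)

/-- Effect of a step on the oracle tape, for the oracle function `f`.  A query outside the domain
of `f` is never answered. -/
def OracleTape.act {A : Type} (f : PartialFun A) : OracleAct A → OracleTape A →
    Option (OracleTape A)
  | .idle, t => some t
  | .write a, t => some (.writing (t.queryWord ++ [a]))
  | .query, t => (f t.queryWord).map fun v => .answer v 0
  | .move _, .writing q => some (.writing q)
  | .move d, .answer v p => some (.answer v (moveOn v d p))

/-- The instructions of a machine: new state, movement of the input head, symbols written on the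
work tapes, movements of the work heads, action on the oracle tape, and possibly a letter which is
appended to the (write-only) output tape. -/
structure Action (A State Sym Tape : Type) where
  next : State
  inMove : Move
  write : Tape → Sym
  workMove : Tape → Move
  oracle : OracleAct A
  out : Option A

/-- Nondeterministic multi-tape Turing machines over the alphabet `A`, with a two-way read-only
input tape, finitely many read-write work tapes, an oracle tape and a one-way write-only output
tape.  The transition relation `δ` gives the set of instructions allowed for each state, scanned
input symbol, tuple of scanned work symbols, and scanned symbol of the oracle tape. -/
structure Machine (A : Type) where
  State : Type
  Sym : Type
  Tape : Type
  finiteState : Finite State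
  finiteSym : Finite Sym
  finiteTape : Finite Tape
  blank : Sym
  start : State
  accept : Set State
  δ : State → Marked A → (Tape → Sym) → Option (Marked A) → Set (Action A State Sym Tape)

namespace Machine

variable {A : Type} (M : Machine A)

/-- The instructions of `M`. -/
abbrev Act := Action A M.State M.Sym M.Tape

/-- Configurations of `M`. -/
structure Config where
  state : M.State
  inPos : ℕ
  work : M.Tape → ℕ → M.Sym
  head : M.Tape → ℕ
  oracle : OracleTape A
  out : List A

/-- The initial configuration. -/
def init : M.Config where
  state := M.start
  inPos := 0
  work := fun _ _ => M.blank
  head := fun _ => 0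
  oracle := .writing []
  out := []

/-- The instructions which the transition relation allows in configuration `c` on input `x`. -/
def enabled (x : List A) (c : M.Config) : Set M.Act :=
  M.δ c.state (readCell x c.inPos) (fun i => c.work i (c.head i)) c.oracle.scan

/-- The configuration reached from `c` by an instruction, on input `x` and with oracle `f`
(there is none if the instruction asks a query outside the domain of `f`). -/
def step (f : PartialFun A) (x : List A) (c : M.Config) (a : M.Act) : Option M.Config :=
  (c.oracle.act f a.oracle).map fun o =>
    { state := a.next
      inPos := moveOn x a.inMove c.inPos
      work := fun i => Function.update (c.work i) (c.head i) (a.write i)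
      head := fun i => (a.workMove i).apply (c.head i)
      oracle := o
      out := c.out ++ a.out.toList }

/-- `M.Run f x c l c'`: executing the instructions `l` one after the other leads from `c` to `c'`,
on input `x` and with oracle `f`. -/
inductive Run (f : PartialFun A) (x : List A) : M.Config → List M.Act → M.Config → Prop
  | nil (c : M.Config) : Run f x c [] c
  | cons {c c' c'' : M.Config} {a : M.Act} {l : List M.Act} (ha : a ∈ M.enabled x c)
      (hs : M.step f x c a = some c') (hr : Run f x c' l c'') : Run f x c (a :: l) c''

/-- Configurations that occur in some computation of `M` on input `x` with oracle `f`. -/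
def Reachable (f : PartialFun A) (x : List A) (c : M.Config) : Prop :=
  ∃ l, M.Run f x M.init l c

/-- Accepting configurations: no instruction is allowed, and the state is accepting. -/
def Accepting (x : List A) (c : M.Config) : Prop :=
  M.enabled x c = ∅ ∧ c.state ∈ M.accept

/-- The number of accepting branches of `M` on input `x` with oracle `f`. -/
noncomputable def acc (f : PartialFun A) (x : List A) : ℕ :=
  {l : List M.Act | ∃ c, M.Run f x M.init l c ∧ M.Accepting x c}.ncard

/-- The number of accepting branches of `M` on input `x` with oracle `f` which have `y` on the
output tape. -/
noncomputable def accOut (f : PartialFun A) (x y : List A) : ℕ :=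
  {l : List M.Act | ∃ c, M.Run f x M.init l c ∧ M.Accepting x c ∧ c.out = y}.ncard

/-- On inputs of length `n`, only `O(log n)` cells of each work tape are visited. -/
def LogSpace (f : PartialFun A) : Prop :=
  ∃ C : ℕ, ∀ x c, M.Reachable f x c → ∀ i, c.head i < C * (Nat.log 2 x.length + 1)

/-- All computation branches, accepting or not, have polynomially bounded length. -/
def PolyTime (f : PartialFun A) : Prop :=
  ∃ C : ℕ, ∀ x l c, M.Run f x M.init l c → l.length ≤ C * x.length ^ C + C

/-- The Ruzzo-Simon-Tompa condition on space-bounded nondeterministic oracle machines: from the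
step which writes the first letter of a query until the query is submitted, the machine acts
deterministically. -/
def DeterministicQueries (f : PartialFun A) : Prop :=
  ∀ x c, M.Reachable f x c →
    (c.oracle.queryWord ≠ [] ∨ ∃ a ∈ M.enabled x c, ∃ s, a.oracle = .write s) →
      (M.enabled x c).Subsingleton

/-- `M` is a nondeterministic logspace oracle machine, when it is run with oracle `f`. -/
def IsLogSpaceMachine (f : PartialFun A) : Prop :=
  M.LogSpace f ∧ M.PolyTime f ∧ M.DeterministicQueries f

/-- `M` never uses its oracle tape: it is an ordinary Turing machine. -/
def OracleFree : Prop :=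
  ∀ q s w o, ∀ a ∈ M.δ q s w o, a.oracle = .idle

end Machine

/-- The oracle that never answers; used to run ordinary machines. -/
def noOracle (A : Type) : PartialFun A := fun _ => none

/-- `M` is an ordinary nondeterministic logspace Turing machine. -/
def IsNLMachine {A : Type} (M : Machine A) : Prop :=
  M.OracleFree ∧ M.IsLogSpaceMachine (noOracle A)

/-- The class `#L`. -/
def SharpL (A : Type) : Set (List A → ℕ) :=
  {φ | ∃ M : Machine A, IsNLMachine M ∧ ∀ x, φ x = M.acc (noOracle A) x}

/-- The class `#L^f`. -/
def SharpLRel {A : Type} (f : PartialFun A) : Set (List A → ℕ) :=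
  {φ | ∃ M : Machine A, M.IsLogSpaceMachine f ∧ ∀ x, φ x = M.acc f x}

/-- The class `Mod_k L`. -/
def ModL (k : ℕ) (A : Type) : Set (Language A) :=
  {L | ∃ φ ∈ SharpL A, ∀ x, x ∈ L ↔ ¬ φ x ≡ 0 [MOD k]}

/-- The class `coMod_k L`. -/
def coModL (k : ℕ) (A : Type) : Set (Language A) :=
  {L | ∃ φ ∈ SharpL A, ∀ x, x ∈ L ↔ φ x ≡ 0 [MOD k]}

/-- The class `Mod_k L^𝓕`, for a class `𝓕` of function oracles. -/
def ModLRel (k : ℕ) {A : Type} (𝓕 : Set (PartialFun A)) : Set (Language A) :=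
  {L | ∃ f ∈ 𝓕, ∃ φ ∈ SharpLRel f, ∀ x, x ∈ L ↔ ¬ φ x ≡ 0 [MOD k]}

/-- The class `coMod_k L^𝓕`, for a class `𝓕` of function oracles. -/
def coModLRel (k : ℕ) {A : Type} (𝓕 : Set (PartialFun A)) : Set (Language A) :=
  {L | ∃ f ∈ 𝓕, ∃ φ ∈ SharpLRel f, ∀ x, x ∈ L ↔ φ x ≡ 0 [MOD k]}

/-- `M` with oracle `f` computes the partial function `g` modulo `k`: the number of accepting
branches with output `y` is `1` modulo `k` if `y = g x`, and `0` modulo `k` for all other `y`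
(for all `y` whatsoever if `x` is not in the domain of `g`). -/
def ComputesMod (k : ℕ) {A : Type} (M : Machine A) (f g : PartialFun A) : Prop :=
  ∀ x y, (g x = some y → M.accOut f x y ≡ 1 [MOD k]) ∧
    (g x ≠ some y → M.accOut f x y ≡ 0 [MOD k])

/-- The class `FUL[k]`. -/
def FUL (k : ℕ) (A : Type) : Set (PartialFun A) :=
  {g | ∃ M : Machine A, IsNLMachine M ∧ ComputesMod k M (noOracle A) g}

/-- The class `FUL[k]^𝓕`, for a class `𝓕` of function oracles. -/
def FULRel (k : ℕ) {A : Type} (𝓕 : Set (PartialFun A)) : Set (PartialFun A) :=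
  {g | ∃ f ∈ 𝓕, ∃ M : Machine A, M.IsLogSpaceMachine f ∧ ComputesMod k M f g}

end ModLog

namespace ModLog

/-! Neither a query nor its answer fits into logarithmic space, so the simulating machine stores
neither of them and recomputes their letters on demand. While the oracle machine `M` writes a query
it is deterministic. Hence it suffices to keep the first letter of the query and the configuration
reached right after it; any later letter is found by rerunning `M` from a copy of that configuration
(`Den.readQ_eq`). Whenever cell `p` of an answer is scanned, a machine `F` computing `f` modulo `k`
is run on the query recomputed in this way, only the letter of its output in cell `p` is remembered,
and the simulation continues from every accepting branch of `F`.

This nondeterministic subroutine is correct because counting is linear. Attach to a configuration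
the formal sum, in `List A →₀ ZMod k`, of the outputs of its accepting branches (`Machine.dist`). If
all working registers are erased after the call, what follows depends on the output `y` of `F` only
through the symbol in cell `p` of `y`. The total weight is therefore the sum over `y` of the number
of branches of `F` with output `y`, times the weight of continuing with that symbol. Modulo `k`
these numbers are `1` for `y = f q` and `0` otherwise: wrong outputs are not avoided, they cancel,
and if `f q` is undefined everything cancels, as a refused query should (`Den.oracleSym_eq`,
`Den.iter_mainStep_eq_zero`). Induction on the length of branches shows that `M` and its simulation
have the same distribution modulo `k` (`Den.iter_mainStep`), which gives both kinds of counts at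
once.

To obtain a Turing machine, the simulation is written as a program over finitely many polynomially
bounded registers, each tape of `M` and `F` being coded by two numbers used as stacks. The meaning
of a program (`Den`) maps the weights of its exits to a total weight; `Real` says that a one-tape
fragment implements it in polynomial time. Registers have `width n` digits in a large base, digits
of equal place sharing a tape cell, so that arithmetic is done by finite transducers walking along
the tape. `Real.exists_machine` turns such a program into a logspace machine with the same
distribution. The converse inclusions of classes use the nowhere defined oracle. -/

instance : Finite Move :=
  Finite.of_injective
    (fun m : Move => match m with | .left => (0 : Fin 3) | .stay => 1 | .right => 2)
    (by intro a b; cases a <;> cases b <;> simp)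

instance {A : Type} [Finite A] : Finite (Marked A) :=
  Finite.of_injective
    (fun m : Marked A => match m with
      | .lend => (none : Option (Option A)) | .rend => some none | .sym a => some (some a))
    (by intro a b; cases a <;> cases b <;> simp)

instance {A : Type} [Finite A] : Finite (OracleAct A) :=
  Finite.of_injective
    (fun m : OracleAct A => match m with
      | .idle => (Sum.inl none : Option A ⊕ Option Move) | .write a => Sum.inl (some a)
      | .query => Sum.inr none | .move d => Sum.inr (some d))
    (by intro a b; cases a <;> cases b <;> simp)

instance {A S G T : Type} [Finite A] [Finite S] [Finite G] [Finite T] :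
    Finite (Action A S G T) :=
  Finite.of_injective
    (fun a : Action A S G T => (a.next, a.inMove, a.write, a.workMove, a.oracle, a.out))
    (by rintro ⟨⟩ ⟨⟩; simp)

instance {A : Type} [Finite A] (M : Machine A) : Finite M.Act :=
  haveI := M.finiteState; haveI := M.finiteSym; haveI := M.finiteTape
  inferInstanceAs (Finite (Action A M.State M.Sym M.Tape))

/-! ### Branch counts as values of an output distribution -/

namespace Machine

variable {A : Type} [Finite A] (R : Type) [CommSemiring R] (M : Machine A) (f : PartialFun A)
  (x : List A)

/-- The enabled instructions, as a finset. -/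
noncomputable def choices (c : M.Config) : Finset M.Act := (M.enabled x c).toFinite.toFinset

variable {M x} in
@[simp] theorem mem_choices {c : M.Config} {a : M.Act} :
    a ∈ M.choices x c ↔ a ∈ M.enabled x c := by
  simp [choices]

open Classical in
/-- The distribution of the outputs of the accepting branches of length less than the given bound
which start in a given configuration. -/
noncomputable def dist : ℕ → M.Config → (List A →₀ R)
  | 0, _ => 0
  | j + 1, c => (if M.Accepting x c then Finsupp.single c.out 1 else 0) +
      ∑ a ∈ M.choices x c, (M.step f x c a).elim 0 fun c' => dist j c'

-- A branch is its first instruction followed by a branch of the successor, which that instruction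
-- determines; so the sets of branches decompose disjointly, in step with the recursion for `dist`.
-- Both acceptance counts are instances: `φ` is evaluation at `y`, or the total mass.
open Classical in
theorem exists_branches (P : List A → Prop) (φ : (List A →₀ R) →+ R)
    (hφ : ∀ o, φ (Finsupp.single o 1) = if P o then 1 else 0) (j : ℕ) (c : M.Config)
    (hj : ∀ l c', M.Run f x c l c' → l.length < j) :
    ∃ S : Finset (List M.Act),
      (∀ l, l ∈ S ↔ ∃ c', M.Run f x c l c' ∧ M.Accepting x c' ∧ P c'.out) ∧
      (S.card : R) = φ (M.dist R f x j c) := by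
  induction j generalizing c with
  | zero => exact absurd (hj [] c (.nil c)) (by simp)
  | succ j ih =>
    have key : ∀ a : M.Act, ∃ S : Finset (List M.Act), a ∈ M.choices x c →
        (∀ l, l ∈ S ↔ ∃ c₁ c', M.step f x c a = some c₁ ∧ M.Run f x c₁ l c' ∧
          M.Accepting x c' ∧ P c'.out) ∧
        (S.card : R) = φ ((M.step f x c a).elim 0 fun c' => M.dist R f x j c') := by
      intro a
      cases hs : M.step f x c a with
      | none => exact ⟨∅, fun _ => by simp⟩
      | some c₁ =>
        by_cases ha : a ∈ M.choices x c
        · obtain ⟨S, h1, h2⟩ := ih c₁ fun l c' hr => by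
            have := hj (a :: l) c' (.cons (mem_choices.1 ha) hs hr)
            simpa using this
          exact ⟨S, fun _ => ⟨fun l => by simp [h1], by simpa using h2⟩⟩
        · exact ⟨∅, fun h => absurd h ha⟩
    choose S hS using key
    refine ⟨(if M.Accepting x c ∧ P c.out then {[]} else ∅) ∪
      (M.choices x c).biUnion fun a => (S a).image (List.cons a), ?_, ?_⟩
    · intro l
      rw [Finset.mem_union, Finset.mem_biUnion]
      constructor
      · rintro (h | ⟨a, ha, h⟩)
        · split_ifs at h with hc
          · rw [Finset.mem_singleton] at h
            subst h
            exact ⟨c, .nil c, hc⟩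
          · simp at h
        · obtain ⟨l', hl', rfl⟩ := Finset.mem_image.1 h
          obtain ⟨c₁, c', h1, h2, h3⟩ := ((hS a ha).1 l').1 hl'
          exact ⟨c', .cons (mem_choices.1 ha) h1 h2, h3⟩
      · rintro ⟨c', hr, h⟩
        cases hr with
        | nil => left; rw [if_pos h]; simp
        | @cons _ c₁ _ a l' ha hs hr =>
          right
          exact ⟨a, mem_choices.2 ha, Finset.mem_image_of_mem _
            (((hS a (mem_choices.2 ha)).1 l').2 ⟨c₁, c', hs, hr, h⟩)⟩
    · rw [Finset.card_union_of_disjoint, Finset.card_biUnion, dist, map_add, map_sum,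
        Nat.cast_add, Nat.cast_sum]
      · congr 1
        · by_cases h1 : M.Accepting x c <;> by_cases h2 : P c.out <;> simp [h1, h2, hφ]
        · refine Finset.sum_congr rfl fun a ha => ?_
          rw [Finset.card_image_of_injective _ (List.cons_injective), (hS a ha).2]
      · intro a _ b _ hab
        refine Finset.disjoint_left.2 ?_
        intro l h1 h2
        obtain ⟨l1, -, rfl⟩ := Finset.mem_image.1 h1
        obtain ⟨l2, -, h⟩ := Finset.mem_image.1 h2
        exact hab (List.cons.inj h).1.symm
      · rw [Finset.disjoint_left]
        intro l h1 h2
        obtain ⟨a, -, h2⟩ := Finset.mem_biUnion.1 h2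
        obtain ⟨l', -, rfl⟩ := Finset.mem_image.1 h2
        split_ifs at h1 <;> simp at h1

theorem accOut_eq_dist (j : ℕ) (hj : ∀ l c', M.Run f x M.init l c' → l.length < j)
    (y : List A) : (M.accOut f x y : R) = M.dist R f x j M.init y := by
  classical
  obtain ⟨S, h1, h2⟩ := M.exists_branches R f x (· = y) (Finsupp.applyAddHom y)
    (fun o => by simp [Finsupp.single_apply]) j M.init hj
  have : {l : List M.Act | ∃ c, M.Run f x M.init l c ∧ M.Accepting x c ∧ c.out = y} = S := by
    ext l; simp [h1]
  rw [accOut, this, Set.ncard_coe_finset, h2]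
  rfl

theorem acc_eq_dist (j : ℕ) (hj : ∀ l c', M.Run f x M.init l c' → l.length < j) :
    (M.acc f x : R) = (M.dist R f x j M.init).sum fun _ r => r := by
  classical
  obtain ⟨S, h1, h2⟩ := M.exists_branches R f x (fun _ => True)
    (Finsupp.liftAddHom fun _ => AddMonoidHom.id R)
    (fun o => by simp) j M.init hj
  have : {l : List M.Act | ∃ c, M.Run f x M.init l c ∧ M.Accepting x c} = S := by
    ext l; simp [h1]
  rw [acc, this, Set.ncard_coe_finset, h2]
  rfl

end Machine
end ModLog

/-! ### Program fragments and their weighted evaluation -/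

namespace ModLog

/-- Memory of a one-tape machine whose work tape has the alphabet `Option Γ`. -/
structure Mem (A Γ : Type) where
  pos : ℕ
  work : ℕ → Option Γ
  head : ℕ
  out : List A

/-- The deterministic part of a step of a one-tape machine. -/
structure Instr (A Γ : Type) where
  inMove : Move
  write : Option Γ
  workMove : Move
  out : Option A

/-- Effect of an instruction on the memory. -/
def Instr.apply {A Γ : Type} (x : List A) (i : Instr A Γ) (m : Mem A Γ) : Mem A Γ where
  pos := moveOn x i.inMove m.pos
  work := Function.update m.work m.head i.write
  head := i.workMove.apply m.head
  out := m.out ++ i.out.toList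

/-- Program fragments with exits labelled by `α`.  In each control point an instruction is executed,
and the next control point is chosen nondeterministically from a finite set. -/
structure Frag (A Γ α : Type) where
  Pt : Type
  finitePt : Finite Pt
  entry : Pt
  trans : Pt → Marked A → Option Γ → Instr A Γ × Finset (Pt ⊕ α)

variable {A Γ α β W : Type} [AddCommMonoid W]

/-- `Ev F x sp X q m t w`: all branches of `F` starting at `q` with memory `m` end or leave the
fragment within `t` steps, with the head staying in the cells `0, …, sp`, and the sum of the weights
assigned by `X` to the exits is `w`. -/
inductive Ev (F : Frag A Γ α) (x : List A) (sp : ℕ) (X : α → Mem A Γ → W → Prop) :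
    F.Pt ⊕ α → Mem A Γ → ℕ → W → Prop
  | exit {a : α} {m : Mem A Γ} {w : W} (t : ℕ) (h : X a m w) : Ev F x sp X (.inr a) m t w
  | step {p : F.Pt} {m : Mem A Γ} {t : ℕ} (i : Instr A Γ) (S : Finset (F.Pt ⊕ α))
      (ws : F.Pt ⊕ α → W)
      (htrans : F.trans p (readCell x m.pos) (m.work m.head) = (i, S))
      (hh : m.head ≤ sp)
      (h : ∀ q ∈ S, Ev F x sp X q (i.apply x m) t (ws q)) :
      Ev F x sp X (.inl p) m (t + 1) (∑ q ∈ S, ws q)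

theorem Ev.det {F : Frag A Γ α} {x : List A} {sp : ℕ} {X : α → Mem A Γ → W → Prop}
    {p : F.Pt} {m m' : Mem A Γ} {t : ℕ} {w : W} (i : Instr A Γ) (q : F.Pt ⊕ α)
    (htrans : F.trans p (readCell x m.pos) (m.work m.head) = (i, {q}))
    (hh : m.head ≤ sp) (hm : i.apply x m = m') (h : Ev F x sp X q m' t w) :
    Ev F x sp X (.inl p) m (t + 1) w := by
  have := Ev.step i {q} (fun _ => w) htrans hh (X := X) (t := t) (by
    intro q' hq'
    rw [Finset.mem_singleton.1 hq', hm]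
    exact h)
  simpa using this

theorem Ev.mono {F : Frag A Γ α} {x : List A} {sp : ℕ} {X Y : α → Mem A Γ → W → Prop}
    {q : F.Pt ⊕ α} {m : Mem A Γ} {t t' : ℕ} {w : W} (h : Ev F x sp X q m t w) (ht : t ≤ t')
    (hXY : ∀ a m w, X a m w → Y a m w) : Ev F x sp Y q m t' w := by
  induction h generalizing t' with
  | exit t h => exact .exit _ (hXY _ _ _ h)
  | step i S ws htrans hh h ih =>
    obtain ⟨t', rfl⟩ : ∃ s, t' = s + 1 := ⟨t' - 1, by omega⟩
    exact .step i S ws htrans hh fun q hq => ih q hq (by omega)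

/-- All ways of combining fragments rename control points. A derivation is transported along the
renaming and prolonged at its exits by derivations in `G`; injectivity keeps different choices apart
and hence preserves the weights. -/
theorem Ev.embed {F : Frag A Γ α} {G : Frag A Γ β} {x : List A} {sp : ℕ}
    {X : α → Mem A Γ → W → Prop} {Y : β → Mem A Γ → W → Prop} {t' : ℕ}
    (φ : F.Pt ⊕ α ↪ G.Pt ⊕ β)
    (hφ : ∀ p, ∃ p', φ (.inl p) = .inl p' ∧
      ∀ i s, G.trans p' i s = ((F.trans p i s).1, (F.trans p i s).2.map φ))
    (hX : ∀ a m w, X a m w → Ev G x sp Y (φ (.inr a)) m t' w)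
    {q : F.Pt ⊕ α} {m : Mem A Γ} {t : ℕ} {w : W} (h : Ev F x sp X q m t w) :
    Ev G x sp Y (φ q) m (t + t') w := by
  induction h with
  | exit t h => exact (hX _ _ _ h).mono (by omega) fun _ _ _ h => h
  | @step p m t i S ws htrans hh h ih =>
    obtain ⟨p', hp', htr⟩ := hφ p
    rw [hp']
    -- The value `0` outside the range of `φ` is arbitrary: the sum runs over `S.map φ` only.
    have := Ev.step (F := G) (X := Y) (p := p') (m := m) (x := x) (sp := sp) (t := t + t')
      i (S.map φ) (fun q => Function.extend φ ws 0 q) (by rw [htr, htrans]) hh (by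
        intro q hq
        obtain ⟨q', hq', rfl⟩ := Finset.mem_map.1 hq
        rw [φ.injective.extend_apply]
        exact ih q' hq')
    rw [Finset.sum_map] at this
    simp only [φ.injective.extend_apply] at this
    convert this using 1
    omega

/-- Control points and exits of the first part of a sequential composition. -/
def seqEmb {P S : Type} (e : α ↪ S) : P ⊕ α ↪ (P ⊕ S) ⊕ β where
  toFun
    | .inl p => .inl (.inl p)
    | .inr a => .inl (.inr (e a))
  inj' := by rintro (p | a) (p' | a') h <;> simp_all

/-- Control points and exits of the second part of a sequential composition. -/
def sndEmb {P : Type} {S : α → Type} (a : α) : S a ⊕ β ↪ (P ⊕ Σ a, S a) ⊕ β where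
  toFun
    | .inl p => .inl (.inr ⟨a, p⟩)
    | .inr b => .inr b
  inj' := by rintro (p | b) (p' | b') h <;> simp_all

/-- Control points and exits of the body of a loop. -/
def bodyEmb {δ : Type} {S : δ → Type} (d : δ) : S d ⊕ (δ ⊕ β) ↪ (δ ⊕ Σ d, S d) ⊕ β where
  toFun
    | .inl p => .inl (.inr ⟨d, p⟩)
    | .inr (.inl d') => .inl (.inl d')
    | .inr (.inr b) => .inr b
  inj' := by rintro (p | a | a) (p' | a' | a') h <;> simp_all

namespace Frag

/-- The entry points of a family of fragments. -/
def entryEmb (G : α → Frag A Γ β) : α ↪ Σ a, (G a).Pt where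
  toFun a := ⟨a, (G a).entry⟩
  inj' _ _ h := (Sigma.mk.inj h).1

/-- Run `F`, and continue with `G a` at its exit `a`. -/
def bind [Finite α] (F : Frag A Γ α) (G : α → Frag A Γ β) : Frag A Γ β where
  Pt := F.Pt ⊕ Σ a, (G a).Pt
  finitePt := by
    have := F.finitePt
    have := fun a => (G a).finitePt
    infer_instance
  entry := .inl F.entry
  trans
    | .inl p, i, s => ((F.trans p i s).1, (F.trans p i s).2.map (seqEmb (entryEmb G)))
    | .inr ⟨a, p⟩, i, s => (((G a).trans p i s).1, ((G a).trans p i s).2.map (sndEmb a))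

theorem bind_ev [Finite α] {F : Frag A Γ α} {G : α → Frag A Γ β} {x : List A} {sp : ℕ}
    {X : α → Mem A Γ → W → Prop} {Y : β → Mem A Γ → W → Prop} {t t' : ℕ}
    (hX : ∀ a m w, X a m w → Ev (G a) x sp Y (.inl (G a).entry) m t' w)
    {m : Mem A Γ} {w : W} (h : Ev F x sp X (.inl F.entry) m t w) :
    Ev (F.bind G) x sp Y (.inl (F.bind G).entry) m (t + t') w := by
  refine Ev.embed (G := F.bind G) (t' := t') (seqEmb (entryEmb G)) ?_ ?_ h
  · exact fun p => ⟨_, rfl, fun _ _ => rfl⟩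
  · intro a m w hx
    have := Ev.embed (G := F.bind G) (t' := 0) (Y := Y)
      (sndEmb (P := F.Pt) (S := fun a => (G a).Pt) a) ?_ ?_ (hX a m w hx)
    · exact this
    · exact fun p => ⟨_, rfl, fun _ _ => rfl⟩
    · exact fun a m w h => .exit _ h

/-- Run `F d`, repeatedly: an exit `inl d'` leads to `F d'`. -/
def loop {δ : Type} [Finite δ] (F : δ → Frag A Γ (δ ⊕ β)) (d : δ) : Frag A Γ β where
  Pt := δ ⊕ Σ d, (F d).Pt
  finitePt := by
    have := fun a => (F a).finitePt
    infer_instance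
  entry := .inl d
  trans
    | .inl d, _, s => (⟨.stay, s, .stay, none⟩, {.inl (.inr ⟨d, (F d).entry⟩)})
    | .inr ⟨d, p⟩, i, s => (((F d).trans p i s).1, ((F d).trans p i s).2.map (bodyEmb d))

/-- This covers a single round. The evaluation of the following rounds enters as `hX`, so that
termination is left to an induction carried out by the user of the loop. -/
theorem loop_ev {δ : Type} [Finite δ] {F : δ → Frag A Γ (δ ⊕ β)} {d₀ d : δ} {x : List A} {sp : ℕ}
    {X : δ ⊕ β → Mem A Γ → W → Prop} {Y : β → Mem A Γ → W → Prop} {t t' : ℕ}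
    (hX : ∀ d' m w, X (.inl d') m w → Ev (loop F d₀) x sp Y (.inl (.inl d')) m t' w)
    (hX' : ∀ b m w, X (.inr b) m w → Y b m w)
    {m : Mem A Γ} {w : W} (hm : m.head ≤ sp) (hpos : m.pos ≤ x.length + 1)
    (h : Ev (F d) x sp X (.inl (F d).entry) m t w) :
    Ev (loop F d₀) x sp Y (.inl (.inl d)) m (t + t' + 1) w := by
  refine Ev.det (F := loop F d₀) ⟨.stay, m.work m.head, .stay, none⟩
    (.inl (.inr ⟨d, (F d).entry⟩)) rfl hm (m' := m) ?_ ?_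
  · cases m
    simp [Instr.apply, moveOn, Move.apply] at hpos ⊢
    exact hpos
  · refine Ev.embed (G := loop F d₀) (t' := t') (bodyEmb (S := fun d => (F d).Pt) d) ?_ ?_ h
    · exact fun p => ⟨_, rfl, fun _ _ => rfl⟩
    · rintro (d' | b) m w h
      · exact hX _ _ _ h
      · exact .exit _ (hX' _ _ _ h)

/-- A single step, which does not depend on the work tape. -/
def act (g : Marked A → Move × Option A × Finset α) : Frag A Γ α where
  Pt := Unit
  finitePt := inferInstance
  entry := ()
  trans _ i s := (⟨(g i).1, s, .stay, (g i).2.1⟩, (g i).2.2.map ⟨Sum.inr, Sum.inr_injective⟩)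

theorem act_ev {g : Marked A → Move × Option A × Finset α} {x : List A} {sp : ℕ}
    {X : α → Mem A Γ → W → Prop} {m : Mem A Γ} (ws : α → W) (hm : m.head ≤ sp)
    (h : ∀ a ∈ (g (readCell x m.pos)).2.2, X a
      { m with
        pos := moveOn x (g (readCell x m.pos)).1 m.pos
        out := m.out ++ (g (readCell x m.pos)).2.1.toList } (ws a)) :
    Ev (act g) x sp X (.inl ()) m 1 (∑ a ∈ (g (readCell x m.pos)).2.2, ws a) := by
  have := Ev.step (F := act g) (X := X) (p := ()) (m := m) (x := x) (sp := sp) (t := 0) _ _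
    (Sum.elim 0 ws) rfl hm (by
      intro q hq
      obtain ⟨a, ha, rfl⟩ := Finset.mem_map.1 hq
      refine .exit _ ?_
      convert h a ha using 1
      · simp [Instr.apply, Move.apply]
      · rfl)
  have hs : (∑ q ∈ (g (readCell x m.pos)).2.2.map ⟨Sum.inr, Sum.inr_injective⟩,
      Sum.elim (0 : Unit → W) ws q) = ∑ a ∈ (g (readCell x m.pos)).2.2, ws a :=
    Finset.sum_map ..
  rw [← hs]
  exact this

end Frag

/-! ### Transducer passes over the work tape -/

/-- Work tape holding the word `ws` in the cells `1, 2, …`; the other cells are blank. -/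
def tapeOf (ws : List Γ) : ℕ → Option Γ
  | 0 => none
  | j + 1 => ws[j]?

theorem tapeOf_append_cons (pre ws : List Γ) (c : Γ) :
    tapeOf (pre ++ c :: ws) (pre.length + 1) = some c := by
  simp [tapeOf]

theorem update_tapeOf (pre ws : List Γ) (c c' : Γ) :
    Function.update (tapeOf (pre ++ c :: ws)) (pre.length + 1) (some c') =
      tapeOf (pre ++ c' :: ws) := by
  funext j
  rcases j with - | j
  · simp [tapeOf]
  · by_cases h : j = pre.length
    · subst h; simp [tapeOf]
    · rw [Function.update_of_ne (by omega)]
      simp only [tapeOf, List.getElem?_append]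
      split_ifs
      · rfl
      · obtain ⟨i, hi⟩ : ∃ i, j - pre.length = i + 1 := ⟨j - pre.length - 1, by omega⟩
        simp [hi]

theorem update_tapeOf_end (ws : List Γ) (o : Option Γ) :
    Function.update (tapeOf ws) (ws.length + 1) o = tapeOf (ws ++ o.toList) := by
  funext j
  rcases j with - | j
  · simp [tapeOf]
  · by_cases h : j = ws.length
    · subst h; cases o <;> simp [tapeOf]
    · rw [Function.update_of_ne (by omega)]
      simp only [tapeOf, List.getElem?_append]
      split_ifs with h1
      · rfl
      · have : j - ws.length ≠ 0 := by omega
        rw [List.getElem?_eq_none (by omega)]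
        cases o <;> simp [this]

/-- Run a transducer from left to right. -/
def runR {Q : Type} (g : Q → Γ → Γ × Q) : Q → List Γ → List Γ × Q
  | q, [] => ([], q)
  | q, c :: ws => ((g q c).1 :: (runR g (g q c).2 ws).1, (runR g (g q c).2 ws).2)

/-- Run a transducer from right to left. -/
def runL {Q : Type} (g : Q → Γ → Γ × Q) (q : Q) : List Γ → List Γ × Q
  | [] => ([], q)
  | c :: ws => ((g (runL g q ws).2 c).1 :: (runL g q ws).1, (g (runL g q ws).2 c).2)

theorem runR_length {Q : Type} (g : Q → Γ → Γ × Q) (q : Q) (ws : List Γ) :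
    (runR g q ws).1.length = ws.length := by
  induction ws generalizing q <;> simp_all [runR]

theorem runL_append {Q : Type} (g : Q → Γ → Γ × Q) (q : Q) (ws : List Γ) (c : Γ) :
    runL g q (ws ++ [c]) =
      ((runL g (g q c).2 ws).1 ++ [(g q c).1], (runL g (g q c).2 ws).2) := by
  induction ws <;> simp_all [runL]

namespace Frag
variable {Q₁ Q₂ : Type} [Finite Q₁] [Finite Q₂]

/-- Run a transducer from left to right over the word on the work tape, possibly append a letter,
and run another transducer from right to left over the original part. -/
def trip (g₁ : Q₁ → Γ → Γ × Q₁) (turn : Q₁ → Option Γ × Q₂) (g₂ : Q₂ → Γ → Γ × Q₂) (q₀ : Q₁) :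
    Frag A Γ Q₂ where
  Pt := Option (Q₁ ⊕ Q₂)
  finitePt := inferInstance
  entry := none
  trans
    | none, _, s => (⟨.stay, s, .right, none⟩, {.inl (some (.inl q₀))})
    | some (.inl q), _, some c =>
      (⟨.stay, some (g₁ q c).1, .right, none⟩, {.inl (some (.inl (g₁ q c).2))})
    | some (.inl q), _, none =>
      (⟨.stay, (turn q).1, .left, none⟩, {.inl (some (.inr (turn q).2))})
    | some (.inr q), _, some c =>
      (⟨.stay, some (g₂ q c).1, .left, none⟩, {.inl (some (.inr (g₂ q c).2))})
    | some (.inr q), _, none => (⟨.stay, none, .stay, none⟩, {.inr q})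

variable {g₁ : Q₁ → Γ → Γ × Q₁} {turn : Q₁ → Option Γ × Q₂} {g₂ : Q₂ → Γ → Γ × Q₂} {q₀ : Q₁}
  {x : List A} {sp : ℕ} {X : Q₂ → Mem A Γ → W → Prop} {pos : ℕ} {out : List A} {w : W}

/-- The head arrives from the right, so the induction removes the last letter; letters already
treated accumulate in `post`. -/
theorem trip_left (hpos : pos ≤ x.length + 1) (ws post : List Γ) (q : Q₂) (hsp : ws.length ≤ sp)
    (h : X (runL g₂ q ws).2 ⟨pos, tapeOf ((runL g₂ q ws).1 ++ post), 0, out⟩ w) :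
    Ev (trip g₁ turn g₂ q₀) x sp X (.inl (some (.inr q)))
      ⟨pos, tapeOf (ws ++ post), ws.length, out⟩ (ws.length + 1) w := by
  induction ws using List.reverseRecOn generalizing post q with
  | nil =>
    refine Ev.det (F := trip g₁ turn g₂ q₀) _ (.inr q) rfl hsp ?_ (.exit _ h)
    simp [Instr.apply, moveOn, Move.apply, hpos, runL, tapeOf]
  | append_singleton ws c ih =>
    rw [runL_append] at h
    rw [List.length_append] at hsp
    simp only [List.length_append, List.length_singleton, List.append_assoc,
      List.singleton_append]
    have hc : tapeOf (ws ++ c :: post) (ws.length + 1) = some c := tapeOf_append_cons ..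
    refine Ev.det (F := trip g₁ turn g₂ q₀) ⟨.stay, some (g₂ q c).1, .left, none⟩
      (.inl (some (.inr (g₂ q c).2))) ?_ hsp rfl ?_
    · simp only [hc]; rfl
    · have := ih ((g₂ q c).1 :: post) (g₂ q c).2 (by omega) (by simpa using h)
      convert this using 1
      simp [Instr.apply, moveOn, Move.apply, hpos, update_tapeOf]

theorem trip_right (hpos : pos ≤ x.length + 1) (pre ws : List Γ) (q : Q₁)
    (hsp : pre.length + ws.length + 1 ≤ sp) {t : ℕ}
    (h : Ev (trip g₁ turn g₂ q₀) x sp X (.inl (some (.inl (runR g₁ q ws).2)))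
      ⟨pos, tapeOf (pre ++ (runR g₁ q ws).1), pre.length + ws.length + 1, out⟩ t w) :
    Ev (trip g₁ turn g₂ q₀) x sp X (.inl (some (.inl q)))
      ⟨pos, tapeOf (pre ++ ws), pre.length + 1, out⟩ (t + ws.length) w := by
  induction ws generalizing pre q with
  | nil => simpa [runR] using h
  | cons c ws ih =>
    have hc : tapeOf (pre ++ c :: ws) (pre.length + 1) = some c := tapeOf_append_cons ..
    simp only [List.length_cons] at hsp
    refine Ev.det (F := trip g₁ turn g₂ q₀) ⟨.stay, some (g₁ q c).1, .right, none⟩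
      (.inl (some (.inl (g₁ q c).2))) ?_ (by simp; omega) rfl ?_
    · simp only [hc]; rfl
    · have := ih (pre ++ [(g₁ q c).1]) (g₁ q c).2 (by simp; omega) (by
        simp only [List.length_append, List.length_singleton, List.append_assoc,
          List.singleton_append]
        simp only [runR, List.length_cons] at h
        convert h using 2
        omega)
      convert this using 1
      · simp [Instr.apply, moveOn, Move.apply, hpos, update_tapeOf]
      · rfl

/-- The blank cell `0` marks the left end, and the first blank after the word marks the right end,
which is why `sp` exceeds the length of the word. The time is one step off cell `0`, `|ws|` steps to
the right, one turn, and `|ws| + 1` steps back and out. -/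
theorem trip_ev (hpos : pos ≤ x.length + 1) (ws ws' ws'' : List Γ) (o : Option Γ)
    (q₁ : Q₁) (q₂ q₂' : Q₂) (hsp : ws.length + 1 ≤ sp)
    (h₁ : runR g₁ q₀ ws = (ws', q₁)) (ht : turn q₁ = (o, q₂))
    (h₂ : runL g₂ q₂ ws' = (ws'', q₂'))
    (h : X q₂' ⟨pos, tapeOf (ws'' ++ o.toList), 0, out⟩ w) :
    Ev (trip g₁ turn g₂ q₀) x sp X (.inl none)
      ⟨pos, tapeOf ws, 0, out⟩ (2 * ws.length + 3) w := by
  have hl : ws'.length = ws.length := by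
    have := runR_length g₁ q₀ ws
    rwa [h₁] at this
  have hsp' : ws'.length ≤ sp := by omega
  refine Ev.det (F := trip g₁ turn g₂ q₀) ⟨.stay, none, .right, none⟩
      (.inl (some (.inl q₀))) rfl (by simp) rfl ?_
  have key := trip_right (g₁ := g₁) (turn := turn) (g₂ := g₂) (q₀ := q₀) (X := X) (out := out)
    (w := w) (t := ws.length + 2) hpos [] ws q₀ (by simpa using hsp) (by
      rw [h₁]
      simp only [List.length_nil, Nat.zero_add, List.nil_append]
      refine Ev.det (F := trip g₁ turn g₂ q₀) ⟨.stay, o, .left, none⟩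
        (.inl (some (.inr q₂))) ?_ (by simpa using hsp) rfl ?_
      · have : tapeOf ws' (ws.length + 1) = none := by simp [tapeOf, hl]
        simp only [this]
        simp only [trip, ht]
        rfl
      · have := trip_left (g₁ := g₁) (turn := turn) (g₂ := g₂) (q₀ := q₀) (X := X) (out := out)
          (w := w) hpos ws' o.toList q₂ hsp' (by rw [h₂]; exact h)
        convert this using 1 <;> simp only [hl]
        rw [← hl, ← update_tapeOf_end]
        simp [Instr.apply, moveOn, Move.apply, hpos])
  convert key using 1
  · simp [Instr.apply, moveOn, Move.apply, hpos]
    rfl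
  · omega

/-! ### From fragments to machines -/

/-- The one-tape machine which runs a fragment and accepts at its exit. -/
def toMachine [Finite Γ] (F : Frag A Γ Unit) : Machine A where
  State := F.Pt ⊕ Unit
  Sym := Option Γ
  Tape := Unit
  finiteState := by have := F.finitePt; infer_instance
  finiteSym := inferInstance
  finiteTape := inferInstance
  blank := none
  start := .inl F.entry
  accept := {.inr ()}
  δ
    | .inl p, i, s, _ => {a | ∃ q ∈ (F.trans p i (s ())).2, a =
        ⟨q, (F.trans p i (s ())).1.inMove, fun _ => (F.trans p i (s ())).1.write,
          fun _ => (F.trans p i (s ())).1.workMove, .idle, (F.trans p i (s ())).1.out⟩}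
    | .inr _, _, _, _ => ∅

/-- The configuration of `F.toMachine` with given control point and memory. -/
def config [Finite Γ] (F : Frag A Γ Unit) (q : F.Pt ⊕ Unit) (m : Mem A Γ) : F.toMachine.Config where
  state := q
  inPos := m.pos
  work := fun _ => m.work
  head := fun _ => m.head
  oracle := .writing []
  out := m.out

theorem toMachine_oracleFree [Finite Γ] (F : Frag A Γ Unit) : F.toMachine.OracleFree := by
  rintro (p | u) s w o a ha
  · obtain ⟨q, -, rfl⟩ := ha
    rfl
  · cases ha

variable [Finite Γ] {R : Type} [CommSemiring R]

theorem toMachine_step (F : Frag A Γ Unit) (f : PartialFun A) (x : List A) (q : F.Pt ⊕ Unit)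
    (m : Mem A Γ) (i : Instr A Γ) (s : F.Pt ⊕ Unit) :
    F.toMachine.step f x (F.config s m)
      ⟨q, i.inMove, fun _ => i.write, fun _ => i.workMove, .idle, i.out⟩ =
      some (F.config q (i.apply x m)) := by
  simp [Machine.step, config, OracleTape.act, Instr.apply]
  rfl

/-- Any run, accepting or not, follows a path in the derivation of `Ev`. This yields the time bound
and the space bound for all reachable configurations. -/
theorem ev_run {F : Frag A Γ Unit} {f : PartialFun A} {x : List A} {sp : ℕ}
    {q : F.Pt ⊕ Unit} {m : Mem A Γ} {t : ℕ} {w : List A →₀ R}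
    (h : Ev F x sp (fun _ m w => m.head ≤ sp ∧ w = Finsupp.single m.out 1) q m t w)
    {l : List F.toMachine.Act} {c : F.toMachine.Config}
    (hr : F.toMachine.Run f x (F.config q m) l c) :
    l.length ≤ t ∧ ∃ q' m', c = F.config q' m' ∧ m'.head ≤ sp := by
  induction h generalizing l with
  | exit t h =>
    cases hr with
    | nil => exact ⟨Nat.zero_le _, _, _, rfl, h.1⟩
    | cons ha => cases ha
  | @step p m t i S ws htrans hh h ih =>
    cases hr with
    | nil => exact ⟨Nat.zero_le _, _, _, rfl, hh⟩
    | cons ha hs hr =>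
      obtain ⟨q, hq, rfl⟩ := ha
      change q ∈ (F.trans p (readCell x m.pos) (m.work m.head)).2 at hq
      have hs' := toMachine_step F f x q m
        (F.trans p (readCell x m.pos) (m.work m.head)).1 (.inl p)
      have := Option.some.inj (hs.symm.trans hs')
      subst this
      rw [htrans] at hq hr
      obtain ⟨h1, h2⟩ := ih q hq hr
      exact ⟨Nat.succ_le_succ h1, h2⟩

-- The weight derived by `Ev` is the output distribution. The bound is `t + 1` because `dist` counts
-- branches of length strictly less than its bound.
open Classical in
theorem ev_dist [Finite A] {F : Frag A Γ Unit} {f : PartialFun A} {x : List A} {sp : ℕ}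
    {q : F.Pt ⊕ Unit} {m : Mem A Γ} {t : ℕ} {w : List A →₀ R}
    (h : Ev F x sp (fun _ m w => m.head ≤ sp ∧ w = Finsupp.single m.out 1) q m t w) :
    F.toMachine.dist R f x (t + 1) (F.config q m) = w := by
  induction h with
  | @exit a m w t h =>
    have he : F.toMachine.enabled x (F.config (.inr a) m) = ∅ := rfl
    have hc : F.toMachine.choices x (F.config (.inr a) m) = ∅ := by
      ext; simp [he]
    rw [Machine.dist, hc, if_pos ⟨he, rfl⟩, h.2]
    simp [config]
  | @step p m t i S ws htrans hh h ih =>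
    have hc : F.toMachine.choices x (F.config (.inl p) m) = S.image fun q =>
        ⟨q, i.inMove, fun _ => i.write, fun _ => i.workMove, .idle, i.out⟩ := by
      ext a
      rw [Machine.mem_choices, Finset.mem_image]
      change (∃ q ∈ (F.trans p (readCell x m.pos) (m.work m.head)).2, a =
        ⟨q, (F.trans p (readCell x m.pos) (m.work m.head)).1.inMove,
          fun _ => (F.trans p (readCell x m.pos) (m.work m.head)).1.write,
          fun _ => (F.trans p (readCell x m.pos) (m.work m.head)).1.workMove, .idle,
          (F.trans p (readCell x m.pos) (m.work m.head)).1.out⟩) ↔ _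
      rw [htrans]
      exact ⟨fun ⟨q, h1, h2⟩ => ⟨q, h1, h2.symm⟩, fun ⟨q, h1, h2⟩ => ⟨q, h1, h2.symm⟩⟩
    rw [Machine.dist, hc, if_neg (fun h => Sum.inl_ne_inr h.2), zero_add,
      Finset.sum_image]
    · refine Finset.sum_congr rfl fun q hq => ?_
      rw [toMachine_step]
      exact ih q hq
    -- Different successors give different instructions, so no multiplicity is lost in passing to a
    -- set of instructions.
    · intro q _ q' _ h
      exact congrArg Action.next h

end Frag
end ModLog

/-! ### Arithmetic on words of digit vectors -/

namespace ModLog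

section Words

variable {H : Type} {β : ℕ} [NeZero β]

/-- The `w` least significant digits in base `β` of the numbers `ρ h`, as a word of vectors. -/
def word (β : ℕ) [NeZero β] : ℕ → (H → ℕ) → List (H → Fin β)
  | 0, _ => []
  | w + 1, ρ => (fun h => Fin.ofNat β (ρ h)) :: word β w fun h => ρ h / β

theorem word_length (w : ℕ) (ρ : H → ℕ) : (word β w ρ).length = w := by
  induction w generalizing ρ <;> simp_all [word]

theorem word_zero (w : ℕ) : word β w (fun _ : H => 0) = List.replicate w fun _ => 0 := by
  induction w with
  | zero => rfl
  | succ w ih =>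
    simp only [word, Nat.zero_div, ih, List.replicate_succ]
    congr 1

/-- Overflow of a register is reduction modulo `β ^ w`, so the transducers may be described by
arithmetic with unbounded numbers. -/
theorem word_congr {w : ℕ} {ρ ρ' : H → ℕ} (h : ∀ i, ρ i % β ^ w = ρ' i % β ^ w) :
    word β w ρ = word β w ρ' := by
  induction w generalizing ρ ρ' with
  | zero => rfl
  | succ w ih =>
    rw [word, word, ih (ρ := fun i => ρ i / β) (ρ' := fun i => ρ' i / β)]
    · congr 1
      funext i
      ext
      have := congrArg (· % β) (h i)
      simpa [Nat.mod_mod_of_dvd _ (dvd_pow_self β (Nat.succ_ne_zero w))] using this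
    · intro i
      rw [← Nat.mod_mul_right_div_self, ← Nat.mod_mul_right_div_self, ← pow_succ', h i]

/-- Transducer which multiplies by `b` and adds the carry. -/
def affineStep (b : H → ℕ) (K : ℕ) (q : H → Fin (K + 1)) (c : H → Fin β) :
    (H → Fin β) × (H → Fin (K + 1)) :=
  (fun h => Fin.ofNat β (b h * c h + q h), fun h => Fin.ofNat (K + 1) ((b h * c h + q h) / β))

/-- The carry never exceeds `K`, because `K * (β - 1) + K = K * β`; hence its reduction to `Fin (K +
1)` is harmless. -/
theorem runR_affine {b : H → ℕ} {K : ℕ} (hb : ∀ h, b h ≤ K) (w : ℕ) (q : H → Fin (K + 1))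
    (ρ : H → ℕ) :
    runR (affineStep b K) q (word β w ρ) = (word β w fun h => b h * ρ h + q h,
      fun h => Fin.ofNat (K + 1) ((b h * (ρ h % β ^ w) + q h) / β ^ w)) := by
  have hβ : 0 < β := NeZero.pos β
  induction w generalizing q ρ with
  | zero => simp [runR, word, Nat.mod_one]
  | succ w ih =>
    have hq : ∀ h, (b h * (ρ h % β) + q h) / β < K + 1 := by
      intro h
      rw [Nat.div_lt_iff_lt_mul hβ]
      have h1 := hb h
      have h2 : ρ h % β + 1 ≤ β := Nat.mod_lt _ hβ
      have h3 := (q h).2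
      nlinarith [Nat.mul_le_mul h1 h2]
    simp only [word, runR, ih, affineStep, Fin.val_ofNat]
    simp only [Nat.mod_eq_of_lt (hq _)]
    refine Prod.ext ?_ ?_
    · simp only [List.cons.injEq]
      constructor
      · funext h
        ext
        simp [Nat.add_mod, Nat.mul_mod]
      · congr 1
        funext h
        conv_rhs => rw [← Nat.div_add_mod (ρ h) β]
        rw [Nat.mul_add, Nat.mul_left_comm, Nat.add_assoc, Nat.mul_add_div hβ]
    · funext h
      simp only
      congr 1
      rw [pow_succ', Nat.mod_mul, ← Nat.div_div_eq_div_mul]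
      congr 1
      rw [Nat.mul_add, Nat.mul_left_comm, Nat.add_right_comm, Nat.add_comm,
        Nat.add_mul_div_left _ _ hβ]

/-- Transducer which divides by `b`, from the most significant digit on. -/
def divStep (b : H → ℕ) (K : ℕ) (q : H → Fin (K + 1)) (c : H → Fin β) :
    (H → Fin β) × (H → Fin (K + 1)) :=
  (fun h => Fin.ofNat β ((c h + β * q h) / b h), fun h => Fin.ofNat (K + 1) ((c h + β * q h) % b h))

/-- This is long division: the state is the current remainder, which is less than the divisor, so
each new quotient is a single digit. -/
theorem runL_div {b : H → ℕ} {K : ℕ} (hb : ∀ h, 1 ≤ b h ∧ b h ≤ K + 1) (w : ℕ) (ρ : H → ℕ) :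
    runL (divStep b K) (fun _ => 0) (word β w ρ) = (word β w fun h => ρ h % β ^ w / b h,
      fun h => Fin.ofNat (K + 1) (ρ h % β ^ w % b h)) := by
  have hβ : 0 < β := NeZero.pos β
  induction w generalizing ρ with
  | zero =>
    simp only [runL, word, pow_zero, Nat.mod_one, Nat.zero_mod]
    rfl
  | succ w ih =>
    have hr : ∀ h, ρ h / β % β ^ w % b h < K + 1 := fun h =>
      (Nat.mod_lt _ (hb h).1).trans_le (hb h).2
    have hv : ∀ h, ρ h % β ^ (w + 1) = b h * (β * (ρ h / β % β ^ w / b h)) +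
        (ρ h % β + β * (ρ h / β % β ^ w % b h)) := by
      intro h
      rw [pow_succ', Nat.mod_mul]
      conv_lhs => rw [← Nat.div_add_mod (ρ h / β % β ^ w) (b h)]
      ring
    have hd : ∀ h, (ρ h % β + β * (ρ h / β % β ^ w % b h)) / b h < β := by
      intro h
      rw [Nat.div_lt_iff_lt_mul (hb h).1]
      have h1 : ρ h / β % β ^ w % b h + 1 ≤ b h := Nat.mod_lt _ (hb h).1
      have h2 := Nat.mod_lt (ρ h) hβ
      nlinarith [Nat.mul_le_mul_left β h1]
    simp only [word, runL, ih, divStep, Fin.val_ofNat]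
    simp only [Nat.mod_eq_of_lt (hr _)]
    refine Prod.ext ?_ ?_
    · simp only [List.cons.injEq]
      constructor
      · funext h
        ext
        rw [hv, Nat.mul_add_div (hb h).1]
        simp
      · congr 1
        funext h
        rw [hv, Nat.mul_add_div (hb h).1, Nat.mul_add_div hβ, Nat.div_eq_of_lt (hd h), Nat.add_zero]
    · funext h
      simp only
      congr 1
      rw [hv, Nat.mul_add_mod]

/-- Transducer which subtracts the borrow. -/
def decStep (q : H → Fin 2) (c : H → Fin β) : (H → Fin β) × (H → Fin 2) :=
  (fun h => Fin.ofNat β (c h + β - q h), fun h => if (c h : ℕ) < q h then 1 else 0)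

/-- Taking `ρ + q` as the input avoids truncated subtraction; a register holding `0` is covered by
writing it as `β ^ w`, with the same digits. -/
theorem runR_dec (w : ℕ) (q : H → Fin 2) (ρ : H → ℕ) :
    (runR decStep q (word β w fun h => ρ h + q h)).1 = word β w ρ := by
  have hβ : 0 < β := NeZero.pos β
  induction w generalizing q ρ with
  | zero => rfl
  | succ w ih =>
    have hd : ∀ h, (ρ h + q h) / β = ρ h / β +
        ((if (Fin.ofNat β (ρ h + q h) : ℕ) < q h then 1 else 0 : Fin 2) : ℕ) ∧
        ((ρ h + q h) % β + β - q h) % β = ρ h % β := by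
      intro h
      have h1 := Nat.div_add_mod (ρ h) β
      have h2 := Nat.mod_lt (ρ h) hβ
      have h3 : (q h : ℕ) = 0 ∨ (q h : ℕ) = 1 := by have := (q h).2; omega
      rcases h3 with h3 | h3
      · simp [h3]
      · rw [h3]
        by_cases h4 : ρ h % β + 1 = β
        · have h5 : ρ h + 1 = β * (ρ h / β + 1) := by rw [Nat.mul_add]; omega
          have h6 : (ρ h + 1) % β = 0 := by rw [h5]; exact Nat.mul_mod_right _ _
          refine ⟨?_, ?_⟩
          · simp [h6]
            rw [h5, Nat.mul_div_cancel_left _ hβ]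
          · rw [h6, Nat.zero_add, Nat.mod_eq_of_lt (by omega)]
            omega
        · have h5 : ρ h + 1 = β * (ρ h / β) + (ρ h % β + 1) := by omega
          have h7 : ρ h % β + 1 < β := by omega
          have h6 : (ρ h + 1) % β = ρ h % β + 1 := by
            conv_lhs => rw [h5]
            rw [Nat.mul_add_mod, Nat.mod_eq_of_lt h7]
          refine ⟨?_, ?_⟩
          · simp [h6]
            conv_lhs => rw [h5]
            rw [Nat.mul_add_div hβ, Nat.div_eq_of_lt h7, Nat.add_zero]
          · rw [h6, show ρ h % β + 1 + β - 1 = ρ h % β + β by omega, Nat.add_mod_right,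
              Nat.mod_mod]
    simp only [word, runR, decStep, List.cons.injEq]
    constructor
    · funext h
      ext
      simpa using (hd h).2
    · simp only [(hd _).1]
      exact ih _ _

/-- Transducer which tests for zero. -/
def zeroStep (q : H → Bool) (c : H → Fin β) : (H → Fin β) × (H → Bool) :=
  (c, fun h => q h && decide ((c h : ℕ) = 0))

theorem runR_zero (w : ℕ) (q : H → Bool) (ρ : H → ℕ) :
    runR zeroStep q (word β w ρ) =
      (word β w ρ, fun h => q h && decide (ρ h % β ^ w = 0)) := by
  have hβ : 0 < β := NeZero.pos β
  induction w generalizing q ρ with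
  | zero => simp [runR, word, Nat.mod_one]
  | succ w ih =>
    simp only [word, runR, ih, zeroStep]
    refine Prod.ext rfl ?_
    funext h
    simp only [Fin.val_ofNat]
    rw [Bool.and_assoc, ← Bool.decide_and, pow_succ', Nat.mod_mul]
    congr 2
    simp only [Nat.add_eq_zero_iff, mul_eq_zero, hβ.ne', false_or]

/-- Transducer which copies or erases components. -/
def renStep (π : H → Option H) (q : Unit) (c : H → Fin β) : (H → Fin β) × Unit :=
  (fun h => (π h).elim 0 c, q)

theorem runR_ren (π : H → Option H) (w : ℕ) (ρ : H → ℕ) :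
    runR (renStep π) () (word β w ρ) = (word β w (fun h => (π h).elim 0 ρ), ()) := by
  induction w generalizing ρ with
  | zero => rfl
  | succ w ih =>
    simp only [word, runR, ih, renStep]
    refine Prod.ext ?_ rfl
    simp only [List.cons.injEq]
    constructor
    · funext h
      cases π h <;> simp
    · congr 1
      funext h
      cases π h <;> simp

theorem runL_id {Γ Q : Type} (q : Q) (ws : List Γ) : runL (fun q c => (c, q)) q ws = (ws, q) := by
  induction ws <;> simp_all [runL]

theorem runR_id {Γ Q : Type} (q : Q) (ws : List Γ) : runR (fun q c => (c, q)) q ws = (ws, q) := by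
  induction ws <;> simp_all [runR]

end Words

/-! ### Polynomial bounds -/

/-- Polynomially bounded functions. -/
def PolyBdd (g : ℕ → ℕ) : Prop := ∃ c, ∀ n, g n ≤ (n + 3) ^ c

namespace PolyBdd

theorem mono {g h : ℕ → ℕ} (hh : PolyBdd h) (hg : ∀ n, g n ≤ h n) : PolyBdd g :=
  hh.imp fun _ hc n => (hg n).trans (hc n)

theorem const (a : ℕ) : PolyBdd fun _ => a :=
  ⟨a, fun n => (Nat.lt_pow_self (by omega)).le⟩

theorem id : PolyBdd fun n => n := ⟨1, fun n => by simp⟩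

theorem add {g h : ℕ → ℕ} (hg : PolyBdd g) (hh : PolyBdd h) : PolyBdd fun n => g n + h n := by
  obtain ⟨c, hc⟩ := hg
  obtain ⟨d, hd⟩ := hh
  refine ⟨c + d + 1, fun n => ?_⟩
  have h1 : g n ≤ (n + 3) ^ (c + d) := (hc n).trans (Nat.pow_le_pow_right (by omega) (by omega))
  have h2 : h n ≤ (n + 3) ^ (c + d) := (hd n).trans (Nat.pow_le_pow_right (by omega) (by omega))
  rw [pow_succ]
  nlinarith [Nat.zero_le ((n + 3) ^ (c + d) * n)]

theorem mul {g h : ℕ → ℕ} (hg : PolyBdd g) (hh : PolyBdd h) : PolyBdd fun n => g n * h n := by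
  obtain ⟨c, hc⟩ := hg
  obtain ⟨d, hd⟩ := hh
  exact ⟨c + d, fun n => by rw [pow_add]; exact Nat.mul_le_mul (hc n) (hd n)⟩

theorem pow {g : ℕ → ℕ} (hg : PolyBdd g) (k : ℕ) : PolyBdd fun n => g n ^ k := by
  induction k with
  | zero => simpa using const 1
  | succ k ih => simpa [pow_succ] using ih.mul hg

theorem sum {ι : Type} (s : Finset ι) {g : ι → ℕ → ℕ} (hg : ∀ i, PolyBdd (g i)) :
    PolyBdd fun n => ∑ i ∈ s, g i n := by
  classical
  induction s using Finset.induction_on with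
  | empty => simpa using const 0
  | insert a s ha ih => simpa [Finset.sum_insert ha] using (hg a).add ih

/-- Tapes with logarithmically many visited cells are coded by numbers of this size; they are
polynomial since `b ≤ 2 ^ b` and `2 ^ (Nat.log 2 n + 1) ≤ 2 * n + 2`. -/
theorem pow_log (b C : ℕ) : PolyBdd fun n => b ^ (C * (Nat.log 2 n + 1)) := by
  refine (((id.mul (const 2)).add (const 2)).pow (b * C)).mono fun n => ?_
  have h1 : b ^ (C * (Nat.log 2 n + 1)) ≤ (2 ^ b) ^ (C * (Nat.log 2 n + 1)) :=
    Nat.pow_le_pow_left (Nat.lt_two_pow_self).le _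
  refine h1.trans ?_
  rw [← pow_mul, ← mul_assoc, mul_comm, pow_mul]
  refine Nat.pow_le_pow_left ?_ _
  rw [pow_succ]
  rcases Nat.eq_zero_or_pos n with rfl | hn
  · simp
  · have := Nat.pow_log_le_self 2 hn.ne'
    omega

/-- Back to the form of the bound in `Machine.PolyTime`: `n + 3 ≤ 4 * n` for `n > 0`, while the
summand `C` takes care of `n = 0`. -/
theorem exists_le {g : ℕ → ℕ} (hg : PolyBdd g) : ∃ C, ∀ n, g n ≤ C * n ^ C + C := by
  obtain ⟨c, hc⟩ := hg
  refine ⟨4 ^ c + c, fun n => (hc n).trans ?_⟩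
  rcases Nat.eq_zero_or_pos n with rfl | hn
  · have : 3 ^ c ≤ 4 ^ c := Nat.pow_le_pow_left (by omega) _
    simp only [Nat.zero_add]
    omega
  · have h1 : (n + 3) ^ c ≤ (4 * n) ^ c := Nat.pow_le_pow_left (by omega) _
    rw [mul_pow] at h1
    have h2 : n ^ c ≤ n ^ (4 ^ c + c) := Nat.pow_le_pow_right hn (Nat.le_add_left _ _)
    have h3 : 4 ^ c * n ^ c ≤ (4 ^ c + c) * n ^ (4 ^ c + c) := Nat.mul_le_mul (Nat.le_add_right _ _) h2
    exact (h1.trans h3).trans (Nat.le_add_right _ _)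

end PolyBdd
end ModLog

/-! ### Register programs and their realization -/

namespace ModLog

/-- Store of a register program: position of the input head, registers and output. -/
structure St (A U : Type) where
  pos : ℕ
  reg : U → ℕ
  out : List A

/-- Meaning of a nondeterministic register program with results in `α`: the total weight of its
branches, if the weights of the exits are given. -/
abbrev Den (A U W α : Type) := List A → St A U → (α → St A U → W) → W

/-- Number of digits of the registers. -/
def width (n : ℕ) : ℕ := Nat.log 2 (n + 2)

namespace Den

variable {A U W α δ : Type} [AddCommMonoid W]

/-- Return a result. -/
def pure (a : α) : Den A U W α := fun _ s k => k a s

/-- Sequential composition. -/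
def bind {α' : Type} (D : Den A U W α) (E : α → Den A U W α') : Den A U W α' :=
  fun x s k => D x s fun a s' => E a x s' k

/-- Read a symbol of the input, move the input head, write to the output, and choose a result. -/
def act (g : Marked A → Move × Option A × Finset α) : Den A U W α := fun x s k =>
  ∑ a ∈ (g (readCell x s.pos)).2.2, k a
    { s with
      pos := moveOn x (g (readCell x s.pos)).1 s.pos
      out := s.out ++ (g (readCell x s.pos)).2.1.toList }

/-- Apply affine maps to the registers. -/
def affine (b c : U → ℕ) : Den A U W Unit := fun _ s k =>
  k () { s with reg := fun u => b u * s.reg u + c u }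

/-- Divide the registers with remainder. -/
def divs (β K : ℕ) (b : U → ℕ) : Den A U W (U → Fin (K + 1)) := fun x s k =>
  k (fun u => Fin.ofNat (K + 1) (s.reg u % β ^ width x.length % b u))
    { s with reg := fun u => s.reg u % β ^ width x.length / b u }

/-- Decrease some registers by `1`. -/
def dec (β : ℕ) (S : U → Bool) : Den A U W Unit := fun x s k =>
  k () { s with reg := fun u => if S u then
            if s.reg u = 0 then β ^ width x.length - 1 else s.reg u - 1 else s.reg u }

/-- Test the registers for zero. -/
def zeros (β : ℕ) : Den A U W (U → Bool) := fun x s k =>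
  k (fun u => decide (s.reg u % β ^ width x.length = 0)) s

/-- Copy and erase registers. -/
def ren (π : U → Option U) : Den A U W Unit := fun _ s k =>
  k () { s with reg := fun u => (π u).elim 0 s.reg }

/-- Repeat a program a given number of times. -/
def iter (body : δ → Den A U W δ) : ℕ → δ → Den A U W δ
  | 0, d => pure d
  | j + 1, d => (body d).bind (iter body j)

/-- Repeat a program polynomially often. -/
def rep (β : ℕ) (body : δ → Den A U W δ) (d : δ) : Den A U W δ := fun x s k =>
  iter body (β ^ width x.length) d x s k

end Den

section Realizable

variable {A U W α : Type} [AddCommMonoid W] {β L : ℕ} [NeZero β]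

/-- The memory which represents a store; the registers `τ` are loop counters. -/
def memOf (β : ℕ) [NeZero β] (x : List A) (s : St A U) (τ : Fin L → ℕ) :
    Mem A (U ⊕ Fin L → Fin β) where
  pos := s.pos
  work := tapeOf (word β (width x.length) (Sum.elim s.reg τ))
  head := 0
  out := s.out

/-- `F` implements `D` in time `t`, using the loop counters below `ℓ`. -/
def Impl (ℓ : ℕ) (F : Frag A (U ⊕ Fin L → Fin β) α) (t : ℕ → ℕ) (D : Den A U W α) : Prop :=
  ∀ (x : List A) (X : α → Mem A (U ⊕ Fin L → Fin β) → W → Prop) (k : α → St A U → W)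
    (s : St A U) (τ : Fin L → ℕ), s.pos ≤ x.length + 1 → (∀ j, j.val < ℓ → τ j = 0) →
    (∀ a s', s'.pos ≤ x.length + 1 → X a (memOf β x s' τ) (k a s')) →
    Ev F x (width x.length + 1) X (.inl F.entry) (memOf β x s τ) (t x.length) (D x s k)

variable (β L) in
/-- Programs that are implemented by fragments in polynomial time. -/
def Real (ℓ : ℕ) (D : Den A U W α) : Prop :=
  ∃ (F : Frag A (U ⊕ Fin L → Fin β) α) (t : ℕ → ℕ), PolyBdd t ∧ Impl ℓ F t D

theorem polyBdd_width : PolyBdd width :=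
  (PolyBdd.id.add (PolyBdd.const 2)).mono fun n => Nat.log_le_self 2 (n + 2)

theorem polyBdd_pow_width (b : ℕ) : PolyBdd fun n => b ^ width n := by
  refine ((PolyBdd.id.add (PolyBdd.const 2)).pow b).mono fun n => ?_
  have h1 : b ^ width n ≤ (2 ^ b) ^ width n :=
    Nat.pow_le_pow_left (Nat.lt_two_pow_self).le _
  refine h1.trans ?_
  rw [← pow_mul, mul_comm, pow_mul]
  exact Nat.pow_le_pow_left (Nat.pow_log_le_self 2 (by omega)) _

theorem width_le (n : ℕ) : width n ≤ Nat.log 2 n + 2 := by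
  rcases Nat.eq_zero_or_pos n with rfl | hn
  · exact (Nat.log_le_self 2 2).trans (by omega)
  · have : n + 2 < 2 ^ (Nat.log 2 n + 3) := by
      have := Nat.lt_pow_succ_log_self (b := 2) (by omega) n
      rw [show Nat.log 2 n + 3 = (Nat.log 2 n).succ + 2 by omega, pow_add]
      omega
    exact Nat.lt_succ_iff.1 (Nat.log_lt_of_lt_pow (by omega) this)

/-- Numbers bounded by a power of `n + 3` fit into the registers, if the base is large. -/
theorem pow_le_pow_width (c n : ℕ) : (n + 3) ^ c ≤ (4 ^ c) ^ width n := by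
  rw [← pow_mul, mul_comm, pow_mul]
  refine Nat.pow_le_pow_left ?_ _
  have h1 : n + 2 < 2 ^ (width n + 1) := Nat.lt_pow_succ_log_self (by omega) _
  have h2 : 1 ≤ width n := Nat.log_pos (by omega) (by omega)
  have h3 : 2 ^ (width n + 1) ≤ 2 ^ (2 * width n) := Nat.pow_le_pow_right (by omega) (by omega)
  rw [pow_mul] at h3
  norm_num at h3
  omega

namespace Real

theorem mono {ℓ ℓ' : ℕ} {D : Den A U W α} (h : Real β L ℓ D) (hℓ : ℓ ≤ ℓ') : Real β L ℓ' D := by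
  obtain ⟨F, t, ht, hF⟩ := h
  exact ⟨F, t, ht, fun x X k s τ hs hτ => hF x X k s τ hs fun j hj => hτ j (hj.trans_le hℓ)⟩

/-- The weight prescribed at an exit of the first fragment is the value of the program that follows
it. Since there are finitely many exits, the times of all second parts can be added up. -/
theorem bind {α' : Type} [Finite α] {ℓ : ℕ} {D : Den A U W α} {E : α → Den A U W α'}
    (hD : Real β L ℓ D) (hE : ∀ a, Real β L ℓ (E a)) : Real β L ℓ (D.bind E) := by
  obtain ⟨F, t, ht, hF⟩ := hD
  choose G t' ht' hG using hE
  have := Fintype.ofFinite α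
  refine ⟨F.bind G, fun n => t n + ∑ a, t' a n, ht.add (PolyBdd.sum _ ht'), ?_⟩
  intro x X k s τ hs hτ h
  refine Frag.bind_ev (X := fun a m w => ∃ s' : St A U, s'.pos ≤ x.length + 1 ∧
    m = memOf β x s' τ ∧ w = E a x s' k) ?_ (hF x _ _ s τ hs hτ ?_)
  · rintro a m w ⟨s', hs', rfl, rfl⟩
    exact (hG a x X k s' τ hs' hτ h).mono
      (Finset.single_le_sum (f := fun a => t' a x.length) (fun _ _ => Nat.zero_le _)
        (Finset.mem_univ a)) fun _ _ _ h => h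
  · exact fun a s' hs' => ⟨s', hs', rfl, rfl⟩

theorem moveOn_le (x : List A) (d : Move) (p : ℕ) : moveOn x d p ≤ x.length + 1 :=
  min_le_right ..

theorem act {ℓ : ℕ} (g : Marked A → Move × Option A × Finset α) :
    Real β L ℓ (Den.act g : Den A U W α) := by
  refine ⟨Frag.act g, fun _ => 1, .const 1, fun x X k s τ hs hτ h => ?_⟩
  exact Frag.act_ev (m := memOf β x s τ) _ (Nat.zero_le _) fun a _ =>
    h a { s with
      pos := moveOn x (g (readCell x s.pos)).1 s.pos
      out := s.out ++ (g (readCell x s.pos)).2.1.toList } (moveOn_le ..)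

theorem pure {ℓ : ℕ} (a : α) : Real β L ℓ (Den.pure a : Den A U W α) := by
  refine ⟨Frag.act fun _ => (.stay, none, {a}), fun _ => 1, .const 1, fun x X k s τ hs hτ h => ?_⟩
  have := Frag.act_ev (g := fun _ => (Move.stay, (none : Option A), {a})) (m := memOf β x s τ)
    (sp := width x.length + 1) (x := x) (X := X) (fun _ => k a s) (Nat.zero_le _) (by
      intro a' ha'
      rw [Finset.mem_singleton.1 ha']
      convert h a s hs using 1
      simpa [moveOn, Move.apply, memOf] using hs)
  rw [Finset.sum_singleton] at this
  exact this

theorem map {α' : Type} [Finite α] {ℓ : ℕ} {D : Den A U W α} (hD : Real β L ℓ D) (f : α → α') :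
    Real β L ℓ (fun x s k => D x s fun a => k (f a)) :=
  hD.bind fun a => pure (f a)

/-- Every register instruction is one round trip over the digits. The loop counters `τ` lie on the
same tape, so the transducers have to leave them unchanged. -/
theorem of_trip {Q₁ Q₂ : Type} [Finite Q₁] [Finite Q₂] {ℓ : ℕ}
    (g₁ : Q₁ → (U ⊕ Fin L → Fin β) → (U ⊕ Fin L → Fin β) × Q₁) (turn : Q₁ → Q₂)
    (g₂ : Q₂ → (U ⊕ Fin L → Fin β) → (U ⊕ Fin L → Fin β) × Q₂) (q₀ : Q₁)
    (res : List A → St A U → Q₂) (reg : List A → St A U → U → ℕ)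
    (h : ∀ x s (τ : Fin L → ℕ), ∃ ws q₁,
      runR g₁ q₀ (word β (width x.length) (Sum.elim s.reg τ)) = (ws, q₁) ∧
      runL g₂ (turn q₁) ws = (word β (width x.length) (Sum.elim (reg x s) τ), res x s)) :
    Real β L ℓ (fun x s k => k (res x s) { s with reg := reg x s } : Den A U W Q₂) := by
  refine ⟨Frag.trip g₁ (fun q => (none, turn q)) g₂ q₀, fun n => 2 * width n + 3,
    ((PolyBdd.const 2).mul polyBdd_width).add (.const 3), fun x X k s τ hs hτ hX => ?_⟩
  obtain ⟨ws, q₁, h1, h2⟩ := h x s τ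
  have := Frag.trip_ev (turn := fun q => (none, turn q)) (X := X) (out := s.out)
    (sp := width x.length + 1) hs _ _ _ none _ _ _
    (by rw [word_length]) h1 rfl h2 (by
      simpa [memOf] using hX (res x s) { s with reg := reg x s } hs)
  rw [word_length] at this
  exact this

variable [Finite U]

theorem affine {ℓ : ℕ} (b c : U → ℕ) : Real β L ℓ (Den.affine b c : Den A U W Unit) := by
  have := Fintype.ofFinite U
  obtain ⟨K, hK⟩ : ∃ K, 1 ≤ K ∧ ∀ u, b u ≤ K ∧ c u ≤ K := by
    refine ⟨∑ u, b u + ∑ u, c u + 1, by omega, fun u => ?_⟩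
    have h1 := Finset.single_le_sum (f := b) (fun _ _ => Nat.zero_le _) (Finset.mem_univ u)
    have h2 := Finset.single_le_sum (f := c) (fun _ _ => Nat.zero_le _) (Finset.mem_univ u)
    omega
  refine of_trip (ℓ := ℓ) (affineStep (Sum.elim b fun _ => 1) K) (fun _ => ()) (fun q c => (c, q))
    (fun h => Fin.ofNat (K + 1) (Sum.elim c (fun _ => 0) h)) (fun _ _ => ())
    (fun _ s u => b u * s.reg u + c u) fun x s τ => ⟨_, _, runR_affine ?_ _ _ _, ?_⟩
  · rintro (u | j)
    · exact (hK.2 u).1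
    · exact hK.1
  · rw [runL_id]
    refine Prod.ext ?_ rfl
    simp only
    congr 1
    funext h
    rcases h with u | j
    · simp [Nat.mod_eq_of_lt (Nat.lt_succ_of_le (hK.2 u).2)]
    · simp

theorem divs {ℓ K : ℕ} {b : U → ℕ} (hb : ∀ u, 1 ≤ b u ∧ b u ≤ K + 1) :
    Real β L ℓ (Den.divs β K b : Den A U W _) := by
  refine (of_trip (ℓ := ℓ) (fun q c => (c, q)) id
    (divStep (Sum.elim b fun _ => 1) K) (fun _ => 0)
    (fun x s h => Fin.ofNat (K + 1)
      (Sum.elim (fun u => s.reg u % β ^ width x.length % b u) (fun _ => 0) h))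
    (fun x s u => s.reg u % β ^ width x.length / b u) fun x s τ => ⟨_, _, runR_id _ _, ?_⟩).map
    (fun r u => r (.inl u))
  rw [id, runL_div]
  · refine Prod.ext ?_ ?_
    · refine word_congr ?_
      rintro (u | j)
      · rfl
      · simp
    · funext h
      rcases h with u | j
      · rfl
      · simp [Nat.mod_one]
  · rintro (u | j)
    · exact hb u
    · simp

theorem dec {ℓ : ℕ} (S : U → Bool) : Real β L ℓ (Den.dec β S : Den A U W Unit) := by
  have hβ : 0 < β := NeZero.pos β
  refine of_trip (ℓ := ℓ) decStep (fun _ => ()) (fun q c => (c, q))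
    (fun h => Sum.elim (fun u => if S u then 1 else 0) (fun _ => 0) h) (fun _ _ => ())
    (fun x s u => if S u then
            if s.reg u = 0 then β ^ width x.length - 1 else s.reg u - 1 else s.reg u)
    fun x s τ => ⟨_, _, rfl, ?_⟩
  rw [runL_id]
  refine Prod.ext ?_ rfl
  refine Eq.trans ?_ (runR_dec (β := β) (width x.length)
    (fun h => Sum.elim (fun u => if S u then 1 else 0) (fun _ => 0) h) _)
  -- Old content and new content plus borrow need to agree only modulo `β ^ width`; this covers the
  -- underflow from `0` to `β ^ width - 1`.
  refine congrArg (fun ws => (runR decStep _ ws).1) (word_congr (β := β) ?_)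
  rintro (u | j)
  · simp only [Sum.elim_inl]
    have hp : 0 < β ^ width x.length := Nat.pow_pos hβ
    by_cases hS : S u
    · by_cases h0 : s.reg u = 0
      · simp [hS, h0, Nat.sub_add_cancel hp]
      · simp [hS, h0, Nat.sub_add_cancel (Nat.pos_of_ne_zero h0)]
    · simp [hS]
  · simp

theorem zeros {ℓ : ℕ} : Real β L ℓ (Den.zeros β : Den A U W _) := by
  refine of_trip (ℓ := ℓ) zeroStep (fun q u => q (.inl u)) (fun q c => (c, q)) (fun _ => true)
    (fun x s u => decide (s.reg u % β ^ width x.length = 0)) (fun x s => s.reg)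
    fun x s τ => ⟨_, _, runR_zero _ _ _, ?_⟩
  rw [runL_id]
  refine Prod.ext rfl ?_
  funext u
  refine (Bool.true_and _).trans ?_
  exact decide_eq_decide.2 Iff.rfl

omit [Finite U] in
theorem ren {ℓ : ℕ} (π : U → Option U) : Real β L ℓ (Den.ren π : Den A U W Unit) := by
  refine of_trip (ℓ := ℓ)
    (renStep (Sum.elim (fun u => (π u).map Sum.inl) fun j => some (.inr j))) (fun _ => ())
    (fun q c => (c, q)) () (fun _ _ => ()) (fun _ s u => (π u).elim 0 s.reg)
    fun x s τ => ⟨_, _, runR_ren _ _ _, ?_⟩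
  rw [runL_id]
  refine Prod.ext ?_ rfl
  simp only
  congr 1
  funext h
  rcases h with u | j
  · simp only [Sum.elim_inl]
    cases π u <;> simp
  · simp

/-- Increase a loop counter, and report an overflow. -/
theorem tick_ev (ℓ : Fin L) {x : List A} {sp : ℕ} {s : St A U} {τ : Fin L → ℕ} {w : W}
    {X : Fin 2 → Mem A (U ⊕ Fin L → Fin β) → W → Prop} (hs : s.pos ≤ x.length + 1)
    (hsp : width x.length + 1 ≤ sp)
    (h : X (Fin.ofNat 2 ((τ ℓ % β ^ width x.length + 1) / β ^ width x.length))
      (memOf β x s (Function.update τ ℓ (τ ℓ + 1))) w) :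
    Ev (Frag.trip (affineStep (fun _ => 1) 1) (fun q => (none, q (.inr ℓ))) (fun q c => (c, q))
      (Sum.elim (fun _ => 0) fun j => if j = ℓ then 1 else 0)) x sp X (.inl none) (memOf β x s τ)
      (2 * width x.length + 3) w := by
  classical
  have := Frag.trip_ev (X := X) (out := s.out) (w := w) (sp := sp)
    (turn := fun q => (none, q (.inr ℓ))) hs _ _ _ none _ _ _
    (by rw [word_length]; exact hsp)
    (runR_affine (β := β) (b := fun _ => 1) (K := 1) (fun _ => le_rfl) (width x.length)
      (Sum.elim (fun _ => 0) fun j => if j = ℓ then 1 else 0) (Sum.elim s.reg τ)) rfl (runL_id _ _) (by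
      convert h using 1
      · simp
      · simp only [memOf, Option.toList_none, List.append_nil]
        congr 3
        funext h
        rcases h with u | j
        · simp
        · by_cases hj : j = ℓ
          · subst hj; simp
          · simp [hj])
  rw [word_length] at this
  exact this

/-- The rounds are counted by the loop counter `ℓ`. It overflows after exactly `β ^ width` rounds
and then shows `0` again, so no limit has to be stored and the loop can be reused inside another
one. The body may use the counters below `ℓ`, which are `0` between rounds. -/
theorem rep {δ : Type} [Finite δ] {ℓ : ℕ} (hℓ : ℓ < L) {body : δ → Den A U W δ}
    (h : ∀ d, Real β L ℓ (body d)) (d : δ) : Real β L (ℓ + 1) (Den.rep β body d) := by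
  classical
  have := Fintype.ofFinite δ
  choose F t ht hF using h
  let G : Frag A (U ⊕ Fin L → Fin β) (Fin 2) :=
    Frag.trip (affineStep (fun _ => 1) 1) (fun q => (none, q (.inr ⟨ℓ, hℓ⟩))) (fun q c => (c, q))
      (Sum.elim (fun _ => 0) fun j => if j = ⟨ℓ, hℓ⟩ then 1 else 0)
  let K : δ → Frag A (U ⊕ Fin L → Fin β) (δ ⊕ δ) := fun d => (F d).bind fun d' => G.bind fun c =>
    Frag.act fun _ => (.stay, none, {if c = 0 then .inl d' else .inr d'})
  let T : ℕ → ℕ := fun n => ∑ d, t d n + (2 * width n + 3 + 1) + 1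
  refine ⟨Frag.loop K d, fun n => β ^ width n * T n,
    (polyBdd_pow_width β).mul (((PolyBdd.sum _ ht).add
      ((((PolyBdd.const 2).mul polyBdd_width).add (.const 3)).add (.const 1))).add (.const 1)), ?_⟩
  intro x X k s τ hs hτ hX
  have hp : 0 < β ^ width x.length := Nat.pow_pos (NeZero.pos β)
  have tick : ∀ i (s' : St A U) (w : W) (Z : Fin 2 → Mem A (U ⊕ Fin L → Fin β) → W → Prop),
      s'.pos ≤ x.length + 1 → i < β ^ width x.length →
      Z (Fin.ofNat 2 ((i + 1) / β ^ width x.length))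
        (memOf β x s' (Function.update τ ⟨ℓ, hℓ⟩ (i + 1))) w →
      Ev G x (width x.length + 1) Z (.inl G.entry) (memOf β x s' (Function.update τ ⟨ℓ, hℓ⟩ i))
        (2 * width x.length + 3) w := by
    intro i s' w Z hs' hi hZ
    refine tick_ev (ℓ := ⟨ℓ, hℓ⟩) hs' le_rfl ?_
    simpa [Nat.mod_eq_of_lt hi] using hZ
  have stay : ∀ (e : δ ⊕ δ) (s' : St A U) (σ : Fin L → ℕ) (w : W)
      (Z : δ ⊕ δ → Mem A (U ⊕ Fin L → Fin β) → W → Prop), s'.pos ≤ x.length + 1 →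
      Z e (memOf β x s' σ) w →
      Ev (Frag.act fun _ => (.stay, none, {e})) x (width x.length + 1) Z (.inl ())
        (memOf β x s' σ) 1 w := by
    intro e s' σ w Z hs' hZ
    have := Frag.act_ev (g := fun _ => (Move.stay, (none : Option A), {e})) (m := memOf β x s' σ)
      (sp := width x.length + 1) (x := x) (X := Z) (fun _ => w) (Nat.zero_le _) (by
        intro a' ha'
        rw [Finset.mem_singleton.1 ha']
        convert hZ using 1
        simpa [moveOn, Move.apply, memOf] using hs')
    rw [Finset.sum_singleton] at this
    exact this
  have ht' : ∀ d, t d x.length ≤ ∑ d, t d x.length := fun d =>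
    Finset.single_le_sum (f := fun d => t d x.length) (fun _ _ => Nat.zero_le _)
      (Finset.mem_univ d)
  -- Here `i` is the counter and `j + 1` the number of rounds left; for `j = 0` the tick overflows
  -- and the loop is left.
  have key : ∀ j i d' (s : St A U), s.pos ≤ x.length + 1 → i + j + 1 = β ^ width x.length →
      Ev (Frag.loop K d) x (width x.length + 1) X (.inl (.inl d'))
        (memOf β x s (Function.update τ ⟨ℓ, hℓ⟩ i)) ((j + 1) * T x.length)
        (Den.iter body (j + 1) d' x s k) := by
    intro j
    induction j with
    | zero =>
      intro i d' s hs hi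
      have := Frag.loop_ev (F := K) (d₀ := d) (d := d') (x := x) (sp := width x.length + 1)
        (X := fun e m w => ∃ b, e = .inr b ∧ X b m w) (Y := X)
        (t := ∑ d, t d x.length + (2 * width x.length + 3 + 1)) (t' := 0)
        (m := memOf β x s (Function.update τ ⟨ℓ, hℓ⟩ i)) (w := Den.iter body (0 + 1) d' x s k)
        (by rintro _ _ _ ⟨b, h, -⟩; exact absurd h Sum.inl_ne_inr)
        (by rintro _ _ _ ⟨b, h, h'⟩; rwa [Sum.inr.inj h]) (Nat.zero_le _) hs ?_
      · refine this.mono (le_of_eq ?_) fun _ _ _ h => h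
        simp only [T]
        ring
      · refine Frag.bind_ev (X := fun a m w => ∃ s' : St A U, s'.pos ≤ x.length + 1 ∧
          m = memOf β x s' (Function.update τ ⟨ℓ, hℓ⟩ i) ∧ w = k a s') ?_
          ((hF d' x _ _ s _ hs ?_ ?_).mono (ht' d') fun _ _ _ h => h)
        · rintro a _ _ ⟨s', hs', rfl, rfl⟩
          refine Frag.bind_ev (X := fun c m w => c = 1 ∧
            m = memOf β x s' (Function.update τ ⟨ℓ, hℓ⟩ (i + 1)) ∧ w = k a s') ?_
            (tick i s' _ _ hs' (by omega) ⟨?_, rfl, rfl⟩)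
          · rintro _ _ _ ⟨rfl, rfl, rfl⟩
            refine stay _ s' _ _ _ hs' ⟨a, by simp, ?_⟩
            convert hX a s' hs' using 1
            unfold memOf
            congr 2
            -- The counter equals `β ^ width`, whose digits are those of `0 = τ ℓ`.
            refine word_congr ?_
            rintro (u | j)
            · rfl
            · by_cases hj : j = ⟨ℓ, hℓ⟩
              · subst hj
                simp [show i + 1 = β ^ width x.length by omega, hτ ⟨ℓ, hℓ⟩ (Nat.lt_succ_self ℓ)]
              · simp [hj]
          · rw [show i + 1 = β ^ width x.length by omega, Nat.div_self hp]
            rfl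
        · intro j hj
          rw [Function.update_of_ne (by rintro rfl; exact lt_irrefl _ hj)]
          exact hτ j (by omega)
        · exact fun a s' hs' => ⟨s', hs', rfl, rfl⟩
    | succ j ih =>
      intro i d' s hs hi
      have := Frag.loop_ev (F := K) (d₀ := d) (d := d') (x := x) (sp := width x.length + 1)
        (X := fun e m w => ∃ (b : δ) (s' : St A U), e = .inl b ∧ s'.pos ≤ x.length + 1 ∧
          m = memOf β x s' (Function.update τ ⟨ℓ, hℓ⟩ (i + 1)) ∧
          w = Den.iter body (j + 1) b x s' k) (Y := X)
        (t := ∑ d, t d x.length + (2 * width x.length + 3 + 1)) (t' := (j + 1) * T x.length)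
        (m := memOf β x s (Function.update τ ⟨ℓ, hℓ⟩ i)) (w := Den.iter body (j + 1 + 1) d' x s k)
        (by
          rintro _ _ _ ⟨b, s', h, hs', rfl, rfl⟩
          rw [Sum.inl.inj h]
          exact ih (i + 1) b s' hs' (by omega))
        (by rintro _ _ _ ⟨b, _, h, -⟩; exact absurd h Sum.inr_ne_inl) (Nat.zero_le _) hs ?_
      · refine this.mono (le_of_eq ?_) fun _ _ _ h => h
        simp only [T]
        ring
      · refine Frag.bind_ev (X := fun a m w => ∃ s' : St A U, s'.pos ≤ x.length + 1 ∧
          m = memOf β x s' (Function.update τ ⟨ℓ, hℓ⟩ i) ∧ w = Den.iter body (j + 1) a x s' k) ?_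
          ((hF d' x _ _ s _ hs ?_ ?_).mono (ht' d') fun _ _ _ h => h)
        · rintro a _ _ ⟨s', hs', rfl, rfl⟩
          refine Frag.bind_ev (X := fun c m w => c = 0 ∧
            m = memOf β x s' (Function.update τ ⟨ℓ, hℓ⟩ (i + 1)) ∧
            w = Den.iter body (j + 1) a x s' k) ?_
            (tick i s' _ _ hs' (by omega) ⟨?_, rfl, rfl⟩)
          · rintro _ _ _ ⟨rfl, rfl, rfl⟩
            exact stay _ s' _ _ _ hs' ⟨a, s', by simp, hs', rfl, rfl⟩
          · rw [Nat.div_eq_of_lt (by omega)]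
            rfl
        · intro j hj
          rw [Function.update_of_ne (by rintro rfl; exact lt_irrefl _ hj)]
          exact hτ j (by omega)
        · exact fun a s' hs' => ⟨s', hs', rfl, rfl⟩
  obtain ⟨j, hj⟩ : ∃ j, j + 1 = β ^ width x.length := ⟨_, Nat.sub_add_cancel hp⟩
  have := key j 0 d s hs (by omega)
  rw [hj] at this
  rwa [Function.update_eq_self_iff.2 (hτ ⟨ℓ, hℓ⟩ (Nat.lt_succ_self ℓ)).symm] at this

end Real
end Realizable
end ModLog

/-! ### Laying out the work tape -/

namespace ModLog

section Init

variable {A Γ : Type}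

open Classical in
/-- Increment of a binary counter with the digits `z` and `o`, least significant digit first. -/
noncomputable def countStep (z o : Γ) (q : Bool) (c : Γ) : Γ × Bool :=
  if q then (if c = o then (z, true) else (o, false)) else (c, false)

open Classical in
/-- Value of a binary counter whose digit `1` is `o`. -/
noncomputable def countVal (o : Γ) : List Γ → ℕ
  | [] => 0
  | c :: ws => (if c = o then 1 else 0) + 2 * countVal o ws

theorem countVal_lt (o : Γ) (ws : List Γ) : countVal o ws < 2 ^ ws.length := by
  induction ws with
  | nil => simp [countVal]
  | cons c ws ih =>
    rw [countVal, List.length_cons, pow_succ]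
    split_ifs <;> omega

theorem countVal_append {z o : Γ} (h : z ≠ o) (ws : List Γ) :
    countVal o (ws ++ [z]) = countVal o ws := by
  induction ws with
  | nil => simp [countVal, h]
  | cons c ws ih => simp [countVal, ih]

theorem runR_count {z o : Γ} (h : z ≠ o) (q : Bool) (ws : List Γ) :
    countVal o (runR (countStep z o) q ws).1 +
      2 ^ ws.length * (runR (countStep z o) q ws).2.toNat = countVal o ws + q.toNat := by
  induction ws generalizing q with
  | nil => simp [runR, countVal]
  | cons c ws ih =>
    simp only [runR, countVal, List.length_cons, pow_succ]
    cases q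
    · have := ih false
      by_cases hc : c = o <;> simp [countStep, hc] at this ⊢ <;> linarith
    · by_cases hc : c = o
      · have := ih true
        simp [countStep, hc, h] at this ⊢
        linarith
      · have := ih false
        simp [countStep, hc] at this ⊢
        linarith

/-- Write a word of length `width n`, consisting of `z`, on the work tape, and move the input head
to the right end. -/
noncomputable def initFrag (A : Type) (z o : Γ) : Frag A Γ Unit :=
  Frag.loop (δ := Unit) (fun _ =>
    (Frag.act fun s => match s with
      | .rend => (.stay, none, {false})
      | _ => (.right, none, {true})).bind fun b =>
    (if b then
        Frag.trip (countStep z o) (fun q => (if q then some z else none, ())) (fun q c => (c, q)) true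
      else
        Frag.trip (fun q _ => (z, q)) (fun q => (none, q)) (fun q c => (c, q)) ()).bind fun _ =>
    Frag.act fun _ => (.stay, none, {if b then .inl () else .inr ()})) ()

variable {W : Type} [AddCommMonoid W]

theorem readCell_rend_iff (x : List A) (p : ℕ) : readCell x p = .rend ↔ x.length < p := by
  cases p with
  | zero => simp [readCell]
  | succ p =>
    simp only [readCell]
    cases h : x[p]? with
    | none =>
      rw [List.getElem?_eq_none_iff] at h
      simp; omega
    | some a =>
      have := (List.getElem?_eq_some_iff.1 h).1
      simp; omega

theorem readCell_lend_iff (x : List A) (p : ℕ) : readCell x p = .lend ↔ p = 0 := by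
  cases p with
  | zero => simp [readCell]
  | succ p =>
    simp only [readCell]
    cases x[p]? <;> simp

theorem stay_ev {α : Type} {x : List A} {sp : ℕ} {X : α → Mem A Γ → W → Prop} {m : Mem A Γ}
    {e : α} {w : W} (hm : m.head ≤ sp) (hp : m.pos ≤ x.length + 1) (h : X e m w) :
    Ev (Frag.act fun _ => (.stay, none, {e})) x sp X (.inl ()) m 1 w := by
  have := Frag.act_ev (g := fun _ => (Move.stay, (none : Option A), {e})) (m := m)
    (sp := sp) (x := x) (X := X) (fun _ => w) hm (by
      intro a' ha'
      rw [Finset.mem_singleton.1 ha']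
      convert h using 1
      simp [moveOn, Move.apply, hp])
  rw [Finset.sum_singleton] at this
  exact this

theorem runR_fill (z : Γ) (ws : List Γ) :
    runR (fun (q : Unit) _ => (z, q)) () ws = (List.replicate ws.length z, ()) := by
  induction ws <;> simp_all [runR, List.replicate_succ]

/-- The tape holds a binary counter whose leading `1` is not written, so that `pos + 1 = 2 ^ |ws| +
countVal o ws`. At the right end `pos + 1` is `|x| + 2`, whence `|ws|` is the required logarithm;
the digits are then overwritten by `z`. -/
theorem initFrag_ev {z o : Γ} (h : z ≠ o) {x : List A} {X : Unit → Mem A Γ → W → Prop}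
    {w : W} (hX : X () ⟨x.length + 1, tapeOf (List.replicate (width x.length) z), 0, []⟩ w) :
    Ev (initFrag A z o) x (width x.length + 1) X (.inl (initFrag A z o).entry)
      ⟨0, fun _ => none, 0, []⟩ ((x.length + 2) * (2 * width x.length + 6)) w := by
  have key : ∀ j pos (ws : List Γ), pos + j = x.length + 1 →
      pos + 1 = 2 ^ ws.length + countVal o ws →
      Ev (initFrag A z o) x (width x.length + 1) X (.inl (.inl ()))
        ⟨pos, tapeOf ws, 0, []⟩ ((j + 1) * (2 * width x.length + 6)) w := by
    intro j
    induction j with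
    | zero =>
      intro pos ws hpos hval
      have hw : ws.length = width x.length := by
        have := countVal_lt o ws
        rw [width, eq_comm, Nat.log_eq_iff (Or.inr ⟨by omega, by omega⟩)]
        rw [pow_succ]
        omega
      refine (Frag.loop_ev (F := _) (d₀ := ()) (d := ()) (x := x) (sp := width x.length + 1)
        (X := fun e m w => ∃ b, e = .inr b ∧ X b m w) (Y := X)
        (t := 1 + (2 * width x.length + 3 + 1)) (t' := 0) (m := ⟨pos, tapeOf ws, 0, []⟩) (w := w)
        (by rintro _ _ _ ⟨b, h, -⟩; exact absurd h Sum.inl_ne_inr)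
        (by rintro _ _ _ ⟨b, h, h'⟩; rwa [Sum.inr.inj h]) (Nat.zero_le _) (by simp; omega)
        ?_).mono (by omega) fun _ _ _ h => h
      have hr : readCell x pos = .rend := (readCell_rend_iff _ _).2 (by omega)
      refine Frag.bind_ev (X := fun b m w' => b = false ∧ m = ⟨pos, tapeOf ws, 0, []⟩ ∧ w = w') ?_ ?_
      · rintro _ _ _ ⟨rfl, rfl, rfl⟩
        refine Frag.bind_ev (X := fun _ m w' => w = w' ∧
          m = ⟨pos, tapeOf (List.replicate (width x.length) z), 0, []⟩) ?_ ?_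
        · rintro ⟨⟩ _ _ ⟨rfl, rfl⟩
          refine stay_ev (Nat.zero_le _) (by simp; omega) ⟨(), by simp, ?_⟩
          rwa [show pos = x.length + 1 by omega]
        · have := Frag.trip_ev (A := A) (x := x) (pos := pos) (out := []) (w := w)
            (sp := width x.length + 1) (turn := fun q : Unit => (none, q))
            (X := fun _ m w' => w = w' ∧
              m = ⟨pos, tapeOf (List.replicate (width x.length) z), 0, []⟩) (by omega) ws _ _ none
            () () () (by omega) (runR_fill z ws) rfl (runL_id _ _) ⟨rfl, by simp [hw]⟩
          rw [hw] at this
          exact this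
      · have := Frag.act_ev (A := A) (g := fun s => match s with
          | .rend => (.stay, none, {false})
          | _ => (.right, none, {true})) (m := ⟨pos, tapeOf ws, 0, []⟩) (x := x)
          (sp := width x.length + 1) (X := fun b m w' => b = false ∧
            m = ⟨pos, tapeOf ws, 0, []⟩ ∧ w = w') (fun _ => w) (Nat.zero_le _) (by
            simp only [hr]
            intro a ha
            refine ⟨Finset.mem_singleton.1 ha, ?_, by trivial⟩
            simp [moveOn, Move.apply]
            omega)
        simp only [hr, Finset.sum_singleton] at this
        exact this
    | succ j ih =>
      intro pos ws hpos hval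
      have hw : ws.length ≤ width x.length := by
        refine (Nat.le_log_iff_pow_le (by omega) (by omega)).2 ?_
        omega
      refine (Frag.loop_ev (F := _) (d₀ := ()) (d := ()) (x := x) (sp := width x.length + 1)
        (X := fun e m w' => ∃ ws', e = .inl () ∧ m = ⟨pos + 1, tapeOf ws', 0, []⟩ ∧ w = w' ∧
          pos + 1 + 1 = 2 ^ ws'.length + countVal o ws') (Y := X)
        (t := 1 + (2 * width x.length + 3 + 1)) (t' := (j + 1) * (2 * width x.length + 6))
        (m := ⟨pos, tapeOf ws, 0, []⟩) (w := w)
        (by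
          rintro _ _ _ ⟨ws', h, rfl, rfl, hws'⟩
          exact ih (pos + 1) ws' (by omega) hws')
        (by rintro _ _ _ ⟨ws', h, -⟩; exact absurd h Sum.inr_ne_inl) (Nat.zero_le _)
        (by simp; omega) ?_).mono (le_of_eq (by ring)) fun _ _ _ h => h
      have hr : readCell x pos ≠ .rend := fun h => by
        have := (readCell_rend_iff _ _).1 h
        omega
      refine Frag.bind_ev (X := fun b m w' => b = true ∧ m = ⟨pos + 1, tapeOf ws, 0, []⟩ ∧ w = w')
        ?_ ?_
      · rintro _ _ _ ⟨rfl, rfl, rfl⟩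
        refine Frag.bind_ev (X := fun _ m w' => ∃ ws', m = ⟨pos + 1, tapeOf ws', 0, []⟩ ∧ w = w' ∧
          pos + 1 + 1 = 2 ^ ws'.length + countVal o ws') ?_ ?_
        · rintro ⟨⟩ _ _ ⟨ws', rfl, rfl, hws'⟩
          exact stay_ev (Nat.zero_le _) (by simp; omega) ⟨ws', by simp, rfl, rfl, hws'⟩
        · have := Frag.trip_ev (A := A) (x := x) (pos := pos + 1) (out := []) (w := w)
            (sp := width x.length + 1) (turn := fun q => (if q then some z else none, ()))
            (X := fun _ m w' => ∃ ws', m = ⟨pos + 1, tapeOf ws', 0, []⟩ ∧ w = w' ∧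
              pos + 1 + 1 = 2 ^ ws'.length + countVal o ws') (by omega) ws _ _ _
            _ () () (by omega) (q₀ := true) (g₁ := countStep z o) rfl rfl (runL_id _ _)
            -- A final carry appends a digit `z`: the implicit leading `1` moves up one place and
            -- absorbs the carry, since `2 ^ m + 2 ^ m = 2 ^ (m + 1)`.
            ⟨_, rfl, rfl, by
              have h1 := runR_count h true ws
              have h2 := runR_length (countStep z o) true ws
              cases hq : (runR (countStep z o) true ws).2
              · rw [hq] at h1
                simp [h2] at h1 ⊢
                omega
              · rw [hq] at h1
                simp [h2, countVal_append h, pow_succ] at h1 ⊢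
                omega⟩
          exact this.mono (by omega) fun _ _ _ h => h
      · have := Frag.act_ev (A := A) (g := fun s => match s with
          | .rend => (.stay, none, {false})
          | _ => (.right, none, {true})) (m := ⟨pos, tapeOf ws, 0, []⟩) (x := x)
          (sp := width x.length + 1) (X := fun b m w' => b = true ∧
            m = ⟨pos + 1, tapeOf ws, 0, []⟩ ∧ w = w') (fun _ => w) (Nat.zero_le _) (by
            simp only
            intro a ha
            refine ⟨Finset.mem_singleton.1 ha, ?_, by trivial⟩
            simp [moveOn, Move.apply]
            omega)
        simp only [Finset.sum_singleton] at this
        exact this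
  have := key (x.length + 1) 0 [] (by omega) (by simp [countVal])
  have he : tapeOf ([] : List Γ) = fun _ => none := by
    funext j
    cases j <;> simp [tapeOf]
  rw [he] at this
  exact this

end Init

/-- With the point mass at the final output as weight of the exit, the value of a program is the
output distribution of its machine. The word laid out initially consists of zero vectors, so all
registers start at `0`; `2 ≤ β` and the existence of a register provide a second symbol for
counting. -/
theorem Real.exists_machine {A U R : Type} [Finite A] [Finite U] [Nonempty U] [CommSemiring R]
    {β L ℓ : ℕ} [NeZero β] (hβ : 2 ≤ β) {D : Den A U (List A →₀ R) Unit} (hD : Real β L ℓ D) :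
    ∃ N : Machine A, IsNLMachine N ∧ ∀ x, ∃ T,
      (∀ l c, N.Run (noOracle A) x N.init l c → l.length < T) ∧
      N.dist R (noOracle A) x T N.init =
        D x ⟨x.length + 1, fun _ => 0, []⟩ fun _ s => Finsupp.single s.out 1 := by
  obtain ⟨F, t, ht, hF⟩ := hD
  let z : U ⊕ Fin L → Fin β := fun _ => 0
  let o : U ⊕ Fin L → Fin β := fun _ => Fin.ofNat β 1
  have hzo : z ≠ o := fun h => by
    have := congrArg Fin.val (congrFun h (.inl (Classical.arbitrary U)))
    simp [z, o, Nat.mod_eq_of_lt hβ] at this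
  let G := (initFrag A z o).bind fun _ => F
  have hG : ∀ x : List A, Ev G x (width x.length + 1)
      (fun _ m w => m.head ≤ width x.length + 1 ∧ w = Finsupp.single m.out 1) (.inl G.entry)
      ⟨0, fun _ => none, 0, []⟩
      ((x.length + 2) * (2 * width x.length + 6) + t x.length)
      (D x ⟨x.length + 1, fun _ => 0, []⟩ fun _ s => Finsupp.single s.out 1) := by
    intro x
    refine Frag.bind_ev (X := fun _ m w =>
      m = ⟨x.length + 1, tapeOf (List.replicate (width x.length) z), 0, []⟩ ∧
      w = D x ⟨x.length + 1, fun _ => 0, []⟩ fun _ s => Finsupp.single s.out 1) ?_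
      (initFrag_ev hzo ⟨rfl, rfl⟩)
    rintro _ _ _ ⟨rfl, rfl⟩
    have := hF x (fun _ m w => m.head ≤ width x.length + 1 ∧ w = Finsupp.single m.out 1)
      (fun _ s => Finsupp.single s.out 1) ⟨x.length + 1, fun _ => 0, []⟩ (fun _ => 0) le_rfl
      (fun _ _ => rfl) (fun _ _ _ => ⟨Nat.zero_le _, rfl⟩)
    convert this using 1
    unfold memOf
    congr 2
    rw [← word_zero]
    congr 1
    funext h
    cases h <;> rfl
  have hinit : G.toMachine.init = G.config (.inl G.entry) ⟨0, fun _ => none, 0, []⟩ := rfl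
  have hreach : ∀ x c, G.toMachine.Reachable (noOracle A) x c →
      ∃ q m, c = G.config q m ∧ m.head ≤ width x.length + 1 := by
    rintro x c ⟨l, hl⟩
    rw [hinit] at hl
    exact (Frag.ev_run (hG x) hl).2
  refine ⟨G.toMachine, ⟨G.toMachine_oracleFree, ?_, ?_, ?_⟩, fun x =>
    ⟨(x.length + 2) * (2 * width x.length + 6) + t x.length + 1, ?_, ?_⟩⟩
  -- Heads stay within `width n + 1 ≤ Nat.log 2 n + 3`.
  · refine ⟨4, fun x c hc i => ?_⟩
    obtain ⟨q, m, rfl, hm⟩ := hreach x c hc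
    have := width_le x.length
    change m.head < _
    omega
  · have hp : PolyBdd fun n => (n + 2) * (2 * width n + 6) + t n :=
      ((PolyBdd.id.add (.const 2)).mul (((PolyBdd.const 2).mul polyBdd_width).add (.const 6))).add ht
    obtain ⟨C, hC⟩ := hp.exists_le
    refine ⟨C, fun x l c hl => ?_⟩
    rw [hinit] at hl
    exact (Frag.ev_run (hG x) hl).1.trans (hC _)
  · intro x c hc h
    obtain ⟨q, m, rfl, -⟩ := hreach x c hc
    rcases h with h | ⟨a, ha, s, hs⟩
    · exact absurd rfl h
    · rw [G.toMachine_oracleFree _ _ _ _ a ha] at hs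
      cases hs
  · intro l c hl
    rw [hinit] at hl
    exact Nat.lt_succ_of_le (Frag.ev_run (hG x) hl).1
  · have := Frag.ev_dist (f := noOracle A) (hG x)
    rw [← hinit] at this
    exact this

end ModLog

/-! ### Random access to the input -/

namespace ModLog

namespace Den

variable {A U W α δ : Type} [AddCommMonoid W]

/-- Move the input head to the left end. -/
def rewind (β : ℕ) : Den A U W Unit :=
  rep β (fun _ : Unit => act fun _ => (.left, none, {()})) ()

/-- Move the input head to the right as often as a counter says. -/
def walk [DecidableEq U] (β : ℕ) (tmp : U) : Den A U W Unit :=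
  rep β (fun _ : Unit => (zeros β).bind fun z =>
    if z tmp then pure () else
      (dec β fun u => decide (u = tmp)).bind fun _ => act fun _ => (.right, none, {()})) ()

/-- Read the input symbol at the position given by a register. -/
def readAt [DecidableEq U] (β : ℕ) (tmp r : U) : Den A U W (Marked A) :=
  (rewind β).bind fun _ => (ren fun u => some (if u = tmp then r else u)).bind fun _ =>
    (walk β tmp).bind fun _ => act fun s => (.stay, none, {s})

theorem iter_left (x : List A) (j : ℕ) (s : St A U) (k : Unit → St A U → W)
    (hs : s.pos ≤ x.length + 1) :
    iter (fun _ : Unit => act fun _ => (.left, none, {()})) j () x s k =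
      k () { s with pos := s.pos - j } := by
  induction j generalizing s with
  | zero => rfl
  | succ j ih =>
    rw [iter, bind, act, Finset.sum_singleton]
    have h : moveOn x .left s.pos = s.pos - 1 := by
      simp only [moveOn, Move.apply]
      omega
    simp only [h, Option.toList_none, List.append_nil]
    rw [ih _ (by simp; omega)]
    simp [Nat.sub_sub, Nat.add_comm]

theorem rewind_eq {β : ℕ} {x : List A} (hB : x.length + 2 ≤ β ^ width x.length) (s : St A U)
    (k : Unit → St A U → W) : rewind β x s k = k () { s with pos := 0 } := by
  rw [rewind, rep]
  -- Nothing is assumed about the initial position. The first move brings it into the range `0, …,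
  -- |x| + 1`, and the other `j ≥ |x| + 1` moves lead to `0`.
  obtain ⟨j, hj⟩ : ∃ j, j + 1 = β ^ width x.length := ⟨_, Nat.sub_add_cancel (by omega)⟩
  rw [← hj, iter, bind, act, Finset.sum_singleton]
  have h : moveOn x .left s.pos ≤ x.length + 1 := min_le_right ..
  simp only [Option.toList_none, List.append_nil]
  rw [iter_left _ _ _ _ h]
  congr 2
  simp only
  omega

/-- The number of rounds is fixed in advance, so rounds after the counter has reached `0` are idle.
-/
theorem iter_walk [DecidableEq U] {β : ℕ} (tmp : U) {x : List A} (j : ℕ) (s : St A U) (k : Unit → St A U → W)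
    (hs : s.pos + s.reg tmp ≤ x.length + 1) (hB : s.reg tmp < β ^ width x.length) :
    iter (fun _ : Unit => (zeros β).bind fun z =>
      if z tmp then pure () else
        (dec β fun u => decide (u = tmp)).bind fun _ => act fun _ => (.right, none, {()})) j () x s k =
      k () { s with
        pos := s.pos + min j (s.reg tmp)
        reg := Function.update s.reg tmp (s.reg tmp - j) } := by
  induction j generalizing s with
  | zero => simp [iter, pure]
  | succ j ih =>
    rw [iter, bind, bind, zeros]
    simp only [Nat.mod_eq_of_lt hB]
    by_cases h0 : s.reg tmp = 0
    · simp only [h0, decide_true, if_true, pure]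
      rw [ih s hs hB]
      simp [h0]
    · simp only [h0, decide_false, Bool.false_eq_true, if_false]
      rw [bind, dec, act, Finset.sum_singleton]
      have h : moveOn x .right s.pos = s.pos + 1 := by
        simp only [moveOn, Move.apply]
        omega
      simp only [h, Option.toList_none, List.append_nil, decide_eq_true_eq]
      rw [ih _ (by simp [h0]; omega) (by simp [h0]; omega)]
      congr 2
      · simp only [if_true, h0, if_false]
        omega
      · funext u
        by_cases hu : u = tmp
        · subst hu; simp [h0]; omega
        · simp [hu]

theorem readAt_eq [DecidableEq U] {β : ℕ} (tmp r : U) {x : List A} (hB : x.length + 2 ≤ β ^ width x.length)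
    (s : St A U) (k : Marked A → St A U → W) (hs : s.reg r ≤ x.length + 1) :
    readAt β tmp r x s k = k (readCell x (s.reg r))
      { s with pos := s.reg r, reg := Function.update s.reg tmp 0 } := by
  rw [readAt, bind, rewind_eq hB, bind, ren, bind, walk, rep, iter_walk _ _ _ _
    (by simpa using hs) (by simp; omega)]
  simp only [Option.elim_some, if_true, Nat.zero_add]
  rw [min_eq_right (by omega), act, Finset.sum_singleton]
  have h : moveOn x .stay (s.reg r) = s.reg r := by
    simp only [moveOn, Move.apply]
    omega
  simp only [h, Option.toList_none, List.append_nil]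
  congr 2
  funext u
  by_cases hu : u = tmp
  · subst hu; simp; omega
  · simp [hu]

end Den

namespace Real

variable {A U W α : Type} [AddCommMonoid W] {β L : ℕ} [NeZero β] [Finite U]

theorem rewind (hL : 1 ≤ L) : Real β L 1 (Den.rewind β : Den A U W Unit) :=
  rep (ℓ := 0) hL (fun _ => act _) _

theorem readAt [DecidableEq U] [Finite A] (hL : 1 ≤ L) (tmp r : U) :
    Real β L 1 (Den.readAt β tmp r : Den A U W _) := by
  refine (rewind hL).bind fun _ => (ren _).bind fun _ => bind (rep (ℓ := 0) hL (fun _ => ?_) _)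
    fun _ => act _
  refine zeros.bind fun z => ?_
  split_ifs
  · exact pure _
  · exact (dec _).bind fun _ => act _

end Real

/-! ### Tapes as pairs of numbers -/

section Tapes

variable {G : Type} [Finite G]

/-- Code of a tape symbol: a nonzero digit. -/
noncomputable def symCode (g : G) : ℕ := Finite.equivFin G g + 1

/-- The base used for coding stacks of tape symbols. -/
noncomputable def symBase (G : Type) : ℕ := Nat.card G + 1

open Classical in
/-- Decoding of digits; `0` stands for a blank. -/
noncomputable def symDecode (blank : G) (n : ℕ) : G :=
  if h : ∃ g : G, symCode g = n then h.choose else blank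

theorem symCode_lt (g : G) : symCode g < symBase G := by
  have := (Finite.equivFin G g).2
  simp only [symCode, symBase]
  omega

theorem symCode_pos (g : G) : 0 < symCode g := Nat.succ_pos _

theorem symCode_injective : Function.Injective (symCode : G → ℕ) := fun a b h => by
  simp only [symCode, Nat.add_right_cancel_iff] at h
  exact (Finite.equivFin G).injective (Fin.ext h)

theorem symDecode_code (blank g : G) : symDecode blank (symCode g) = g := by
  have h : ∃ g' : G, symCode g' = symCode g := ⟨g, rfl⟩
  rw [symDecode, dif_pos h]
  exact symCode_injective h.choose_spec

/-- The leading zeros of the right stack thus stand for the infinite blank rest of the tape. -/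
theorem symDecode_zero (blank : G) : symDecode blank 0 = blank := by
  rw [symDecode, dif_neg]
  rintro ⟨g, hg⟩
  exact absurd hg (symCode_pos g).ne'

theorem symBase_pos (G : Type) : 0 < symBase G := Nat.succ_pos _

/-- The part of a tape to the left of the head, as a number. -/
noncomputable def leftStack (cells : ℕ → G) : ℕ → ℕ
  | 0 => 0
  | h + 1 => symCode (cells h) + symBase G * leftStack cells h

theorem leftStack_lt (cells : ℕ → G) (h : ℕ) : leftStack cells h < symBase G ^ h := by
  induction h with
  | zero => simp [leftStack]
  | succ h ih =>
    rw [leftStack, pow_succ]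
    have := symCode_lt (cells h)
    nlinarith

theorem leftStack_congr {cells cells' : ℕ → G} {h : ℕ} (hc : ∀ j < h, cells j = cells' j) :
    leftStack cells h = leftStack cells' h := by
  induction h with
  | zero => rfl
  | succ h ih => rw [leftStack, leftStack, hc h (by omega), ih fun j hj => hc j (by omega)]

/-- The numbers `l` and `r` represent a tape with its head. -/
structure TapeRep (blank : G) (cells : ℕ → G) (head S l r : ℕ) : Prop where
  left : l = leftStack cells head
  right : ∀ j, symDecode blank (r / symBase G ^ j % symBase G) = cells (head + j)
  bound : r < symBase G ^ (S - head)
  head_lt : head < S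

/-- Left stack after writing `g` and moving. -/
noncomputable def newLeft (g : G) (d : Move) (l : ℕ) : ℕ :=
  match d with
  | .left => l / symBase G
  | .stay => l
  | .right => symBase G * l + symCode g

/-- Right stack after writing `g` and moving. -/
noncomputable def newRight (g : G) (d : Move) (l r : ℕ) : ℕ :=
  match d with
  | .left => if l % symBase G = 0 then symBase G * (r / symBase G) + symCode g else
      symBase G * symBase G * (r / symBase G) + (symBase G * symCode g + l % symBase G)
  | .stay => symBase G * (r / symBase G) + symCode g
  | .right => r / symBase G

namespace TapeRep

variable {blank : G} {cells : ℕ → G} {head S l r : ℕ}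

theorem scan (h : TapeRep blank cells head S l r) :
    symDecode blank (r % symBase G) = cells head := by
  simpa using h.right 0

theorem left_lt (h : TapeRep blank cells head S l r) : l < symBase G ^ S := by
  rw [h.left]
  exact (leftStack_lt _ _).trans_le (Nat.pow_le_pow_right (symBase_pos G) h.head_lt.le)

theorem right_lt (h : TapeRep blank cells head S l r) : r < symBase G ^ S :=
  h.bound.trans_le (Nat.pow_le_pow_right (symBase_pos G) (Nat.sub_le _ _))

theorem write (h : TapeRep blank cells head S l r) (g : G) :
    TapeRep blank (Function.update cells head g) head S l
      (symBase G * (r / symBase G) + symCode g) := by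
  have hb := symBase_pos G
  have hc := symCode_lt g
  refine ⟨?_, ?_, ?_, h.head_lt⟩
  · rw [h.left]
    exact leftStack_congr fun j hj => (Function.update_of_ne hj.ne _ _).symm
  · rintro (- | j)
    · simp [Nat.mod_eq_of_lt hc, symDecode_code]
    · rw [Function.update_of_ne (by omega), ← h.right (j + 1), pow_succ', ← Nat.div_div_eq_div_mul,
        Nat.mul_add_div hb, Nat.div_eq_of_lt hc, Nat.add_zero, ← Nat.div_div_eq_div_mul]
  · have h1 := h.bound
    obtain ⟨e, he⟩ : ∃ e, S - head = e + 1 := ⟨S - head - 1, by have := h.head_lt; omega⟩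
    rw [he, pow_succ] at h1 ⊢
    have h2 : r / symBase G < symBase G ^ e := (Nat.div_lt_iff_lt_mul hb).2 h1
    nlinarith

theorem moveRight (h : TapeRep blank cells head S l r) (hS : head + 1 < S) :
    TapeRep blank cells (head + 1) S (symBase G * l + symCode (cells head)) (r / symBase G) := by
  have hb := symBase_pos G
  refine ⟨?_, ?_, ?_, hS⟩
  · rw [leftStack, h.left, Nat.add_comm]
  · intro j
    rw [Nat.div_div_eq_div_mul, ← pow_succ', h.right (j + 1)]
    congr 1
    omega
  · have h1 := h.bound
    rw [show S - head = S - (head + 1) + 1 by omega, pow_succ] at h1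
    exact (Nat.div_lt_iff_lt_mul hb).2 h1

theorem moveLeft (h : TapeRep blank cells (head + 1) S l r) :
    TapeRep blank cells head S (l / symBase G) (symBase G * r + symCode (cells head)) := by
  have hb := symBase_pos G
  have hc := symCode_lt (cells head)
  refine ⟨?_, ?_, ?_, by have := h.head_lt; omega⟩
  · rw [h.left, leftStack, Nat.add_mul_div_left _ _ hb, Nat.div_eq_of_lt hc, Nat.zero_add]
  · rintro (- | j)
    · simp [Nat.mod_eq_of_lt hc, symDecode_code]
    · rw [pow_succ', ← Nat.div_div_eq_div_mul, Nat.mul_add_div hb, Nat.div_eq_of_lt hc,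
        Nat.add_zero, h.right j]
      congr 1
      omega
  · have h1 := h.bound
    have h2 := h.head_lt
    rw [show S - head = S - (head + 1) + 1 by omega, pow_succ]
    nlinarith

/-- Digits of the left stack are nonzero, even for blank cells. Hence `l % symBase G = 0` exactly
when the head is on cell `0`, where a left move has no effect; otherwise this remainder is the
symbol to be transferred to the right stack. -/
theorem step (h : TapeRep blank cells head S l r) (g : G) (d : Move) (hS : d.apply head < S) :
    TapeRep blank (Function.update cells head g) (d.apply head) S (newLeft g d l)
      (newRight g d l r) := by
  have hb := symBase_pos G
  have hw := h.write g
  cases d with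
  | stay => exact hw
  | right =>
    have := hw.moveRight hS
    rw [Nat.mul_add_div hb, Nat.div_eq_of_lt (symCode_lt g), Nat.add_zero,
      Function.update_self] at this
    exact this
  | left =>
    cases head with
    | zero =>
      have hl : l = 0 := h.left
      simpa [newLeft, newRight, Move.apply, hl] using hw
    | succ head =>
      have := hw.moveLeft
      have hl : l % symBase G = symCode (cells head) := by
        rw [h.left, leftStack, Nat.add_mul_mod_self_left, Nat.mod_eq_of_lt (symCode_lt _)]
      rw [Function.update_of_ne (by omega)] at this
      simp only [newLeft, newRight, Move.apply, hl, (symCode_pos _).ne', if_false,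
        Nat.add_sub_cancel]
      convert this using 1
      rw [Nat.mul_add, Nat.mul_assoc, Nat.add_assoc]

end TapeRep
end Tapes
end ModLog

/-! ### One machine step on registers -/

namespace ModLog

instance {A : Type} (M : Machine A) : Finite M.State := M.finiteState
instance {A : Type} (M : Machine A) : Finite M.Sym := M.finiteSym
instance {A : Type} (M : Machine A) : Finite M.Tape := M.finiteTape

/-- Registers for the configuration of a machine: the position of the input head, and two stacks
for each tape. -/
abbrev VReg (T : Type) := Option (T × Bool)

/-- Whether a move on a read-only tape increases the position. -/
def posInc {A : Type} : Marked A → Move → Bool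
  | .rend, _ => false
  | _, .right => true
  | _, _ => false

/-- Whether a move on a read-only tape decreases the position. -/
def posDec {A : Type} : Marked A → Move → Bool
  | .lend, _ => false
  | _, .left => true
  | _, _ => false

/-- The scanned end marker already tells whether a move is blocked, so a position can be updated
without knowing the length of `w`. This matters for queries and answers, which are never stored. -/
theorem moveOn_eq {A : Type} {w : List A} {p : ℕ} (hp : p ≤ w.length + 1) (d : Move) :
    moveOn w d p =
      p + (posInc (readCell w p) d).toNat - (posDec (readCell w p) d).toNat := by
  have h1 := readCell_rend_iff w p
  have h2 := readCell_lend_iff w p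
  cases h : readCell w p <;> rw [h] at h1 h2 <;> simp at h1 h2 <;>
    cases d <;> simp [moveOn, Move.apply, posInc, posDec] <;> omega

theorem posDec_pos {A : Type} {w : List A} {p : ℕ} {d : Move}
    (h : posDec (readCell w p) d = true) : p ≠ 0 := by
  rintro rfl
  simp [readCell, posDec] at h

variable {A U W : Type}

namespace Den

variable (β : ℕ) (M : Machine A) (p : U → Option (VReg M.Tape)) (e : VReg M.Tape → U)

/-- Divisor of the registers when the scanned symbols are popped. -/
noncomputable def scanBase (u : U) : ℕ :=
  match p u with
  | some (some (_, true)) => symBase M.Sym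
  | _ => 1

/-- Pop the scanned symbols. -/
noncomputable def vget : Den A U W (M.Tape → M.Sym) := fun x s k =>
  divs β (symBase M.Sym) (scanBase M p) x s fun r =>
    k fun i => symDecode M.blank (r (e (some (i, true))))

variable (i : Marked A) (a : M.Act)

/-- Divisor of the registers when symbols are popped from the left stacks. -/
noncomputable def leftBase (u : U) : ℕ :=
  match p u with
  | some (some (t, false)) => match a.workMove t with
    | .left => symBase M.Sym
    | _ => 1
  | _ => 1

/-- Factors used for pushing symbols. -/
noncomputable def pushMul (r : U → Fin (symBase M.Sym + 1)) (u : U) : ℕ :=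
  match p u with
  | some (some (t, false)) => match a.workMove t with
    | .right => symBase M.Sym
    | _ => 1
  | some (some (t, true)) => match a.workMove t with
    | .right => 1
    | .stay => symBase M.Sym
    | .left => if (r (e (some (t, false))) : ℕ) = 0 then symBase M.Sym
        else symBase M.Sym * symBase M.Sym
  | _ => 1

/-- Summands used for pushing symbols. -/
noncomputable def pushAdd (r : U → Fin (symBase M.Sym + 1)) (u : U) : ℕ :=
  match p u with
  | some none => (posInc i a.inMove).toNat
  | some (some (t, false)) => match a.workMove t with
    | .right => symCode (a.write t)
    | _ => 0
  | some (some (t, true)) => match a.workMove t with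
    | .right => 0
    | .stay => symCode (a.write t)
    | .left => if (r (e (some (t, false))) : ℕ) = 0 then symCode (a.write t)
        else symBase M.Sym * symCode (a.write t) + r (e (some (t, false)))
  | none => 0

/-- Execute an instruction, after the scanned symbols have been popped. -/
noncomputable def vput : Den A U W Unit :=
  (divs β (symBase M.Sym) (leftBase M p a)).bind fun r =>
    (affine (pushMul M p e a r) (pushAdd M p e i a r)).bind fun _ =>
      dec β fun u => match p u with
        | some none => posDec i a.inMove
        | _ => false

open Classical in
/-- Simulate one step in a given state: the result is the instruction executed, if there is any. -/
noncomputable def vstep [AddCommMonoid W] (q : M.State) [Finite A] (rd : Den A U W (Marked A))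
    (sc : Den A U W (Option (Marked A))) : Den A U W (Option M.Act) :=
  sc.bind fun o => rd.bind fun i => (vget β M p e).bind fun g =>
    if (M.δ q i g o).toFinite.toFinset = ∅ then pure none
    else (act fun _ => (.stay, none, (M.δ q i g o).toFinite.toFinset)).bind fun a =>
      (vput β M p e i a).bind fun _ => pure (some a)

/-- The registers after one step. -/
noncomputable def nextReg (reg : U → ℕ) (u : U) : ℕ :=
  match p u with
  | none => reg u
  | some none => reg u + (posInc i a.inMove).toNat - (posDec i a.inMove).toNat
  | some (some (t, false)) => newLeft (a.write t) (a.workMove t) (reg u)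
  | some (some (t, true)) =>
      newRight (a.write t) (a.workMove t) (reg (e (some (t, false)))) (reg u)

variable {β M p e i a}

theorem vget_eq {x : List A} {s : St A U} (hp : ∀ u v, p u = some v ↔ e v = u)
    (hs : ∀ u, s.reg u < β ^ width x.length) (k : (M.Tape → M.Sym) → St A U → W) :
    vget β M p e x s k = k
      (fun i => symDecode M.blank (s.reg (e (some (i, true))) % symBase M.Sym))
      { s with reg := fun u => s.reg u / scanBase M p u } := by
  simp only [vget, divs, Nat.mod_eq_of_lt (hs _)]
  congr 1
  funext i
  have : scanBase M p (e (some (i, true))) = symBase M.Sym := by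
    simp [scanBase, (hp _ _).2 rfl]
  rw [this, Fin.val_ofNat, Nat.mod_eq_of_lt ((Nat.mod_lt _ (symBase_pos _)).trans (by omega))]

/-- Here `reg` is the content before the scanned symbols were popped. All tapes are updated
simultaneously, by one division, one affine map and one decrement; `hdec` rules out an underflow of
the position. -/
theorem vput_eq {x : List A} {s : St A U} (hp : ∀ u v, p u = some v ↔ e v = u)
    {reg : U → ℕ} (hreg : ∀ u, reg u < β ^ width x.length)
    (hs : s.reg = fun u => reg u / scanBase M p u)
    (hdec : posDec i a.inMove = true → reg (e none) ≠ 0) (k : Unit → St A U → W) :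
    vput β M p e i a x s k = k () { s with reg := nextReg M p e i a reg } := by
  have hs' : ∀ u, s.reg u < β ^ width x.length := fun u => by
    rw [hs]; exact (Nat.div_le_self _ _).trans_lt (hreg u)
  have hb := symBase_pos M.Sym
  have hl : ∀ t, p (e (some (t, false))) = some (some (t, false)) := fun t => (hp _ _).2 rfl
  have hmod : ∀ n, n % symBase M.Sym % (symBase M.Sym + 1) = n % symBase M.Sym := fun n =>
    Nat.mod_eq_of_lt ((Nat.mod_lt _ hb).trans (by omega))
  simp only [vput, bind, divs, affine, dec, Nat.mod_eq_of_lt (hs' _)]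
  congr 2
  funext u
  rcases h : p u with - | (- | ⟨t, - | -⟩)
  · simp [nextReg, pushMul, pushAdd, leftBase, h, hs, scanBase]
  · have hu : e none = u := (hp _ _).1 h
    subst hu
    simp only [nextReg, pushMul, pushAdd, leftBase, h, hs, scanBase, Nat.div_one, Nat.one_mul]
    cases hd : posDec i a.inMove
    · simp
    · have := hdec hd
      simp [this]
  · simp only [nextReg, pushMul, pushAdd, leftBase, h, hs, scanBase, Nat.div_one]
    cases hm : a.workMove t <;> simp [newLeft]
  · simp only [nextReg, pushMul, pushAdd, leftBase, h, hs, scanBase, Nat.div_one, hl]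
    cases hm : a.workMove t <;> simp [newRight]
    simp only [hmod]
    split_ifs <;> rfl

end Den

/-- The configuration after an instruction, with a given oracle tape. -/
def Machine.advance (M : Machine A) (x : List A) (c : M.Config) (a : M.Act) (o : OracleTape A) :
    M.Config where
  state := a.next
  inPos := moveOn x a.inMove c.inPos
  work := fun i => Function.update (c.work i) (c.head i) (a.write i)
  head := fun i => (a.workMove i).apply (c.head i)
  oracle := o
  out := c.out ++ a.out.toList

theorem Machine.step_eq_some_iff {M : Machine A} {f : PartialFun A} {x : List A}
    {c c' : M.Config} {a : M.Act} :
    M.step f x c a = some c' ↔ ∃ o, c.oracle.act f a.oracle = some o ∧ M.advance x c a o = c' :=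
  Option.map_eq_some_iff

/-- The numbers `g` represent the configuration `c` on input `w`, with heads below `S`. -/
structure VRep (M : Machine A) (S : ℕ) (w : List A) (c : M.Config) (g : VReg M.Tape → ℕ) :
    Prop where
  pos : g none = c.inPos
  pos_le : c.inPos ≤ w.length + 1
  tape : ∀ t, TapeRep M.blank (c.work t) (c.head t) S (g (some (t, false))) (g (some (t, true)))

namespace VRep

variable {M : Machine A} {S : ℕ} {w : List A} {c : M.Config} {p : U → Option (VReg M.Tape)}
  {e : VReg M.Tape → U} {reg : U → ℕ} {B : ℕ}

theorem init {g : VReg M.Tape → ℕ} (hS : 0 < S) (hg : ∀ v, g v = 0) :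
    VRep M S w M.init g where
  pos := hg _
  pos_le := Nat.zero_le _
  tape t := by
    rw [hg, hg]
    refine ⟨rfl, fun j => ?_, Nat.pow_pos (symBase_pos _), hS⟩
    simp [symDecode_zero, Machine.init]

theorem lt (h : VRep M S w c fun v => reg (e v)) (hp : ∀ u v, p u = some v ↔ e v = u)
    (hw : w.length + 2 ≤ B) (hS : symBase M.Sym ^ S ≤ B) (hr : ∀ u, p u = none → reg u < B)
    (u : U) : reg u < B := by
  rcases hu : p u with - | (- | ⟨t, - | -⟩)
  · exact hr u hu
  · have := h.pos
    rw [(hp _ _).1 hu] at this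
    have := h.pos_le
    omega
  · have := (h.tape t).left_lt
    rw [(hp _ _).1 hu] at this
    omega
  · have := (h.tape t).right_lt
    rw [(hp _ _).1 hu] at this
    omega

theorem next (h : VRep M S w c fun v => reg (e v)) (hp : ∀ u v, p u = some v ↔ e v = u)
    {a : M.Act} (hS : ∀ t, (a.workMove t).apply (c.head t) < S) (o : OracleTape A) :
    VRep M S w (M.advance w c a o)
      fun v => Den.nextReg M p e (readCell w c.inPos) a reg (e v) := by
  have hp' : ∀ v, p (e v) = some v := fun v => (hp _ _).2 rfl
  refine ⟨?_, min_le_right _ _, fun t => ?_⟩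
  · simp only [Den.nextReg, hp']
    rw [h.pos, ← moveOn_eq h.pos_le]
    rfl
  · simp only [Den.nextReg, hp']
    exact (h.tape t).step _ _ (hS t)

end VRep

namespace Den

variable {β : ℕ} {M : Machine A} {p : U → Option (VReg M.Tape)} {e : VReg M.Tape → U}

-- The word `w` on the simulated input tape is accessible only through `rd` and need not be `x`: the
-- same lemma serves for `M` on its input and for `F` on a query.
open Classical in
theorem vstep_eq [AddCommMonoid W] [Finite A] {x w : List A} {s s₁ s₂ : St A U} {S : ℕ} {c : M.Config}
    {rd : Den A U W (Marked A)} {sc : Den A U W (Option (Marked A))}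
    (hp : ∀ u v, p u = some v ↔ e v = u)
    (hsc : ∀ k, sc x s k = k c.oracle.scan s₁)
    (hrd : ∀ k, rd x s₁ k = k (readCell w c.inPos) s₂)
    (hV : VRep M S w c fun v => s₂.reg (e v))
    (hs : ∀ u, s₂.reg u < β ^ width x.length) (k : Option M.Act → St A U → W) :
    vstep β M p e c.state rd sc x s k =
      if M.choices w c = ∅ then k none { s₂ with reg := fun u => s₂.reg u / scanBase M p u }
      else ∑ a ∈ M.choices w c, k (some a)
        { s₂ with
          pos := moveOn x .stay s₂.pos
          reg := nextReg M p e (readCell w c.inPos) a s₂.reg } := by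
  simp only [vstep]
  rw [bind, hsc, bind, hrd, bind, vget_eq hp hs]
  have hg : (fun t => symDecode M.blank (s₂.reg (e (some (t, true))) % symBase M.Sym)) =
      fun t => c.work t (c.head t) := funext fun t => (hV.tape t).scan
  rw [hg]
  change (if M.choices w c = ∅ then _ else _ : Den A U W _) _ _ _ = _
  split_ifs with h
  · rfl
  · rw [bind, act]
    refine Finset.sum_congr rfl fun a ha => ?_
    rw [bind, vput_eq hp hs rfl]
    · simp [pure]
    · intro hd
      rw [hV.pos]
      exact posDec_pos hd

end Den

namespace Real

variable [AddCommMonoid W] {β L ℓ : ℕ} [NeZero β] [Finite U] {M : Machine A} {p : U → Option (VReg M.Tape)}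
  {e : VReg M.Tape → U}

theorem vget : Real β L ℓ (Den.vget β M p e : Den A U W _) := by
  refine (divs (fun u => ?_)).map _
  have := symBase_pos M.Sym
  unfold Den.scanBase
  split <;> omega

theorem vput (i : Marked A) (a : M.Act) : Real β L ℓ (Den.vput β M p e i a : Den A U W _) := by
  refine (divs (fun u => ?_)).bind fun r => (affine _ _).bind fun _ => dec _
  have := symBase_pos M.Sym
  unfold Den.leftBase
  split
  · split <;> omega
  · omega

theorem vstep [Finite A] (q : M.State) {rd : Den A U W (Marked A)}
    {sc : Den A U W (Option (Marked A))} (hrd : Real β L ℓ rd) (hsc : Real β L ℓ sc) :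
    Real β L ℓ (Den.vstep β M p e q rd sc) := by
  refine hsc.bind fun o => hrd.bind fun i => vget.bind fun g => ?_
  split_ifs
  · exact pure _
  · exact (act _).bind fun a => (vput i a).bind fun _ => pure _

end Real
end ModLog

/-! ### Recomputing letters of a query -/

namespace ModLog

/-- `Asks f x S n c ls`: from `c` on, `M` acts deterministically, and writes the letters `ls` on the
oracle tape before it submits the query in the `n`-th step. -/
inductive Asks {A : Type} [Finite A] {M : Machine A} (f : PartialFun A) (x : List A) (S : ℕ) :
    ℕ → M.Config → List A → Prop
  | query {c : M.Config} {a : M.Act} (hc : M.choices x c = {a}) (hs : c.oracle.scan = none)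
      (hS : ∀ t, (a.workMove t).apply (c.head t) < S) (ha : a.oracle = .query) : Asks f x S 1 c []
  | write {c c' : M.Config} {a : M.Act} {l : A} {n : ℕ} {ls : List A} (hc : M.choices x c = {a})
      (hs : c.oracle.scan = none) (hc' : M.step f x c a = some c') (hS : ∀ t, (a.workMove t).apply (c.head t) < S)
      (ha : a.oracle = .write l) (h : Asks f x S n c' ls) : Asks f x S (n + 1) c (l :: ls)
  | other {c c' : M.Config} {a : M.Act} {n : ℕ} {ls : List A} (hc : M.choices x c = {a})
      (hs : c.oracle.scan = none) (hc' : M.step f x c a = some c') (hS : ∀ t, (a.workMove t).apply (c.head t) < S)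
      (ha : a.oracle ≠ .query) (ha' : ∀ l, a.oracle ≠ .write l) (h : Asks f x S n c' ls) :
      Asks f x S (n + 1) c ls

/-- The registers of the simulating machine: three banks for configurations of the oracle machine
(current, saved, and copy), a bank for the machine which computes the oracle, and four counters. -/
abbrev Rg {A : Type} (M F : Machine A) := (Fin 3 × VReg M.Tape) ⊕ VReg F.Tape ⊕ Fin 4

variable {A W : Type} {M F : Machine A}

namespace Rg

/-- The registers of a configuration of the oracle machine. -/
def bank (j : Fin 3) (v : VReg M.Tape) : Rg M F := .inl (j, v)

/-- The registers of the configuration of the machine which computes the oracle. -/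
def fbank (v : VReg F.Tape) : Rg M F := .inr (.inl v)

/-- The counters. -/
def ctr (j : Fin 4) : Rg M F := .inr (.inr j)

/-- Partial inverse of `bank`. -/
def unbank (j : Fin 3) : Rg M F → Option (VReg M.Tape)
  | .inl (j', v) => if j' = j then some v else none
  | .inr _ => none

/-- Partial inverse of `fbank`. -/
def unfbank : Rg M F → Option (VReg F.Tape)
  | .inr (.inl v) => some v
  | _ => none

theorem unbank_iff (j : Fin 3) (u : Rg M F) (v : VReg M.Tape) :
    unbank j u = some v ↔ bank j v = u := by
  rcases u with ⟨j', v'⟩ | u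
  · by_cases h : j' = j
    · subst h
      simp [unbank, bank, eq_comm]
    · simp [unbank, bank, h, Ne.symm h]
  · simp [unbank, bank]

theorem unfbank_iff (u : Rg M F) (v : VReg F.Tape) : unfbank u = some v ↔ fbank v = u := by
  rcases u with u | u | u <;> simp [unfbank, fbank, eq_comm]

/-- The registers which are used for reading a cell of a query. -/
def isCopy : Rg M F → Bool
  | .inl (j, _) => j = 2
  | .inr (.inl _) => false
  | .inr (.inr j) => j = 0 ∨ j = 3

end Rg

open Rg

variable [Finite A] [AddCommMonoid W]

open Classical in
noncomputable instance : DecidableEq (Rg M F) := fun _ _ => inferInstance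

namespace Den

variable (β : ℕ)

/-- Decrease a register unless it is zero, and report whether it becomes zero. -/
noncomputable def countdown (r : Rg M F) : Den A (Rg M F) W Bool :=
  (zeros β).bind fun z => if z r then pure false else
    (dec β fun u => decide (u = r)).bind fun _ => (zeros β).bind fun z => pure (z r)

/-- Simulate one step of the oracle machine, which is writing a query, until a given number of
letters have been written. -/
noncomputable def askStep : M.State ⊕ Marked A → Den A (Rg M F) W (M.State ⊕ Marked A)
  | .inr r => pure (.inr r)
  | .inl q => (vstep β M (unbank 2) (bank 2) q (readAt β (ctr 0) (bank 2 none)) (pure none)).bind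
      fun r => match r with
        | none => pure (.inl q)
        | some a => match a.oracle with
          | .write l => (countdown β (ctr 3)).bind fun h =>
              pure (if h then .inr (.sym l) else .inl a.next)
          | .query => pure (.inr .rend)
          | _ => pure (.inl a.next)

/-- Load the copy bank and the counter of query letters. -/
def loadCopy : Rg M F → Option (Rg M F)
  | .inl (j, v) => if j = 2 then some (bank 1 v) else some (.inl (j, v))
  | .inr (.inl v) => some (.inr (.inl v))
  | .inr (.inr j) => if j = 3 then some (fbank none) else some (.inr (.inr j))

/-- Read the query in the position given by the input head of the machine which computes the
oracle.  The query is empty, or it is described by its first letter and the state after writing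
it. -/
noncomputable def readQ : Option (A × M.State) → Den A (Rg M F) W (Marked A)
  | none => (zeros β).bind fun z => pure (if z (fbank none) then .lend else .rend)
  | some (a, q) => (zeros β).bind fun z => if z (fbank none) then pure .lend else
      (ren loadCopy).bind fun _ => (countdown β (ctr 3)).bind fun h =>
        if h then pure (.sym a) else
          (rep β (askStep β) (.inl q)).bind fun r => pure (r.elim (fun _ => .rend) id)

variable {β}

-- A register which is already `0` stays there and reports `false`, so a countdown gives its signal
-- only once.
omit [Finite A] [AddCommMonoid W] in
theorem countdown_eq (r : Rg M F) {x : List A} {s : St A (Rg M F)}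
    (hs : s.reg r < β ^ width x.length) (k : Bool → St A (Rg M F) → W) :
    countdown β r x s k = k (decide (s.reg r = 1))
      { s with reg := Function.update s.reg r (s.reg r - 1) } := by
  rw [countdown, bind, zeros]
  simp only [Nat.mod_eq_of_lt hs]
  by_cases h0 : s.reg r = 0
  · simp only [h0, decide_true, if_true, pure]
    rw [decide_eq_false (by omega), show 0 - 1 = s.reg r by omega, Function.update_eq_self]
  · have h1 : (s.reg r - 1) % β ^ width x.length = s.reg r - 1 := Nat.mod_eq_of_lt (by omega)
    simp only [h0, decide_false, Bool.false_eq_true, if_false, bind, dec, zeros, pure,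
      decide_true, if_true, h1]
    congr 1
    · apply decide_eq_decide.2
      omega
    · congr 1
      funext u
      by_cases hu : u = r
      · subst hu; simp [h0]
      · simp [hu]

omit [Finite A] [AddCommMonoid W] in
theorem iter_const {U δ : Type} {body : δ → Den A U W δ} {d : δ} (h : body d = pure d) (j : ℕ) :
    iter body j d = pure d := by
  induction j with
  | zero => rfl
  | succ j ih =>
    funext x s k
    rw [iter, bind, h, pure, ih]

end Den

/-- Two stores agree, except for the position of the input head and the scratch registers. -/
structure Keep {U : Type} (scratch : U → Bool) (B : ℕ) (s s' : St A U) : Prop where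
  out : s'.out = s.out
  reg : ∀ u, scratch u = false → s'.reg u = s.reg u
  lt : ∀ u, s'.reg u < B

omit [Finite A] in
theorem Keep.trans {U : Type} {sc : U → Bool} {B : ℕ} {s s' s'' : St A U} (h : Keep sc B s s')
    (h' : Keep sc B s' s'') : Keep sc B s s'' :=
  ⟨h'.out.trans h.out, fun u hu => (h'.reg u hu).trans (h.reg u hu), h'.lt⟩

namespace Den

variable {β S : ℕ} {f : PartialFun A} {x : List A}

/-- The effect of a simulated deterministic step in the copy bank. -/
theorem vstep_copy (hB : x.length + 2 ≤ β ^ width x.length)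
    {c : M.Config} {a : M.Act} (hc : M.choices x c = {a}) (hscan : c.oracle.scan = none)
    {s : St A (Rg M F)} (hs : ∀ u, s.reg u < β ^ width x.length)
    (hV : VRep M S x c fun v => s.reg (bank 2 v)) :
    ∃ s' : St A (Rg M F), s'.out = s.out ∧ s'.reg = nextReg M (unbank 2) (bank 2)
        (readCell x c.inPos) a (Function.update s.reg (ctr 0) 0) ∧
      ∀ k : Option M.Act → St A (Rg M F) → W,
      vstep β M (unbank 2) (bank 2) c.state (readAt β (ctr 0) (bank 2 none)) (pure none) x s k =
        k (some a) s' := by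
  have hne : ∀ v, (bank 2 v : Rg M F) ≠ ctr 0 := fun v => by simp [bank, ctr]
  have hpos : s.reg (bank 2 none) = c.inPos := hV.pos
  refine ⟨⟨moveOn x .stay c.inPos, nextReg M (unbank 2) (bank 2)
    (readCell x c.inPos) a (Function.update s.reg (ctr 0) 0), s.out⟩, rfl, rfl, fun k => ?_⟩
  rw [vstep_eq (w := x) (S := S) (s₁ := s)
    (s₂ := ⟨c.inPos, Function.update s.reg (ctr 0) 0, s.out⟩) (unbank_iff 2)
    (fun k => by rw [hscan]; rfl) (fun k => by
      rw [readAt_eq _ _ hB _ _ (by rw [hpos]; exact hV.pos_le), hpos])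
    (by simpa [hne] using hV) (fun u => by
      by_cases hu : u = ctr 0
      · subst hu; simp; omega
      · simpa [hu] using hs u), hc, if_neg (Finset.singleton_ne_empty _), Finset.sum_singleton]

/-- Determinism makes each simulated step a single continuation, so the rerun contributes no
multiplicity. It stops at the letter which brings the counter to `0`, or with the right end marker
if the query is submitted earlier; the remaining rounds are idle. -/
theorem iter_askStep (hB : x.length + 2 ≤ β ^ width x.length)
    (hS : symBase M.Sym ^ S ≤ β ^ width x.length) {n : ℕ} {c : M.Config} {ls : List A}
    (h : Asks f x S n c ls) {j m : ℕ} (hj : n ≤ j) {s : St A (Rg M F)}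
    (hs : ∀ u, s.reg u < β ^ width x.length)
    (hV : VRep M S x c fun v => s.reg (bank 2 v)) (hm : s.reg (ctr 3) = m + 1) :
    ∃ s' : St A (Rg M F), Keep isCopy (β ^ width x.length) s s' ∧
      ∀ k : M.State ⊕ Marked A → St A (Rg M F) → W,
      iter (askStep β) j (.inl c.state) x s k = k (.inr (readCell ls (m + 1))) s' := by
  -- A simulated step changes only the copy bank and the counter used for walking. The registers do
  -- not represent the oracle tape, so `o` is arbitrary.
  have hkeep : ∀ {c : M.Config} {a : M.Act} {s s' : St A (Rg M F)} (o : OracleTape A),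
      (∀ t, (a.workMove t).apply (c.head t) < S) →
      (∀ u, s.reg u < β ^ width x.length) →
      VRep M S x c (fun v => s.reg (bank 2 v)) → s'.out = s.out →
      s'.reg = nextReg M (unbank 2) (bank 2) (readCell x c.inPos) a
        (Function.update s.reg (ctr 0) 0) →
      Keep isCopy (β ^ width x.length) s s' ∧
        VRep M S x (M.advance x c a o) (fun v => s'.reg (bank 2 v)) ∧
        s'.reg (ctr 3) = s.reg (ctr 3) := by
    intro c a s s' o hS' hs hV hout hreg
    have hV' : VRep M S x (M.advance x c a o) fun v => s'.reg (bank 2 v) := by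
      rw [hreg]
      refine VRep.next ?_ (unbank_iff 2) hS' o
      simpa [bank, ctr] using hV
    refine ⟨⟨hout, fun u hu => ?_, hV'.lt (unbank_iff 2) hB hS fun u hu => ?_⟩, hV', ?_⟩
    · rw [hreg]
      rcases u with ⟨j, v⟩ | v | j
      · simp [isCopy] at hu
        simp [nextReg, unbank, ctr, hu]
      · simp [nextReg, unbank, ctr]
      · simp [isCopy] at hu
        simp [nextReg, unbank, ctr, hu]
    · rw [hreg, nextReg, hu]
      by_cases h : u = ctr 0
      · subst h; simp; omega
      · simpa [h] using hs u
    · rw [hreg]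
      simp [nextReg, unbank, ctr]
  induction h generalizing j m s with
  | @query c a hc hscan hS' ha =>
    obtain ⟨j, rfl⟩ : ∃ i, j = i + 1 := ⟨j - 1, by omega⟩
    obtain ⟨s', h1, h2, h3⟩ := vstep_copy (W := W) hB hc hscan hs hV
    refine ⟨s', (hkeep (.writing []) hS' hs hV h1 h2).1, fun k => ?_⟩
    rw [iter, bind, askStep, bind, h3]
    simp only [ha]
    rw [pure, iter_const (body := askStep β) rfl]
    simp [pure, readCell]
  | @write c c' a l n ls hc hscan hc' hS' ha h ih =>
    obtain ⟨j, rfl⟩ : ∃ i, j = i + 1 := ⟨j - 1, by omega⟩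
    obtain ⟨s', h1, h2, h3⟩ := vstep_copy (W := W) hB hc hscan hs hV
    obtain ⟨o, -, rfl⟩ := Machine.step_eq_some_iff.1 hc'
    obtain ⟨h4, h5, h6⟩ := hkeep o hS' hs hV h1 h2
    rw [hm] at h6
    have h7 : Keep isCopy (β ^ width x.length) s'
        { s' with reg := Function.update s'.reg (ctr 3) m } := by
      refine ⟨rfl, fun u hu => ?_, fun u => ?_⟩
      · refine Function.update_of_ne ?_ _ _
        rintro rfl
        simp [isCopy, ctr] at hu
      · by_cases hu : u = ctr 3
        · subst hu
          have := h4.lt (ctr 3)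
          simp; omega
        · simpa [hu] using h4.lt u
    have hstep : ∀ k : M.State ⊕ Marked A → St A (Rg M F) → W,
        askStep β (.inl c.state) x s k = k (if m = 0 then .inr (.sym l) else .inl a.next)
          { s' with reg := Function.update s'.reg (ctr 3) m } := by
      intro k
      rw [askStep, bind, h3]
      simp only [ha]
      rw [bind, countdown_eq _ (h4.lt _), h6, pure]
      simp
    rcases m with - | m
    · refine ⟨_, h4.trans h7, fun k => ?_⟩
      rw [iter, bind, hstep, if_pos rfl, iter_const (body := askStep β) rfl]
      simp [pure, readCell]
    · obtain ⟨s'', h8, h9⟩ := ih (j := j) (m := m)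
        (s := { s' with reg := Function.update s'.reg (ctr 3) (m + 1) }) (by omega) h7.lt
        (by simpa [bank, ctr] using h5) (by simp)
      refine ⟨s'', (h4.trans h7).trans h8, fun k => ?_⟩
      rw [iter, bind, hstep, if_neg (Nat.succ_ne_zero m)]
      refine (h9 k).trans ?_
      simp [readCell]
  | @other c c' a n ls hc hscan hc' hS' ha ha' h ih =>
    obtain ⟨j, rfl⟩ : ∃ i, j = i + 1 := ⟨j - 1, by omega⟩
    obtain ⟨s', h1, h2, h3⟩ := vstep_copy (W := W) hB hc hscan hs hV
    obtain ⟨o, -, rfl⟩ := Machine.step_eq_some_iff.1 hc'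
    obtain ⟨h4, h5, h6⟩ := hkeep o hS' hs hV h1 h2
    obtain ⟨s'', h8, h9⟩ := ih (j := j) (m := m) (s := s') (by omega) h4.lt h5 (h6.trans hm)
    refine ⟨s'', h4.trans h8, fun k => ?_⟩
    have hstep : askStep β (.inl c.state) x s =
        fun k : M.State ⊕ Marked A → St A (Rg M F) → W => k (.inl a.next) s' := by
      funext k
      rw [askStep, bind, h3]
      rcases hao : a.oracle with - | l | - | d
      · simp only [hao, pure]
      · exact absurd hao (ha' l)
      · exact absurd hao ha
      · simp only [hao, pure]
    rw [iter, bind, hstep]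
    exact h9 k

/-- `info` describes the query `q`; if `q` is not empty, then the numbers `g` represent the
configuration after its first letter has been written. -/
def QRep (B : ℕ) (f : PartialFun A) (x : List A) (S : ℕ) (info : Option (A × M.State))
    (q : List A) (g : VReg M.Tape → ℕ) : Prop :=
  (info = none ∧ q = []) ∨ ∃ (a : A) (c : M.Config) (n : ℕ) (ls : List A),
    info = some (a, c.state) ∧ q = a :: ls ∧ Asks f x S n c ls ∧ n ≤ B ∧ VRep M S x c g

/-- The first letter comes from the finite control, because the saved configuration is the one after
it; later cells come from a rerun in the copy bank, which leaves the saved configuration intact for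
further use. -/
theorem readQ_eq (hB : x.length + 2 ≤ β ^ width x.length)
    (hS : symBase M.Sym ^ S ≤ β ^ width x.length) {info : Option (A × M.State)} {q : List A}
    {s : St A (Rg M F)} (hs : ∀ u, s.reg u < β ^ width x.length)
    (hq : s.reg (fbank none) ≤ q.length + 1)
    (hinfo : QRep (β ^ width x.length) f x S info q fun v => s.reg (bank 1 v)) :
    ∃ s' : St A (Rg M F), Keep isCopy (β ^ width x.length) s s' ∧
      ∀ k : Marked A → St A (Rg M F) → W,
      readQ β info x s k = k (readCell q (s.reg (fbank none))) s' := by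
  rcases hinfo with ⟨rfl, rfl⟩ | ⟨a, c, n, ls, rfl, rfl, hA, hn, hV⟩
  · refine ⟨s, ⟨rfl, fun _ _ => rfl, hs⟩, fun k => ?_⟩
    simp only [readQ, bind, zeros, pure, Nat.mod_eq_of_lt (hs _)]
    simp only [List.length_nil] at hq
    interval_cases h : s.reg (fbank none) <;> simp [readCell]
  · by_cases h0 : s.reg (fbank none) = 0
    · refine ⟨s, ⟨rfl, fun _ _ => rfl, hs⟩, fun k => ?_⟩
      simp [readQ, bind, zeros, pure, h0, readCell]
    · let s₁ : St A (Rg M F) := { s with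
        reg := Function.update (fun u => (loadCopy u).elim 0 s.reg) (ctr 3)
          (s.reg (fbank none) - 1) }
      have hload : ∀ u, isCopy u = false → (loadCopy u).elim 0 s.reg = s.reg u := by
        rintro (⟨j, v⟩ | v | j) hu
        · simp [isCopy] at hu
          simp [loadCopy, hu]
        · simp [loadCopy]
        · simp [isCopy] at hu
          simp [loadCopy, hu]
      have hlt : ∀ u, (loadCopy u).elim 0 s.reg < β ^ width x.length := by
        rintro (⟨j, v⟩ | v | j)
        · simp only [loadCopy]; split_ifs <;> exact hs _
        · exact hs _
        · simp only [loadCopy]; split_ifs <;> exact hs _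
      have h1 : Keep isCopy (β ^ width x.length) s s₁ := by
        refine ⟨rfl, fun u hu => ?_, fun u => ?_⟩
        · simp only [s₁]
          rw [Function.update_of_ne, hload u hu]
          rintro rfl
          simp [isCopy, ctr] at hu
        · by_cases hu : u = ctr 3
          · subst hu
            have := hs (fbank none)
            simp [s₁]; omega
          · simpa [s₁, hu] using hlt u
      have hstart : ∀ k : Marked A → St A (Rg M F) → W,
          readQ β (some (a, c.state)) x s k =
            if s.reg (fbank none) = 1 then k (.sym a) s₁ else
              rep β (askStep β) (.inl c.state) x s₁ fun r s' =>
                k (r.elim (fun _ => .rend) id) s' := by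
        intro k
        simp only [readQ, bind, zeros, Nat.mod_eq_of_lt (hs _), h0, decide_false,
          Bool.false_eq_true, if_false, ren]
        rw [countdown_eq (ctr 3) (hlt (ctr 3))]
        have h3 : (loadCopy (ctr 3 : Rg M F)).elim 0 s.reg = s.reg (fbank none) := rfl
        simp only [h3]
        by_cases h1 : s.reg (fbank none) = 1
        · simp [h1, pure, s₁]
        · simp [h1, s₁, bind, pure]
      by_cases h1' : s.reg (fbank none) = 1
      · refine ⟨s₁, h1, fun k => ?_⟩
        rw [hstart, if_pos h1', h1']
        simp [readCell]
      -- Cell `m + 2` of `a :: ls` is cell `m + 1` of `ls`; the countdown for the first letter has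
      -- left `m + 1` in the counter.
      · obtain ⟨m, hm⟩ : ∃ m, s.reg (fbank none) = m + 2 := ⟨s.reg (fbank none) - 2, by omega⟩
        obtain ⟨s', h2, h3⟩ := iter_askStep (W := W) (m := m) (s := s₁) hB hS hA hn h1.lt
          (by simpa [s₁, bank, ctr, loadCopy] using hV) (by simp [s₁, hm])
        refine ⟨s', h1.trans h2, fun k => ?_⟩
        rw [hstart, if_neg h1', rep, h3, hm]
        simp [readCell]

end Den

namespace Real

variable {β L : ℕ} [NeZero β]

omit [Finite A] in
theorem countdown {ℓ : ℕ} (r : Rg M F) : Real β L ℓ (Den.countdown β r : Den A (Rg M F) W _) := by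
  refine zeros.bind fun z => ?_
  split_ifs
  · exact pure _
  · exact (dec _).bind fun _ => zeros.bind fun _ => pure _

theorem askStep (hL : 1 ≤ L) (d : M.State ⊕ Marked A) :
    Real β L 1 (Den.askStep β d : Den A (Rg M F) W _) := by
  rcases d with q | r
  · refine (vstep q (readAt hL _ _) (pure _)).bind fun r => ?_
    rcases r with - | a
    · exact pure _
    · dsimp only
      split
      · exact (countdown _).bind fun _ => pure _
      · exact pure _
      · exact pure _
  · exact pure _

theorem readQ (hL : 2 ≤ L) (info : Option (A × M.State)) :
    Real β L 2 (Den.readQ β info : Den A (Rg M F) W _) := by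
  rcases info with - | ⟨a, q⟩
  · exact zeros.bind fun _ => pure _
  · refine zeros.bind fun z => ?_
    split_ifs
    · exact pure _
    · refine (ren _).bind fun _ => (countdown _).bind fun h => ?_
      split_ifs
      · exact pure _
      · exact (rep (ℓ := 1) hL (fun d => askStep (by omega) d) _).bind fun _ => pure _

end Real
end ModLog

/-! ### Recomputing symbols of an answer -/

namespace ModLog

open Rg

variable {A W : Type} {M F : Machine A}

/-- The registers which are used for computing a symbol of the answer of the oracle. -/
def Rg.isSub : Rg M F → Bool
  | .inl (j, _) => j = 2
  | .inr (.inl _) => true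
  | .inr (.inr j) => j ≠ 1

theorem Rg.isSub_of_isCopy {u : Rg M F} (h : isSub u = false) : isCopy u = false := by
  rcases u with ⟨j, v⟩ | v | j
  · exact h
  · rfl
  · simp only [isSub, decide_not, Bool.not_eq_eq_eq_not, Bool.not_false, decide_eq_true_eq] at h
    subst h
    simp [isCopy]

theorem Keep.of_isCopy {B : ℕ} {s s' : St A (Rg M F)} (h : Keep isCopy B s s') :
    Keep isSub B s s' :=
  ⟨h.out, fun u hu => h.reg u (isSub_of_isCopy hu), h.lt⟩

/-- The symbol in cell `p`, if no end marker is there. -/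
def letterAt (y : List A) : ℕ → Option A
  | 0 => none
  | p + 1 => y[p]?

theorem Machine.Run.append {f : PartialFun A} {x : List A} {c c' c'' : M.Config}
    {l l' : List M.Act} (h : M.Run f x c l c') (h' : M.Run f x c' l' c'') :
    M.Run f x c (l ++ l') c'' := by
  induction h with
  | nil => exact h'
  | cons ha hs _ ih => exact .cons ha hs (ih h')

theorem Machine.Reachable.step {f : PartialFun A} {x : List A} {c c' : M.Config} {a : M.Act}
    (h : M.Reachable f x c) (ha : a ∈ M.enabled x c) (hs : M.step f x c a = some c') :
    M.Reachable f x c' := by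
  obtain ⟨l, hl⟩ := h
  exact ⟨l ++ [a], hl.append (.cons ha hs (.nil _))⟩

namespace Den

/-- Stop without accepting. -/
def fail {U α : Type} [AddCommMonoid W] : Den A U W α := act fun _ => (.stay, none, ∅)

variable (β : ℕ)

open Classical in
/-- Simulate one step of the machine which computes the oracle. -/
noncomputable def oracleStep [Finite A] [AddCommMonoid W] (info : Option (A × M.State)) :
    (F.State × Option A) ⊕ Option A → Den A (Rg M F) W ((F.State × Option A) ⊕ Option A)
  | .inr r => pure (.inr r)
  | .inl (q, r) => (vstep β F unfbank fbank q (readQ β info) (pure none)).bind fun o => match o with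
      | none => if q ∈ F.accept then pure (.inr r) else fail
      | some a => match a.out with
        | none => pure (.inl (a.next, r))
        | some l => (countdown β (ctr 2)).bind fun h =>
            pure (.inl (a.next, if h then some l else r))

/-- Load the counter of answer letters, and erase the bank of the machine which computes the
oracle. -/
def loadAnswer : Rg M F → Option (Rg M F)
  | .inl v => some (.inl v)
  | .inr (.inl _) => none
  | .inr (.inr j) => if j = 2 then some (ctr 1) else some (.inr (.inr j))

/-- Compute the symbol of the answer of the oracle in the position given by a counter. -/
noncomputable def oracleSym [Finite A] [AddCommMonoid W] (info : Option (A × M.State)) :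
    Den A (Rg M F) W (Marked A) :=
  (ren loadAnswer).bind fun _ =>
    (rep β (oracleStep β info) (.inl (F.start, none))).bind fun r => match r with
      | .inl _ => fail
      | .inr r => (zeros β).bind fun z =>
          (ren fun u => if isSub u then none else some u).bind fun _ => (rewind β).bind fun _ =>
            pure (if z (ctr 1) then .lend else r.elim .rend .sym)

variable {β} {S S' : ℕ} {f : PartialFun A} {x : List A} {R : Type}

theorem fail_eq {U α : Type} [AddCommMonoid W] (s : St A U) (k : α → St A U → W) :
    fail x s k = 0 := by
  simp [fail, act]

theorem letterAt_append (y z : List A) (p : ℕ) :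
    letterAt (y ++ z) p = if p ≤ y.length then letterAt y p else letterAt z (p - y.length) := by
  rcases p with - | p
  · simp [letterAt]
  · split_ifs with h
    · simp only [letterAt]
      rw [List.getElem?_append_left (by omega)]
    · obtain ⟨i, rfl⟩ : ∃ i, p = y.length + i := ⟨p - y.length, by omega⟩
      rw [show y.length + i + 1 - y.length = i + 1 by omega]
      simp only [letterAt]
      rw [List.getElem?_append_right (by omega), Nat.add_sub_cancel_left]

theorem letterAt_eq_none {y : List A} {p : ℕ} (h : y.length < p) : letterAt y p = none := by
  rcases p with - | p
  · rfl
  · simpa [letterAt] using Nat.lt_succ_iff.1 h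

theorem readCell_eq (y : List A) (p : ℕ) :
    readCell y p = if p = 0 then .lend else (letterAt y p).elim .rend .sym := by
  rcases p with - | p
  · rfl
  · simp only [readCell, letterAt, Nat.succ_ne_zero, if_false]
    cases y[p]? <;> rfl

variable [Finite A]

/-- With `p = s₀.reg (ctr 1)`, the control remembers the letter in cell `p` of the output so far,
and `ctr 2` holds the number of letters still missing. By `hk` the continuation sees nothing else of
a branch of `F`, so the value is linear in the output distribution of `F`. Unfinished branches have
weight `0` by `hk'`. -/
theorem iter_oracleStep [AddCommMonoid W] [CommSemiring R] [Module R W]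
    (hF : F.OracleFree) (hB : x.length + 2 ≤ β ^ width x.length)
    (hS : symBase M.Sym ^ S ≤ β ^ width x.length)
    (hS' : symBase F.Sym ^ S' ≤ β ^ width x.length)
    {info : Option (A × M.State)} {q : List A} (hq : q.length + 2 ≤ β ^ width x.length)
    (hheads : ∀ c, F.Reachable (noOracle A) q c → ∀ t, c.head t < S')
    {s₀ : St A (Rg M F)}
    (hinfo : QRep (β ^ width x.length) f x S info q fun v => s₀.reg (bank 1 v))
    (K : Option A → W)
    (k : (F.State × Option A) ⊕ Option A → St A (Rg M F) → W)
    (hk : ∀ r s, Keep isSub (β ^ width x.length) s₀ s → k (.inr r) s = K r)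
    (hk' : ∀ d s, k (.inl d) s = 0) (j : ℕ) {c : F.Config} {s : St A (Rg M F)}
    (hc : F.Reachable (noOracle A) q c) (ho : c.oracle = .writing [])
    (hs : Keep isSub (β ^ width x.length) s₀ s)
    (hV : VRep F S' q c fun v => s.reg (fbank v))
    (hctr : s.reg (ctr 2) = s₀.reg (ctr 1) - c.out.length) :
    iter (oracleStep β info) j (.inl (c.state, letterAt c.out (s₀.reg (ctr 1)))) x s k =
      Finsupp.linearCombination R (fun y => K (letterAt y (s₀.reg (ctr 1))))
        (F.dist R (noOracle A) q j c) := by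
  induction j generalizing c s with
  | zero => simp [iter, pure, hk', Machine.dist]
  | succ j ih =>
    obtain ⟨s₂, h1, h2⟩ := readQ_eq (W := W) hB hS hs.lt (q := q) (info := info) (f := f)
      (by have := hV.pos; have := hV.pos_le; omega) (by
        convert hinfo using 2 with v
        exact hs.reg _ (by simp [isSub, bank]))
    have h3 : s.reg (fbank none) = c.inPos := hV.pos
    have hV₂ : VRep F S' q c fun v => s₂.reg (fbank v) := by
      convert hV using 2 with v
      exact h1.reg _ (by simp [isCopy, fbank])
    have hctr₂ : s₂.reg (ctr 2) = s₀.reg (ctr 1) - c.out.length := by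
      rw [← hctr]
      exact h1.reg _ (by simp [isCopy, ctr])
    have hs₂ := hs.trans h1.of_isCopy
    rw [iter, bind, oracleStep, bind, vstep_eq (S := S') unfbank_iff
      (fun k => by rw [ho]; rfl) (fun k => by rw [h2, h3]) hV₂ h1.lt, Machine.dist]
    have hemp : F.choices q c = ∅ ↔ F.enabled q c = ∅ := by
      simp [Machine.choices]
    by_cases h4 : F.choices q c = ∅
    · by_cases h5 : c.state ∈ F.accept
      · have h6 : F.Accepting q c := ⟨hemp.1 h4, h5⟩
        simp only [if_pos h4, if_pos h5, if_pos h6]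
        rw [pure, iter_const (body := oracleStep β info) rfl, pure, hk, h4]
        · simp
        · exact hs₂.trans ⟨rfl, fun u hu => by
            rcases u with ⟨i, v⟩ | v | i
            · simp [scanBase, unfbank]
            · simp [isSub] at hu
            · simp [scanBase, unfbank], fun u => (Nat.div_le_self _ _).trans_lt (h1.lt u)⟩
      · have h6 : ¬ F.Accepting q c := fun h => h5 h.2
        simp only [if_pos h4, if_neg h5, if_neg h6]
        rw [fail_eq, h4]
        simp
    · have h6 : ¬ F.Accepting q c := fun h => h4 (hemp.2 h.1)
      rw [if_neg h4, if_neg h6, zero_add, map_sum]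
      refine Finset.sum_congr rfl fun a ha => ?_
      have ha' := Machine.mem_choices.1 ha
      have hidle : a.oracle = .idle := hF _ _ _ _ a ha'
      have hstep : F.step (noOracle A) q c a = some (F.advance q c a c.oracle) := by
        rw [Machine.step_eq_some_iff]
        exact ⟨_, by rw [hidle]; rfl, rfl⟩
      have hreach : F.Reachable (noOracle A) q (F.advance q c a c.oracle) :=
        hc.step ha' hstep
      rw [hstep, Option.elim_some]
      set s₃ : St A (Rg M F) := { s₂ with
        pos := moveOn x .stay s₂.pos
        reg := nextReg F unfbank fbank (readCell q c.inPos) a s₂.reg } with hs₃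
      have hV₃ : VRep F S' q (F.advance q c a c.oracle) fun v => s₃.reg (fbank v) :=
        hV₂.next unfbank_iff (hheads _ hreach) _
      have hk₃ : Keep isSub (β ^ width x.length) s₂ s₃ := by
        refine ⟨rfl, fun u hu => ?_, hV₃.lt unfbank_iff hq hS' fun u hu => ?_⟩
        · rcases u with ⟨i, v⟩ | v | i
          · simp [hs₃, nextReg, unfbank]
          · simp [isSub] at hu
          · simp [hs₃, nextReg, unfbank]
        · simp only [hs₃, nextReg, hu]
          exact h1.lt u
      have hctr₃ : s₃.reg (ctr 2) = s₀.reg (ctr 1) - c.out.length := by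
        rw [← hctr₂]
        simp [hs₃, nextReg, unfbank, ctr]
      have hout : (F.advance q c a c.oracle).out = c.out ++ a.out.toList := rfl
      rcases hao : a.out with - | l
      · simp only [hao]
        rw [hao, Option.toList_none, List.append_nil] at hout
        rw [← ih hreach ho (hs₂.trans hk₃) hV₃ (by rw [hout, hctr₃]), hout]
        rfl
      · simp only [hao]
        rw [hao, Option.toList_some] at hout
        rw [bind, countdown_eq _ (hk₃.lt _), pure, hctr₃]
        have hk₄ : Keep isSub (β ^ width x.length) s₃ { s₃ with
            reg := Function.update s₃.reg (ctr 2) (s₀.reg (ctr 1) - c.out.length - 1) } := by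
          refine ⟨rfl, fun u hu => ?_, fun u => ?_⟩
          · refine Function.update_of_ne ?_ _ _
            rintro rfl
            simp [isSub, ctr] at hu
          · by_cases hu : u = ctr 2
            · subst hu
              have := hk₃.lt (ctr 2)
              simp; omega
            · simpa [hu] using hk₃.lt u
        rw [← ih hreach ho ((hs₂.trans hk₃).trans hk₄) (by simpa [ctr, fbank] using hV₃)
          (by rw [hout]; simp [Nat.sub_sub]), hout]
        congr 3
        rw [letterAt_append]
        -- The new letter belongs into cell `p` exactly if one letter was missing. Otherwise the
        -- cell was filled before, or it remains empty.
        by_cases h7 : s₀.reg (ctr 1) - c.out.length = 1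
        · rw [if_neg (show ¬ s₀.reg (ctr 1) ≤ c.out.length by omega), h7]
          simp [letterAt]
        · simp only [h7, decide_false, Bool.false_eq_true, if_false]
          split_ifs with h8
          · rfl
          · rw [letterAt_eq_none (by omega), letterAt_eq_none (by simp; omega)]

/-- Erasing the working registers and rewinding the head makes the continuation a function of the
symbol alone. The linear combination over the outputs of `F` then collapses, by `hv`, to the correct
symbol, or to `0` if there is no answer. -/
theorem oracleSym_eq [AddCommMonoid W] [CommSemiring R] [Module R W]
    (hF : F.OracleFree) (hB : x.length + 2 ≤ β ^ width x.length)
    (hS : symBase M.Sym ^ S ≤ β ^ width x.length)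
    (hS' : symBase F.Sym ^ S' ≤ β ^ width x.length)
    {info : Option (A × M.State)} {q : List A} (hq : q.length + 2 ≤ β ^ width x.length)
    (hheads : ∀ c, F.Reachable (noOracle A) q c → ∀ t, c.head t < S') (hpos : 0 < S')
    {v : Option (List A)}
    (hv : F.dist R (noOracle A) q (β ^ width x.length) F.init =
      v.elim 0 fun v => Finsupp.single v 1)
    {s : St A (Rg M F)} (hs : ∀ u, s.reg u < β ^ width x.length)
    (hinfo : QRep (β ^ width x.length) f x S info q fun v => s.reg (bank 1 v))
    (k : Marked A → St A (Rg M F) → W) :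
    oracleSym β info x s k = v.elim 0 fun v => k (readCell v (s.reg (ctr 1)))
      ⟨0, fun u => if isSub u then 0 else s.reg u, s.out⟩ := by
  let s₁ : St A (Rg M F) := { s with reg := fun u => (loadAnswer u).elim 0 s.reg }
  have h1 : Keep isSub (β ^ width x.length) s s₁ := by
    refine ⟨rfl, ?_, ?_⟩
    · rintro (u | u | j) hu
      · rfl
      · simp [isSub] at hu
      · simp [isSub] at hu
        simp [s₁, loadAnswer, hu]
    · rintro (u | u | j)
      · exact hs _
      · simp [s₁, loadAnswer]; omega
      · simp only [s₁, loadAnswer]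
        split_ifs <;> exact hs _
  have h2 : s₁.reg (ctr 1) = s.reg (ctr 1) := h1.reg _ (by simp [isSub, ctr])
  have key := iter_oracleStep (R := R) (s := s₁) (s₀ := s₁) (c := F.init) hF hB hS hS' hq hheads
    (info := info) (f := f) (by
      convert hinfo using 2; rfl)
    (fun r => k (if s.reg (ctr 1) = 0 then .lend else r.elim .rend .sym)
      ⟨0, fun u => if isSub u then 0 else s.reg u, s.out⟩)
    (fun r s' => (match r with
      | .inl _ => fail
      | .inr r => (zeros β).bind fun z =>
          (ren fun u => if isSub u then none else some u).bind fun _ => (rewind β).bind fun _ =>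
            pure (if z (ctr 1) then .lend else r.elim .rend .sym) : Den A (Rg M F) W (Marked A))
      x s' k) (fun r s' hs' => ?_) (fun d s' => fail_eq _ _) (β ^ width x.length) ⟨[], .nil _⟩ rfl
    ⟨rfl, fun _ _ => rfl, h1.lt⟩ (VRep.init hpos fun v => by simp [s₁, loadAnswer, fbank])
    (by simp [s₁, loadAnswer, ctr, Machine.init])
  · rw [oracleSym, bind, ren, bind, rep]
    have h3 : letterAt (F.init.out) (s₁.reg (ctr 1)) = none := by
      cases s₁.reg (ctr 1) <;> rfl
    rw [h3, h2] at key
    refine key.trans ?_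
    rw [hv]
    cases v with
    | none => simp
    | some v => simp [readCell_eq]
  · have h4 := h1.trans hs'
    have h5 : s'.reg (ctr 1) = s.reg (ctr 1) := h4.reg _ (by simp [isSub, ctr])
    simp only [bind, zeros, ren, rewind_eq hB, pure, h5,
      decide_eq_true_eq, h4.out]
    have h6 : s.reg (ctr 1) % β ^ width x.length = s.reg (ctr 1) := Nat.mod_eq_of_lt (hs _)
    rw [h6]
    congr 2
    funext u
    cases hu : isSub u
    · simp [h4.reg u hu]
    · simp

end Den

namespace Real

variable {β L : ℕ} [NeZero β] [AddCommMonoid W]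

theorem fail {U α : Type} {ℓ : ℕ} : Real β L ℓ (Den.fail : Den A U W α) := act _

variable [Finite A]

theorem oracleStep (hL : 2 ≤ L) (info : Option (A × M.State))
    (d : (F.State × Option A) ⊕ Option A) :
    Real β L 2 (Den.oracleStep β info d : Den A (Rg M F) W _) := by
  rcases d with ⟨q, r⟩ | r
  · refine (vstep q (readQ hL info) (pure _)).bind fun o => ?_
    rcases o with - | a
    · dsimp only
      split_ifs
      · exact pure _
      · exact fail
    · dsimp only
      split
      · exact pure _
      · exact (countdown _).bind fun _ => pure _
  · exact pure _

theorem oracleSym (hL : 3 ≤ L) (info : Option (A × M.State)) :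
    Real β L 3 (Den.oracleSym β info : Den A (Rg M F) W _) := by
  refine (ren _).bind fun _ => (rep (ℓ := 2) hL (fun d => oracleStep (by omega) info d) _).bind
    fun r => ?_
  rcases r with d | r
  · exact fail
  · exact zeros.bind fun z => (ren _).bind fun _ => ((rewind (by omega)).mono (by omega)).bind
      fun _ => pure _

end Real
end ModLog

/-! ### Simulating the oracle tape -/

namespace ModLog

open Rg

variable {A W : Type} {M F : Machine A}

namespace Den

variable (β : ℕ)

/-- Save the current bank. -/
def saveBank : Rg M F → Option (Rg M F)
  | .inl (j, v) => if j = 1 then some (bank 0 v) else some (.inl (j, v))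
  | .inr u => some (.inr u)

/-- Simulate the action of an instruction on the oracle tape.  The word on the oracle tape is
described by `info`; it has been submitted if `ans` holds. -/
noncomputable def oraclePart (o : Option (Marked A)) (info : Option (A × M.State)) (ans : Bool)
    (a : M.Act) : Den A (Rg M F) W (Option (A × M.State) × Bool) :=
  match a.oracle with
  | .idle => pure (info, ans)
  | .write l => if ans = false ∧ info.isSome then pure (info, false) else
      (ren saveBank).bind fun _ => pure (some (l, a.next), false)
  | .query => (ren fun u => if u = ctr 1 then none else some u).bind fun _ =>
      pure (if ans then none else info, true)
  | .move d => match o with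
    | none => pure (info, ans)
    | some i => (affine (fun _ => 1) fun u => if u = ctr 1 then (posInc i d).toNat else 0).bind
        fun _ => (dec β fun u => decide (u = ctr 1) && posDec i d).bind fun _ => pure (info, ans)

variable [Finite A] [AddCommMonoid W]

/-- Compute the symbol which is scanned on the oracle tape. -/
noncomputable def scanOracle (info : Option (A × M.State)) (ans : Bool) :
    Den A (Rg M F) W (Option (Marked A)) :=
  if ans then (oracleSym β info).bind fun i => pure (some i) else pure none

open Classical in
/-- Simulate one step of the oracle machine; the result `none` means that it has accepted. -/
noncomputable def mainStep : Option (M.State × Option (A × M.State) × Bool) →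
    Den A (Rg M F) W (Option (M.State × Option (A × M.State) × Bool))
  | none => pure none
  | some (q, info, ans) => (scanOracle β info ans).bind fun o =>
      (vstep β M (unbank 0) (bank 0) q (readAt β (ctr 0) (bank 0 none)) (pure o)).bind fun r =>
        match r with
        | none => if q ∈ M.accept then pure none else fail
        | some a => (act fun _ => (.stay, a.out, {()})).bind fun _ =>
            (oraclePart β o info ans a).bind fun r => pure (some (a.next, r))

/-- Simulate the oracle machine. -/
noncomputable def mainLoop : Den A (Rg M F) W Unit :=
  (rep β (mainStep β) (some (M.start, none, false))).bind fun d => match d with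
    | none => pure ()
    | some _ => fail

end Den

/-- `info` describes the query `q` which `M` is writing in configuration `c`. -/
def PreQRep [Finite A] (f : PartialFun A) (x : List A) (S T : ℕ) (info : Option (A × M.State))
    (q : List A) (c : M.Config) (g : VReg M.Tape → ℕ) : Prop :=
  (info = none ∧ q = []) ∨ ∃ (a : A) (c₀ : M.Config) (ls : List A) (m : ℕ),
    info = some (a, c₀.state) ∧ q = a :: ls ∧ VRep M S x c₀ g ∧ m ≤ T ∧
      ∀ n ls', Asks f x S n c ls' → Asks f x S (n + m) c₀ (ls ++ ls')

/-- The store `s` represents the configuration `c`, which is reached by the instructions `l`. -/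
structure Sim [Finite A] (f : PartialFun A) (x : List A) (S B : ℕ) (l : List M.Act) (q : List A)
    (info : Option (A × M.State)) (ans : Bool) (c : M.Config) (s : St A (Rg M F)) : Prop where
  run : M.Run f x M.init l c
  len : q.length ≤ l.length
  lt : ∀ u, s.reg u < B
  rep : VRep M S x c fun v => s.reg (bank 0 v)
  out : s.out = c.out
  oracle : (ans = false ∧ c.oracle = .writing q ∧
      PreQRep f x S l.length info q c fun v => s.reg (bank 1 v)) ∨
    (ans = true ∧ ∃ v, c.oracle = .answer v (s.reg (ctr 1)) ∧ s.reg (ctr 1) ≤ v.length + 1 ∧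
      s.reg (ctr 1) ≤ l.length ∧ f q = some v ∧
      Den.QRep B f x S info q fun v => s.reg (bank 1 v))

namespace Den

variable [Finite A] {β S S' : ℕ} {f : PartialFun A} {x : List A}

/-- The oracle action itself never branches and never fails in the simulation. If `M` has no
successor, the last conclusion records what is needed to show that the pretended answer contributes
nothing later. -/
theorem oraclePart_eq {l : List M.Act} {q : List A} {info : Option (A × M.State)} {ans : Bool}
    {c : M.Config} {s s' : St A (Rg M F)} (h : Sim f x S (β ^ width x.length) l q info ans c s)
    (hdet : M.DeterministicQueries f) (hheads : ∀ c, M.Reachable f x c → ∀ t, c.head t + 1 < S)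
    (hT : ∀ l c, M.Run f x M.init l c → l.length + 2 ≤ β ^ width x.length)
    {a : M.Act} (ha : a ∈ M.enabled x c) (hlt : ∀ u, s'.reg u < β ^ width x.length)
    (hrep : ∀ o, VRep M S x (M.advance x c a o) fun v => s'.reg (bank 0 v))
    (hout : s'.out = c.out ++ a.out.toList) (h1 : ∀ v, s'.reg (bank 1 v) = s.reg (bank 1 v))
    (hctr : s'.reg (ctr 1) = s.reg (ctr 1)) :
    ∃ (q' : List A) (info' : Option (A × M.State)) (ans' : Bool) (s'' : St A (Rg M F)),
      (∀ k : _ → _ → W, oraclePart β c.oracle.scan info ans a x s' k = k (info', ans') s'') ∧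
      (∀ c', M.step f x c a = some c' →
        Sim f x S (β ^ width x.length) (l ++ [a]) q' info' ans' c' s'') ∧
      (M.step f x c a = none → ans' = true ∧ f q' = none ∧ q'.length ≤ l.length ∧
        (∀ u, s''.reg u < β ^ width x.length) ∧
        QRep (β ^ width x.length) f x S info' q' fun v => s''.reg (bank 1 v)) := by
  have hS : ∀ t, (a.workMove t).apply (c.head t) < S := fun t => by
    have := hheads c ⟨l, h.run⟩ t
    cases a.workMove t <;> simp only [Move.apply] <;> omega
  have hrun : ∀ c', M.step f x c a = some c' → M.Run f x M.init (l ++ [a]) c' := fun c' hc' =>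
    h.run.append (.cons ha hc' (.nil _))
  have hlen : (l ++ [a]).length = l.length + 1 := by simp
  have hB := hT l c h.run
  -- This is where the Ruzzo–Simon–Tompa convention enters: with a letter on the tape, the enabled
  -- instruction is the only one.
  have hch : c.oracle.queryWord ≠ [] → M.choices x c = {a} := fun hq => by
    have := hdet x c ⟨l, h.run⟩ (.inl hq)
    ext b
    simp only [Machine.mem_choices, Finset.mem_singleton]
    exact ⟨fun hb => this hb ha, fun hb => hb ▸ ha⟩
  have h1' : (fun v => s'.reg (bank 1 v)) = fun v => s.reg (bank 1 v) := funext h1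
  -- steps which leave the oracle tape alone
  have hsame : (∀ k : _ → _ → W, oraclePart β c.oracle.scan info ans a x s' k =
      k (info, ans) s') → c.oracle.act f a.oracle = some c.oracle → a.oracle ≠ .query →
      (∀ l, a.oracle ≠ .write l) → ∃ (q' : List A) (info' : Option (A × M.State)) (ans' : Bool)
      (s'' : St A (Rg M F)),
      (∀ k : _ → _ → W, oraclePart β c.oracle.scan info ans a x s' k = k (info', ans') s'') ∧
      (∀ c', M.step f x c a = some c' →
        Sim f x S (β ^ width x.length) (l ++ [a]) q' info' ans' c' s'') ∧
      (M.step f x c a = none → ans' = true ∧ f q' = none ∧ q'.length ≤ l.length ∧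
        (∀ u, s''.reg u < β ^ width x.length) ∧
        QRep (β ^ width x.length) f x S info' q' fun v => s''.reg (bank 1 v)) := by
    intro hk hact hnq hnw
    have hstep : M.step f x c a = some (M.advance x c a c.oracle) :=
      Machine.step_eq_some_iff.2 ⟨_, hact, rfl⟩
    refine ⟨q, info, ans, s', hk, fun c' hc' => ?_, fun hn => by rw [hstep] at hn; cases hn⟩
    have hr := hrun c' hc'
    have hc := hc'
    rw [hstep, Option.some.injEq] at hc
    subst hc
    refine ⟨hr, by have := h.len; omega, hlt, hrep _, hout, ?_⟩
    rw [h1', hctr, hlen]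
    rcases h.oracle with ⟨h2, h3, h4⟩ | ⟨h2, v, h3, h4, h5, h6⟩
    · refine .inl ⟨h2, h3, ?_⟩
      rcases h4 with h4 | ⟨b, c₀, ls, m, h4, h5, h6, h7, h8⟩
      · exact .inl h4
      · refine .inr ⟨b, c₀, ls, m + 1, h4, h5, h6, by omega, fun n ls' hA => ?_⟩
        -- A forced step which writes nothing lengthens the rerun by one step and leaves its letters
        -- unchanged.
        have := h8 (n + 1) ls' (.other (hch (by rw [h3, h5]; simp [OracleTape.queryWord]))
          (by rw [h3]; rfl) hc' hS hnq hnw hA)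
        rwa [show n + (m + 1) = n + 1 + m by omega]
    · exact .inr ⟨h2, v, h3, h4, by omega, h6⟩
  rcases hao : a.oracle with - | b | - | d
  · exact hsame (fun k => by simp only [oraclePart, hao, pure]) (by rw [hao]; rfl)
      (by simp [hao]) (by simp [hao])
  · -- write
    have hstep : M.step f x c a =
        some (M.advance x c a (.writing (c.oracle.queryWord ++ [b]))) :=
      Machine.step_eq_some_iff.2 ⟨_, by rw [hao]; rfl, rfl⟩
    by_cases hc : ans = false ∧ info.isSome
    · rcases h.oracle with ⟨h2, h3, h4⟩ | ⟨h2, -⟩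
      · refine ⟨q ++ [b], info, false, s', fun k => ?_, fun c' hc' => ?_, fun hn => by
          rw [hstep] at hn; cases hn⟩
        · simp only [oraclePart, hao]
          rw [if_pos hc, pure]
        have hr := hrun c' hc'
        have hc'' := hc'
        rw [hstep, Option.some.injEq] at hc''
        subst hc''
        refine ⟨hr, by have := h.len; simp; omega, hlt, hrep _, hout, .inl ⟨rfl, ?_, ?_⟩⟩
        · simp [Machine.advance, h3, OracleTape.queryWord]
        · rw [h1', hlen]
          rcases h4 with ⟨h4, -⟩ | ⟨b', c₀, ls, m, h4, h5, h6, h7, h8⟩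
          · rw [h4] at hc
            simp at hc
          · refine .inr ⟨b', c₀, ls ++ [b], m + 1, h4, by simp [h5], h6, by omega,
              fun n ls' hA => ?_⟩
            have := h8 (n + 1) (b :: ls') (.write
              (hch (by rw [h3, h5]; simp [OracleTape.queryWord])) (by rw [h3]; rfl) hc' hS hao hA)
            rw [show n + (m + 1) = n + 1 + m by omega]
            simpa using this
      · rw [hc.1] at h2
        cases h2
    · have hq : c.oracle.queryWord = [] := by
        rcases h.oracle with ⟨h2, h3, h4⟩ | ⟨h2, v, h3, -⟩
        · rcases h4 with ⟨h4, h5⟩ | ⟨b', c₀, ls, m, h4, -⟩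
          · rw [h3, h5]; rfl
          · exact absurd ⟨h2, by rw [h4]; rfl⟩ hc
        · rw [h3]; rfl
      refine ⟨[b], some (b, a.next), false,
        { s' with reg := fun u => (saveBank u).elim 0 s'.reg }, fun k => ?_, fun c' hc' => ?_,
        fun hn => by rw [hstep] at hn; cases hn⟩
      · simp only [oraclePart, hao]
        rw [if_neg hc, bind, ren, pure]
      have hr := hrun c' hc'
      have hc'' := hc'
      rw [hstep, Option.some.injEq] at hc''
      subst hc''
      refine ⟨hr, by simp, ?_, hrep _, hout, .inl ⟨rfl, ?_, ?_⟩⟩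
      · rintro (⟨j, v⟩ | u)
        · simp only [saveBank]; split_ifs <;> exact hlt _
        · exact hlt _
      · simp [Machine.advance, hq]
      · exact .inr ⟨b, _, [], 0, rfl, rfl, hrep _, Nat.zero_le _, fun n ls' hA => hA⟩
  · -- query
    obtain ⟨q', hq', info', hinfo', hlen', hQ⟩ : ∃ q', c.oracle.queryWord = q' ∧ ∃ info',
        (if ans then none else info) = info' ∧ q'.length ≤ l.length ∧
        QRep (β ^ width x.length) f x S info' q' fun v => s.reg (bank 1 v) := by
      rcases h.oracle with ⟨rfl, h3, h4⟩ | ⟨rfl, v, h3, -⟩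
      · refine ⟨q, by rw [h3]; rfl, info, rfl, h.len, ?_⟩
        rcases h4 with h4 | ⟨b', c₀, ls, m, h4, h5, h6, h7, h8⟩
        · exact .inl h4
        -- Submission closes the open-ended description of the query: the rerun from the saved
        -- configuration is now complete.
        · have := h8 1 [] (.query (hch (by rw [h3, h5]; simp [OracleTape.queryWord]))
            (by rw [h3]; rfl) hS hao)
          rw [List.append_nil] at this
          exact .inr ⟨b', c₀, _, ls, h4, h5, this, by omega, h6⟩
      · exact ⟨[], by rw [h3]; rfl, none, rfl, Nat.zero_le _, .inl ⟨rfl, rfl⟩⟩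
    let s'' : St A (Rg M F) :=
      { s' with reg := fun u => (if u = ctr 1 then none else some u).elim 0 s'.reg }
    have hlt'' : ∀ u, s''.reg u < β ^ width x.length := fun u => by
      simp only [s'']
      split_ifs
      · simp; omega
      · exact hlt u
    have h1'' : (fun v => s''.reg (bank 1 v)) = fun v => s.reg (bank 1 v) := funext fun v => by
      rw [← h1]; simp [s'', bank, ctr]
    rw [← h1''] at hQ
    refine ⟨q', info', true, s'', fun k => ?_, fun c' hc' => ?_, fun hn => ?_⟩
    · simp only [oraclePart, hao]
      rw [bind, ren, pure, hinfo']
    · obtain ⟨o, ho, rfl⟩ := Machine.step_eq_some_iff.1 hc'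
      rw [hao, OracleTape.act, hq'] at ho
      obtain ⟨v, hv, rfl⟩ := Option.map_eq_some_iff.1 ho
      refine ⟨hrun _ hc', by omega, hlt'', ?_, hout, .inr ⟨rfl, v, ?_, ?_, ?_, hv, hQ⟩⟩
      · have := hrep (.answer v 0)
        simpa [s'', bank, ctr] using this
      · simp [Machine.advance, s'']
      · simp [s'']
      · simp [s'']
    · refine ⟨rfl, ?_, hlen', hlt'', hQ⟩
      rw [Machine.step, hao, OracleTape.act, hq'] at hn
      simpa using hn
  · -- move
    rcases h.oracle with ⟨h2, h3, h4⟩ | ⟨h2, v, h3, h4, h5, h6⟩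
    · exact hsame (fun k => by simp only [oraclePart, hao, h3, OracleTape.scan, pure])
        (by rw [hao, h3]; rfl) (by simp [hao]) (by simp [hao])
    · let s'' : St A (Rg M F) := { s' with
        reg := Function.update s'.reg (ctr 1) (moveOn v d (s.reg (ctr 1))) }
      have hmv := moveOn_eq h4 d
      have hle : moveOn v d (s.reg (ctr 1)) ≤ l.length + 1 := by
        rw [hmv]
        have := Bool.toNat_le (posInc (readCell v (s.reg (ctr 1))) d)
        omega
      have hstep : M.step f x c a =
          some (M.advance x c a (.answer v (moveOn v d (s.reg (ctr 1))))) :=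
        Machine.step_eq_some_iff.2 ⟨_, by rw [hao, h3]; rfl, rfl⟩
      refine ⟨q, info, ans, s'', fun k => ?_, fun c' hc' => ?_, fun hn => by
        rw [hstep] at hn; cases hn⟩
      · simp only [oraclePart, hao, h3, OracleTape.scan]
        rw [bind, affine, bind, dec, pure]
        congr 1
        simp only [s'']
        congr 1
        funext u
        by_cases hu : u = ctr 1
        · subst hu
          simp only [decide_true, Bool.true_and, if_true, one_mul, Function.update_self, hctr]
          rw [hmv]
          cases hd : posDec (readCell v (s.reg (ctr 1))) d
          · simp
          · have := posDec_pos hd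
            simp [this]
        · simp [hu]
      · have hr := hrun c' hc'
        have hc'' := hc'
        rw [hstep, Option.some.injEq] at hc''
        subst hc''
        refine ⟨hr, by have := h.len; omega, fun u => ?_, ?_, hout, .inr ⟨h2, v, ?_, ?_, ?_, h6.1, ?_⟩⟩
        · by_cases hu : u = ctr 1
          · subst hu; simp [s'']; omega
          · simpa [s'', hu] using hlt u
        · simpa [s'', bank, ctr] using hrep _
        · simp [s'', Machine.advance]
        · simp [s'', moveOn]
        · simpa [s''] using hle
        · convert h6.2 using 2 with u
          rw [← h1]; simp [s'', bank, ctr]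

end Den
end ModLog

/-! ### Simulating whole computations -/

namespace ModLog

open Rg

variable {A W : Type} {M F : Machine A} [Finite A]

/-- On input `x`, all numbers that occur in the simulation of `M` with oracle `f`, computed by `F`,
are less than `B`. -/
structure Fits (R : Type) [CommSemiring R] (M F : Machine A) (f : PartialFun A) (x : List A)
    (T S S' B : ℕ) : Prop where
  free : F.OracleFree
  det : M.DeterministicQueries f
  heads : ∀ c, M.Reachable f x c → ∀ t, c.head t + 1 < S
  time : ∀ l c, M.Run f x M.init l c → l.length ≤ T
  time_le : T + 2 ≤ B
  input_le : x.length + 2 ≤ B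
  space_le : symBase M.Sym ^ S ≤ B
  space_le' : symBase F.Sym ^ S' ≤ B
  pos : 0 < S
  pos' : 0 < S'
  heads' : ∀ q, q.length ≤ T → ∀ c, F.Reachable (noOracle A) q c → ∀ t, c.head t < S'
  dist : ∀ q, q.length ≤ T →
    F.dist R (noOracle A) q B F.init = (f q).elim 0 fun v => Finsupp.single v 1

namespace Den

variable [AddCommMonoid W] {R : Type} [CommSemiring R] [Module R W] {β T S S' : ℕ}
  {f : PartialFun A} {x : List A}

theorem scanOracle_eq (hfit : Fits R M F f x T S S' (β ^ width x.length)) {l : List M.Act}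
    {q : List A} {info : Option (A × M.State)} {ans : Bool} {c : M.Config}
    {s : St A (Rg M F)} (h : Sim f x S (β ^ width x.length) l q info ans c s) :
    ∃ s' : St A (Rg M F), Keep isSub (β ^ width x.length) s s' ∧
      ∀ k : _ → _ → W, scanOracle β info ans x s k = k c.oracle.scan s' := by
  have hq := h.len.trans (hfit.time _ _ h.run)
  have hT := hfit.time_le
  rcases h.oracle with ⟨rfl, h3, -⟩ | ⟨rfl, v, h3, h4, h5, h6, h7⟩
  · exact ⟨s, ⟨rfl, fun _ _ => rfl, h.lt⟩, fun k => by rw [h3]; rfl⟩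
  · refine ⟨⟨0, fun u => if isSub u then 0 else s.reg u, s.out⟩,
      ⟨rfl, fun u hu => by simp [hu], fun u => ?_⟩, fun k => ?_⟩
    · have := h.lt u
      simp only
      split_ifs <;> omega
    · rw [scanOracle, if_pos rfl, bind, oracleSym_eq (R := R) hfit.free hfit.input_le
        hfit.space_le hfit.space_le' (by omega) (hfit.heads' q hq) hfit.pos' (hfit.dist q hq) h.lt
        h7, h6, h3]
      rfl

/-- A query outside the domain is not detected when it is submitted. The next round computes a
symbol of its answer, which has total weight `0`; if no round is left, the exit itself has weight
`0`. -/
theorem iter_mainStep_eq_zero (hfit : Fits R M F f x T S S' (β ^ width x.length))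
    {q : List A} (hq : q.length ≤ T) (hf : f q = none) {info : Option (A × M.State)}
    {s : St A (Rg M F)} (hs : ∀ u, s.reg u < β ^ width x.length)
    (hQ : QRep (β ^ width x.length) f x S info q fun v => s.reg (bank 1 v))
    (k : Option (M.State × Option (A × M.State) × Bool) → St A (Rg M F) → W)
    (hk : ∀ d s, k (some d) s = 0) (p : M.State) (j : ℕ) :
    iter (mainStep β) j (some (p, info, true)) x s k = 0 := by
  have hT := hfit.time_le
  cases j with
  | zero => exact hk _ _
  | succ j =>
    rw [iter, bind, mainStep, bind, scanOracle, if_pos rfl, bind, oracleSym_eq (R := R) hfit.free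
      hfit.input_le hfit.space_le hfit.space_le' (by omega) (hfit.heads' q hq) hfit.pos'
      (hfit.dist q hq) hs hQ, hf]
    rfl

/-- `Sim` is the invariant. One round matches one unfolding of `dist`: the call for the scanned
answer symbol has net weight one on the true symbol, so the sum over the instructions of `M` is
reproduced exactly. -/
theorem iter_mainStep (hfit : Fits R M F f x T S S' (β ^ width x.length))
    (K : List A → W) (k : Option (M.State × Option (A × M.State) × Bool) → St A (Rg M F) → W)
    (hk : ∀ s, k none s = K s.out) (hk' : ∀ d s, k (some d) s = 0) (j : ℕ) {l : List M.Act}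
    {q : List A} {info : Option (A × M.State)} {ans : Bool} {c : M.Config}
    {s : St A (Rg M F)} (h : Sim f x S (β ^ width x.length) l q info ans c s) :
    iter (mainStep β) j (some (c.state, info, ans)) x s k =
      Finsupp.linearCombination R K (M.dist R f x j c) := by
  have hB := hfit.input_le
  induction j generalizing l q info ans c s with
  | zero => simp [iter, pure, hk', Machine.dist]
  | succ j ih =>
    obtain ⟨s₁, h1, h2⟩ := scanOracle_eq (W := W) hfit h
    have hpos : s₁.reg (bank 0 none) = c.inPos :=
      (h1.reg _ (by simp [isSub, bank])).trans h.rep.pos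
    let s₂ : St A (Rg M F) := ⟨c.inPos, Function.update s₁.reg (ctr 0) 0, s₁.out⟩
    have h3 : Keep isSub (β ^ width x.length) s₁ s₂ := by
      refine ⟨rfl, fun u hu => Function.update_of_ne ?_ _ _, fun u => ?_⟩
      · rintro rfl
        simp [isSub, ctr] at hu
      · by_cases hu : u = ctr 0
        · subst hu; simp [s₂]; omega
        · simpa [s₂, hu] using h1.lt u
    have h4 := h1.trans h3
    have hV : VRep M S x c fun v => s₂.reg (bank 0 v) := by
      convert h.rep using 2 with v
      exact h4.reg _ (by simp [isSub, bank])
    rw [iter, bind, mainStep, bind, h2, bind, vstep_eq (unbank_iff 0) (fun k => rfl) (fun k => by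
      rw [readAt_eq _ _ hB _ _ (by rw [hpos]; exact h.rep.pos_le), hpos]) hV h4.lt, Machine.dist]
    have hemp : M.choices x c = ∅ ↔ M.enabled x c = ∅ := by
      simp [Machine.choices]
    by_cases h5 : M.choices x c = ∅
    · by_cases h6 : c.state ∈ M.accept
      · have h7 : M.Accepting x c := ⟨hemp.1 h5, h6⟩
        simp only [if_pos h5, if_pos h6, if_pos h7]
        rw [pure, iter_const (body := mainStep β) rfl, pure, hk, h5]
        simp [h4.out, h.out]
      · have h7 : ¬ M.Accepting x c := fun h => h6 h.2
        simp only [if_pos h5, if_neg h6, if_neg h7]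
        rw [fail_eq, h5]
        simp
    · have h7 : ¬ M.Accepting x c := fun h => h5 (hemp.2 h.1)
      rw [if_neg h5, if_neg h7, zero_add, map_sum]
      refine Finset.sum_congr rfl fun a ha => ?_
      have ha' := Machine.mem_choices.1 ha
      have hS : ∀ t, (a.workMove t).apply (c.head t) < S := fun t => by
        have := hfit.heads c ⟨l, h.run⟩ t
        cases a.workMove t <;> simp only [Move.apply] <;> omega
      have hrep := fun o => hV.next (unbank_iff 0) hS o
      simp only
      rw [bind, act, Finset.sum_singleton, bind]
      obtain ⟨q', info', ans', s', h8, h9, h10⟩ := oraclePart_eq (W := W) h hfit.det hfit.heads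
        (fun l c hl => by have := hfit.time l c hl; have := hfit.time_le; omega) ha'
        (s' := ⟨moveOn x .stay (moveOn x .stay c.inPos),
          nextReg M (unbank 0) (bank 0) (readCell x c.inPos) a s₂.reg,
          s₁.out ++ a.out.toList⟩)
        ((hrep c.oracle).lt (unbank_iff 0) hB hfit.space_le fun u hu => by
          simp only [nextReg, hu]; exact h4.lt u)
        hrep (by simp [h1.out, h.out])
        (fun v => by
          rw [← h4.reg (bank 1 v) (by simp [isSub, bank])]
          simp [nextReg, unbank, bank])
        (by
          rw [← h4.reg (ctr 1) (by simp [isSub, ctr])]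
          simp [nextReg, unbank, ctr])
      refine (h8 _).trans ?_
      rw [pure]
      cases hstep : M.step f x c a with
      | none =>
        obtain ⟨rfl, h11, h12, h13, h14⟩ := h10 hstep
        rw [iter_mainStep_eq_zero hfit (h12.trans (hfit.time _ _ h.run)) h11 h13 h14 k hk']
        simp
      | some c' =>
        rw [Option.elim_some, ← ih (h9 c' hstep)]
        obtain ⟨o, -, rfl⟩ := Machine.step_eq_some_iff.1 hstep
        rfl

theorem mainLoop_eq (hfit : Fits R M F f x T S S' (β ^ width x.length)) (K : List A → W) :
    mainLoop β x (⟨x.length + 1, fun _ => 0, []⟩ : St A (Rg M F)) (fun _ s => K s.out) =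
      Finsupp.linearCombination R K (M.dist R f x (β ^ width x.length) M.init) := by
  have hB := hfit.input_le
  rw [mainLoop, bind, rep]
  refine iter_mainStep hfit K _ (fun s => rfl) (fun d s => fail_eq _ _) _ (l := []) (q := [])
    (c := M.init) ⟨.nil _, le_rfl, fun u => by simp; omega, VRep.init hfit.pos fun v => rfl, rfl,
      .inl ⟨rfl, rfl, .inl ⟨rfl, rfl⟩⟩⟩

end Den

namespace Real

variable {β L : ℕ} [NeZero β] [AddCommMonoid W]

omit [Finite A] in
theorem oraclePart {ℓ : ℕ} (o : Option (Marked A)) (info : Option (A × M.State)) (ans : Bool)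
    (a : M.Act) : Real β L ℓ (Den.oraclePart β o info ans a : Den A (Rg M F) W _) := by
  unfold Den.oraclePart
  split
  · exact pure _
  · split_ifs
    · exact pure _
    · exact (ren _).bind fun _ => pure _
  · exact (ren _).bind fun _ => pure _
  · split
    · exact pure _
    · exact (affine _ _).bind fun _ => (dec _).bind fun _ => pure _

theorem scanOracle (hL : 3 ≤ L) (info : Option (A × M.State)) (ans : Bool) :
    Real β L 3 (Den.scanOracle β info ans : Den A (Rg M F) W _) := by
  unfold Den.scanOracle
  split_ifs
  · exact (oracleSym hL info).bind fun _ => pure _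
  · exact pure _

theorem mainStep (hL : 3 ≤ L) (d : Option (M.State × Option (A × M.State) × Bool)) :
    Real β L 3 (Den.mainStep β d : Den A (Rg M F) W _) := by
  rcases d with - | ⟨q, info, ans⟩
  · exact pure _
  · refine (scanOracle hL info ans).bind fun o =>
      (vstep q ((readAt (by omega) _ _).mono (by omega)) (pure _)).bind fun r => ?_
    rcases r with - | a
    · dsimp only
      split_ifs
      · exact pure _
      · exact fail
    · exact (act _).bind fun _ => (oraclePart o info ans a).bind fun _ => pure _

/-- Four loops are nested, each with its own counter: locating an input cell, rerunning a query,
running `F`, and running `M`. -/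
theorem mainLoop (hL : 4 ≤ L) : Real β L 4 (Den.mainLoop β : Den A (Rg M F) W Unit) := by
  refine (rep (ℓ := 3) hL (fun d => mainStep (by omega) d) _).bind fun d => ?_
  rcases d with - | d
  · exact pure _
  · exact fail

end Real
end ModLog

/-! ### Choice of the bounds and conclusion -/

namespace ModLog

theorem PolyBdd.comp {g h : ℕ → ℕ} (hg : PolyBdd g) (hh : PolyBdd h) :
    PolyBdd fun n => g (h n) := by
  obtain ⟨c, hc⟩ := hg
  exact ((hh.add (.const 3)).pow c).mono fun n => hc (h n)

variable {A : Type}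

/-- Membership in `FUL` becomes an exact identity over `ZMod k`: the distribution is a point mass or
`0`. This is the form in which it enters the simulation. -/
theorem Machine.dist_of_computesMod [Finite A] {k : ℕ} {F : Machine A} {f : PartialFun A}
    (h : ComputesMod k F (noOracle A) f) {q : List A} {j : ℕ}
    (hj : ∀ l c, F.Run (noOracle A) q F.init l c → l.length < j) :
    F.dist (ZMod k) (noOracle A) q j F.init = (f q).elim 0 fun v => Finsupp.single v 1 := by
  ext y
  rw [← F.accOut_eq_dist (ZMod k) _ _ j hj]
  by_cases hy : f q = some y
  · have := (ZMod.natCast_eq_natCast_iff _ _ k).2 ((h q y).1 hy)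
    rw [this, hy]
    simp
  · have := (ZMod.natCast_eq_natCast_iff _ _ k).2 ((h q y).2 hy)
    rw [this]
    cases hv : f q with
    | none => simp
    | some v =>
      have : v ≠ y := by rintro rfl; exact hy hv
      simp [this]

/-- Queries are no longer than the running time `T` of `M`, so time and space of `F` are measured at
`T n`. All quantities are polynomial in `n`, and one exponent `c` makes base `4 ^ c` large enough
for all of them, by `pow_le_pow_width`. -/
theorem exists_fits [Finite A] {k : ℕ} {F M : Machine A} {f : PartialFun A} (hF : IsNLMachine F)
    (hf : ComputesMod k F (noOracle A) f) (hM : M.IsLogSpaceMachine f) :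
    ∃ c, 2 ≤ 4 ^ c ∧ ∀ x, ∃ T S S',
      Fits (ZMod k) M F f x T S S' ((4 ^ c) ^ width x.length) := by
  obtain ⟨hfree, ⟨D, hD⟩, ⟨E, hE⟩, -⟩ := hF
  obtain ⟨⟨C, hC⟩, ⟨K, hK⟩, hdet⟩ := hM
  let T : ℕ → ℕ := fun n => K * n ^ K + K
  -- This leaves room for one further move of the heads, which is needed even if the oracle refuses
  -- the query and the step has no successor.
  let S : ℕ → ℕ := fun n => C * (Nat.log 2 n + 1) + 2
  let S' : ℕ → ℕ := fun n => D * (Nat.log 2 (T n) + 1) + 1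
  have hpoly : ∀ K : ℕ, PolyBdd fun n => K * n ^ K + K := fun K =>
    ((PolyBdd.const K).mul (PolyBdd.id.pow K)).add (.const K)
  have hT : PolyBdd T := hpoly K
  obtain ⟨c, hc⟩ : PolyBdd fun n => n + 2 + (T n + 2) + symBase M.Sym ^ S n +
      symBase F.Sym ^ S' n + (E * T n ^ E + E + 1) := by
    refine ((((PolyBdd.id.add (.const 2)).add (hT.add (.const 2))).add ?_).add ?_).add
      (((hpoly E).comp hT).add (.const 1))
    · simp only [S, pow_add]
      exact (PolyBdd.pow_log _ _).mul (.const _)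
    · simp only [S', pow_add]
      exact ((PolyBdd.pow_log _ _).comp hT).mul (.const _)
  have hc0 : c ≠ 0 := by
    rintro rfl
    have := hc 0
    simp only [pow_zero] at this
    omega
  refine ⟨c, ?_, fun x => ⟨T x.length, S x.length, S' x.length, ?_⟩⟩
  · calc 2 ≤ 4 ^ 1 := by norm_num
      _ ≤ 4 ^ c := Nat.pow_le_pow_right (by norm_num) (by omega)
  have hB := (hc x.length).trans (pow_le_pow_width c x.length)
  simp only at hB
  refine ⟨hfree, hdet, fun c hr t => ?_, fun l c hl => hK x l c hl, by omega, by omega, by omega,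
    by omega, by simp only [S]; omega, by simp only [S']; omega, fun q hq c hr t => ?_,
    fun q hq => Machine.dist_of_computesMod hf fun l c hl => ?_⟩
  · have := hC x c hr t
    simp only [S]
    omega
  · have h1 := hD q c hr t
    have h2 : D * (Nat.log 2 q.length + 1) ≤ D * (Nat.log 2 (T x.length) + 1) :=
      Nat.mul_le_mul le_rfl (Nat.add_le_add_right (Nat.log_mono_right hq) 1)
    simp only [S']
    omega
  · have h1 := hE q l c hl
    have h2 : E * q.length ^ E ≤ E * T x.length ^ E :=
      Nat.mul_le_mul le_rfl (Nat.pow_le_pow_left hq E)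
    omega

/-- Oracles in `FUL[k]` can be eliminated. -/
theorem exists_machine_without_oracle [Finite A] {k : ℕ} {f : PartialFun A} (hf : f ∈ FUL k A)
    {M : Machine A} (hM : M.IsLogSpaceMachine f) :
    ∃ N : Machine A, IsNLMachine N ∧
      (∀ x, N.acc (noOracle A) x ≡ M.acc f x [MOD k]) ∧
      (∀ x y, N.accOut (noOracle A) x y ≡ M.accOut f x y [MOD k]) := by
  obtain ⟨F, hF, hFf⟩ := hf
  obtain ⟨c, hc, hfit⟩ := exists_fits hF hFf hM
  have : NeZero (4 ^ c) := ⟨by omega⟩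
  have : Nonempty (Rg M F) := ⟨Rg.ctr 0⟩
  obtain ⟨N, hN, hdist⟩ := Real.exists_machine hc
    (Real.mainLoop (M := M) (F := F) (β := 4 ^ c) (W := List A →₀ ZMod k) (L := 4) le_rfl)
  have key : ∀ x, ∃ T T', (∀ l c, N.Run (noOracle A) x N.init l c → l.length < T) ∧
      (∀ l c, M.Run f x M.init l c → l.length < T') ∧
      N.dist (ZMod k) (noOracle A) x T N.init = M.dist (ZMod k) f x T' M.init := by
    intro x
    obtain ⟨T, hT, h⟩ := hdist x
    obtain ⟨T', S, S', hx⟩ := hfit x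
    refine ⟨T, (4 ^ c) ^ width x.length, hT, fun l c hl => ?_, ?_⟩
    · have := hx.time l c hl
      have := hx.time_le
      omega
    -- With point masses as weights, the linear combination is the distribution itself.
    · rw [h, Den.mainLoop_eq hx fun y => Finsupp.single y 1, Finsupp.linearCombination_apply]
      simp [Finsupp.sum_single]
  refine ⟨N, hN, fun x => ?_, fun x y => ?_⟩
  · obtain ⟨T, T', hT, hT', h⟩ := key x
    rw [← ZMod.natCast_eq_natCast_iff, N.acc_eq_dist _ _ _ T hT, M.acc_eq_dist _ _ _ T' hT', h]
  · obtain ⟨T, T', hT, hT', h⟩ := key x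
    rw [← ZMod.natCast_eq_natCast_iff, N.accOut_eq_dist _ _ _ T hT,
      M.accOut_eq_dist _ _ _ T' hT', h]

/-- Ordinary machines are by definition run with this oracle, which gives the trivial inclusions. A
machine that never accepts computes it. -/
theorem noOracle_mem_FUL (k : ℕ) (A : Type) : noOracle A ∈ FUL k A := by
  let M : Machine A :=
    { State := Unit, Sym := Unit, Tape := Empty, finiteState := inferInstance
      finiteSym := inferInstance, finiteTape := inferInstance, blank := (), start := ()
      accept := ∅, δ := fun _ _ _ _ => ∅ }
  refine ⟨M, ⟨fun _ _ _ _ _ h => absurd h (Set.notMem_empty _),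
    ⟨0, fun _ _ _ i => i.elim⟩, ⟨0, fun x l c h => ?_⟩,
      fun _ _ _ _ _ h => absurd h (Set.notMem_empty _)⟩,
    fun x y => ⟨fun h => absurd h (by simp [noOracle]), fun _ => ?_⟩⟩
  · cases h with
    | nil => simp
    | cons ha => exact absurd ha (Set.notMem_empty _)
  · have : {l : List M.Act | ∃ c, M.Run (noOracle A) x M.init l c ∧ M.Accepting x c ∧ c.out = y} =
        ∅ := Set.eq_empty_of_forall_notMem fun l ⟨c, _, h, _⟩ => h.2
    rw [Machine.accOut, this, Set.ncard_empty]

end ModLog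

theorem mainTheorem7 (A : Type) [Finite A] (k : ℕ) (hk : 2 ≤ k) :
    ModLog.ModLRel k (ModLog.FUL k A) = ModLog.ModL k A ∧
    ModLog.coModLRel k (ModLog.FUL k A) = ModLog.coModL k A ∧
    ModLog.FULRel k (ModLog.FUL k A) = ModLog.FUL k A ∧
    (∀ f ∈ ModLog.FUL k A, ∀ M : ModLog.Machine A, M.IsLogSpaceMachine f →
      ∃ N : ModLog.Machine A, ModLog.IsNLMachine N ∧
        (∀ x, N.acc (ModLog.noOracle A) x ≡ M.acc f x [MOD k]) ∧
        (∀ x y, N.accOut (ModLog.noOracle A) x y ≡ M.accOut f x y [MOD k])) := by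
  have h0 := ModLog.noOracle_mem_FUL k A
  have iff_of_modEq : ∀ {a b c : ℕ}, a ≡ b [MOD k] → (a ≡ c [MOD k] ↔ b ≡ c [MOD k]) :=
    fun h => ⟨h.symm.trans, h.trans⟩
  refine ⟨?_, ?_, ?_, fun f hf M hM => ModLog.exists_machine_without_oracle hf hM⟩
  · ext L
    constructor
    · rintro ⟨f, hf, φ, ⟨M, hM, hφ⟩, hL⟩
      obtain ⟨N, hN, h, -⟩ := ModLog.exists_machine_without_oracle hf hM
      refine ⟨_, ⟨N, hN, fun _ => rfl⟩, fun x => ?_⟩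
      rw [hL, hφ, iff_of_modEq (h x)]
    · rintro ⟨φ, ⟨M, hM, hφ⟩, hL⟩
      exact ⟨_, h0, φ, ⟨M, hM.2, hφ⟩, hL⟩
  · ext L
    constructor
    · rintro ⟨f, hf, φ, ⟨M, hM, hφ⟩, hL⟩
      obtain ⟨N, hN, h, -⟩ := ModLog.exists_machine_without_oracle hf hM
      refine ⟨_, ⟨N, hN, fun _ => rfl⟩, fun x => ?_⟩
      rw [hL, hφ, iff_of_modEq (h x)]
    · rintro ⟨φ, ⟨M, hM, hφ⟩, hL⟩
      exact ⟨_, h0, φ, ⟨M, hM.2, hφ⟩, hL⟩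
  · ext g
    constructor
    · rintro ⟨f, hf, M, hM, hg⟩
      obtain ⟨N, hN, -, h⟩ := ModLog.exists_machine_without_oracle hf hM
      exact ⟨N, hN, fun x y => ⟨fun hy => (h x y).trans ((hg x y).1 hy),
        fun hy => (h x y).trans ((hg x y).2 hy)⟩⟩
    · rintro ⟨M, hM, hg⟩
      exact ⟨_, h0, M, hM.2, hg⟩
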